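/- **Proposition (MISE of the directional-linear kernel density estimator).** Let $q\ge 1$, let $\Omega_q=\{\mathbf{x}\in\mathbb{R}^{q+1}:\|\mathbf{x}\|=1\}$ with surface measure $\omega_q$, and let $f$ be a probability density on $\Omega_q\times\mathbb{R}$ with respect to $\omega_q(d\mathbf{x})\,dz$. Let $(\mathbf{X}_1,Z_1),(\mathbf{X}_2,Z_2),\dots$ be independent random variables with density $f$. Assume: - **DL1.** Extend $f$ to $\{(\mathbf{x},z)\in\mathbb{R}^{q+2}:\mathbf{x}\ne\mathbf{0}\}$ by $f(\mathbf{x},z)=f(\mathbf{x}/\|\mathbf{x}\|,z)$. The gradient $\nabla f$ and the Hessian matrix $\mathcal{H}f$ of the extension exist and are continuous on this set, and their entries are square integrable on $\Omega_q\times\mathbb{R}$ with respect to $\omega_q(d\mathbf{x})\,dz$. - **DL2.** $L:[0,\infty)\to[0,\infty)$ is bounded and Riemann integrable with $0<\int_0^\infty L^k(r)\,r^{\frac m2-1}\,dr<\infty$ for all integers $m\ge1$ and $k=1,2$; $K$ is a bounded probability density on $\mathbb{R}$, symmetric around zero, with finite second moment. - **DL3.** $h=h_n$ and $g=g_n$ are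 sequences of positive numbers with $h_n\to0$, $g_n\to0$ and $n h_n^q g_n\to\infty$ as $n\to\infty$. Put $$c_{h,q}(L)^{-1}=\int_{\Omega_q}L\Big(\frac{1-\mathbf{x}^T\mathbf{y}}{h^2}\Big)\,\omega_q(d\mathbf{y})$$ (which does not depend on $\mathbf{x}\in\Omega_q$), $$b_q(L)=\frac{\int_0^\infty L(r)r^{\frac q2}\,dr}{\int_0^\infty L(r)r^{\frac q2-1}\,dr},\qquad d_q(L)=\frac{\int_0^\infty L^2(r)r^{\frac q2-1}\,dr}{\int_0^\infty L(r)r^{\frac q2-1}\,dr},\qquad \mu_2(K)=\int_{\mathbb{R}}v^2K(v)\,dv,\qquad R(K)=\int_{\mathbb{R}}K^2(v)\,dv,$$ $$\Psi_\mathbf{x}(f,\mathbf{x},z)=-\mathbf{x}^T\nabla_\mathbf{x}f(\mathbf{x},z)+q^{-1}\big(\nabla^2_\mathbf{x}f(\mathbf{x},z)-\mathbf{x}^T\mathcal{H}_\mathbf{x}f(\mathbf{x},z)\,\mathbf{x}\big),\qquad \mathcal{H}_zf=\frac{\partial^2f}{\partial z^2},$$ where $\nabla_\mathbf{x}$, $\nabla^2_\mathbf{x}$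 and $\mathcal{H}_\mathbf{x}$ are the gradient, the Laplacian and the Hessian matrix in the variable $\mathbf{x}$, and $I[\phi]=\int_{\Omega_q\times\mathbb{R}}\phi(\mathbf{x},z)\,dz\,\omega_q(d\mathbf{x})$. Let $$\hat f_{h,g}(\mathbf{x},z)=\frac{c_{h,q}(L)}{ng}\sum_{i=1}^nL\Big(\frac{1-\mathbf{x}^T\mathbf{X}_i}{h^2}\Big)K\Big(\frac{z-Z_i}{g}\Big),\qquad \mathrm{MISE}\big[\hat f_{h,g}\big]=\int_{\Omega_q\times\mathbb{R}}\mathbb{E}\big[(\hat f_{h,g}(\mathbf{x},z)-f(\mathbf{x},z))^2\big]\,dz\,\omega_q(d\mathbf{x}).$$ Then $\mathrm{MISE}\big[\hat f_{h,g}\big]$ is finite for all sufficiently large $n$ and, as $n\to\infty$, $$\mathrm{MISE}\big[\hat f_{h,g}\big]=b_q(L)^2\,I\big[\Psi_\mathbf{x}(f,\cdot,\cdot)^2\big]h^4+\tfrac14\mu_2(K)^2\,I\big[(\mathcal{H}_zf)^2\big]g^4+b_q(L)\mu_2(K)\,I\big[\Psi_\mathbf{x}(f,\cdot,\cdot)\,\mathcal{H}_zf\big]h^2g^2+\frac{c_{h,q}(L)}{ng}\,d_q(L)R(K)+o\big(h^4+g^4+(nh^qg)^{-1}\big).$$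 -/

import Mathlib

open MeasureTheory ProbabilityTheory Filter Topology Asymptotics

namespace DirLin

noncomputable section

/-- The ambient Euclidean space `ℝ^(q+1)` of the `q`-dimensional sphere. -/
abbrev Amb (q : ℕ) : Type := EuclideanSpace ℝ (Fin (q + 1))

/-- The sphere `Ω_q`, the set of unit vectors of `ℝ^(q+1)`. -/
abbrev Sph (q : ℕ) : Type := Metric.sphere (0 : Amb q) 1

/-- The surface (Lebesgue) measure `ω_q` on `Ω_q`. -/
def surf (q : ℕ) : Measure (Sph q) := (volume : Measure (Amb q)).toSphere

/-- The measure `ω_q(dx) dz` on `Ω_q × ℝ`. -/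
def cyl (q : ℕ) : Measure (Sph q × ℝ) := (surf q).prod volume

/-- `f` is a probability density on `Ω_q × ℝ` with respect to `ω_q(dx) dz`. -/
structure IsDensity {q : ℕ} (f : Sph q × ℝ → ℝ) : Prop where
  nonneg : ∀ p, 0 ≤ f p
  integrable : Integrable f (cyl q)
  integral_eq_one : ∫ p, f p ∂(cyl q) = 1

/-- The probability law on `Ω_q × ℝ` with density `f`. -/
def law {q : ℕ} (f : Sph q × ℝ → ℝ) : Measure (Sph q × ℝ) :=
  (cyl q).withDensity fun p => ENNReal.ofReal (f p)

/-! ### Extension of the density and its derivatives -/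

/-- Radial extension `f(x, z) = f(x / ‖x‖, z)` for `x ≠ 0` (the value at `x = 0` is irrelevant). -/
def radialExt {q : ℕ} (f : Sph q × ℝ → ℝ) (p : Amb q × ℝ) : ℝ :=
  if hp : p.1 = 0 then 0
  else f (⟨‖p.1‖⁻¹ • p.1, by simp [norm_smul, hp]⟩, p.2)

/-- A point of `Ω_q × ℝ` as a point of `ℝ^(q+1) × ℝ`. -/
def emb {q : ℕ} (p : Sph q × ℝ) : Amb q × ℝ := ((p.1 : Amb q), p.2)

/-- The coordinate directions of `ℝ^(q+1) × ℝ`: the directional ones `x_1, …, x_(q+1)`, then `z`. -/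
def coordDir {q : ℕ} : Fin (q + 1) ⊕ Unit → Amb q × ℝ
  | Sum.inl i => (EuclideanSpace.single i 1, 0)
  | Sum.inr _ => (0, 1)

/-- The entries of the gradient: the partial derivative `∂F/∂a`. -/
def grad {q : ℕ} (F : Amb q × ℝ → ℝ) (p : Amb q × ℝ) (a : Fin (q + 1) ⊕ Unit) : ℝ :=
  fderiv ℝ F p (coordDir a)

/-- The entries of the Hessian matrix: the second partial derivative `∂²F/∂a∂b`. -/
def hess {q : ℕ} (F : Amb q × ℝ → ℝ) (p : Amb q × ℝ) (a b : Fin (q + 1) ⊕ Unit) : ℝ :=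
  fderiv ℝ (fun p' => grad F p' b) p (coordDir a)

/-- `𝓗_z f` at a point of `Ω_q × ℝ`. -/
def hessZ {q : ℕ} (f : Sph q × ℝ → ℝ) (p : Sph q × ℝ) : ℝ :=
  hess (radialExt f) (emb p) (Sum.inr ()) (Sum.inr ())

/-- `Ψ_x(f, x, z) = - xᵀ ∇_x f + q⁻¹ (∇²_x f - xᵀ 𝓗_x f x)` at a point of `Ω_q × ℝ`. -/
def psiX {q : ℕ} (f : Sph q × ℝ → ℝ) (p : Sph q × ℝ) : ℝ :=
  -(∑ i, (p.1 : Amb q) i * grad (radialExt f) (emb p) (Sum.inl i)) +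
    (q : ℝ)⁻¹ * ((∑ i, hess (radialExt f) (emb p) (Sum.inl i) (Sum.inl i)) -
      ∑ i, ∑ j, (p.1 : Amb q) i * hess (radialExt f) (emb p) (Sum.inl i) (Sum.inl j) * (p.1 : Amb q) j)

/-! ### The conditions on density, kernels and bandwidths -/

/-- The extended density is twice continuously differentiable off `x = 0`, and all entries of its
gradient and of its Hessian matrix are square integrable on `Ω_q × ℝ`. -/
structure SmoothDensity {q : ℕ} (f : Sph q × ℝ → ℝ) : Prop where
  contDiffOn : ContDiffOn ℝ 2 (radialExt f) {p | p.1 ≠ 0}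
  grad_sq : ∀ a, MemLp (fun p => grad (radialExt f) (emb p) a) 2 (cyl q)
  hess_sq : ∀ a b, MemLp (fun p => hess (radialExt f) (emb p) a b) 2 (cyl q)

/-- `L` is Riemann integrable on the interval `[0, b]`. -/
def RiemannIntegrableOn (L : ℝ → ℝ) (b : ℝ) (hb : 0 < b) : Prop :=
  BoxIntegral.Integrable
    (BoxIntegral.Box.mk (fun _ : Fin 1 => (0 : ℝ)) (fun _ => b) (fun _ => hb))
    BoxIntegral.IntegrationParams.Riemann (fun x : Fin 1 → ℝ => L (x 0))
    BoxIntegral.BoxAdditiveMap.volume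

/-- Directional kernel; only the values `L r` with `0 ≤ r` matter. Convergence of the improper
integral of `L` over `[0, ∞)` is contained in `moment_integrable` (`m = 2`, `k = 1`). -/
structure IsDirKernel (L : ℝ → ℝ) : Prop where
  nonneg : ∀ r, 0 ≤ r → 0 ≤ L r
  bounded : ∃ M, ∀ r, 0 ≤ r → L r ≤ M
  riemann : ∀ b, ∀ hb : 0 < b, RiemannIntegrableOn L b hb
  moment_integrable : ∀ m : ℕ, 1 ≤ m → ∀ k : ℕ, k = 1 ∨ k = 2 →
    IntegrableOn (fun r => L r ^ k * r ^ ((m : ℝ) / 2 - 1)) (Set.Ioi 0)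
  moment_pos : ∀ m : ℕ, 1 ≤ m → ∀ k : ℕ, k = 1 ∨ k = 2 →
    0 < ∫ r in Set.Ioi (0 : ℝ), L r ^ k * r ^ ((m : ℝ) / 2 - 1)

/-- Linear kernel: a bounded density on `ℝ`, symmetric around zero, with finite second moment. -/
structure IsLinKernel (K : ℝ → ℝ) : Prop where
  measurable : Measurable K
  nonneg : ∀ v, 0 ≤ K v
  integrable : Integrable K
  integral_eq_one : ∫ v, K v = 1
  symmetric : ∀ v, K (-v) = K v
  bounded : ∃ M, ∀ v, K v ≤ M
  second_moment : Integrable fun v => v ^ 2 * K v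

/-- Bandwidth sequences: `h_n, g_n > 0`, `h_n → 0`, `g_n → 0` and `n h_n^q g_n → ∞`. -/
structure IsBandwidth (q : ℕ) (h g : ℕ → ℝ) : Prop where
  h_pos : ∀ n, 0 < h n
  g_pos : ∀ n, 0 < g n
  h_tendsto : Tendsto h atTop (𝓝 0)
  g_tendsto : Tendsto g atTop (𝓝 0)
  nhg_tendsto : Tendsto (fun n : ℕ => (n : ℝ) * h n ^ q * g n) atTop atTop

/-! ### Constants of the kernels -/

/-- `∫_{Ω_q} L((1 - xᵀy) / h²) ω_q(dy)`. -/
def kernelMass (q : ℕ) (L : ℝ → ℝ) (h : ℝ) (x : Sph q) : ℝ :=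
  ∫ y : Sph q, L ((1 - inner ℝ (x : Amb q) (y : Amb q)) / h ^ 2) ∂(surf q)

/-- A reference point of `Ω_q`. -/
def pole (q : ℕ) : Sph q := ⟨EuclideanSpace.single 0 1, by simp⟩

/-- The normalizing constant `c_{h,q}(L)`: the inverse of `∫_{Ω_q} L((1 - xᵀy) / h²) ω_q(dy)`, which
does not depend on `x ∈ Ω_q` (see `normConst_eq`). -/
def normConst (q : ℕ) (L : ℝ → ℝ) (h : ℝ) : ℝ := (kernelMass q L h (pole q))⁻¹

/-- `b_q(L) = ∫₀^∞ L(r) r^(q/2) dr / ∫₀^∞ L(r) r^(q/2-1) dr`. -/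
def bConst (q : ℕ) (L : ℝ → ℝ) : ℝ :=
  (∫ r in Set.Ioi (0 : ℝ), L r * r ^ ((q : ℝ) / 2)) /
    ∫ r in Set.Ioi (0 : ℝ), L r * r ^ ((q : ℝ) / 2 - 1)

/-- `d_q(L) = ∫₀^∞ L²(r) r^(q/2-1) dr / ∫₀^∞ L(r) r^(q/2-1) dr`. -/
def dConst (q : ℕ) (L : ℝ → ℝ) : ℝ :=
  (∫ r in Set.Ioi (0 : ℝ), L r ^ 2 * r ^ ((q : ℝ) / 2 - 1)) /
    ∫ r in Set.Ioi (0 : ℝ), L r * r ^ ((q : ℝ) / 2 - 1)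

/-- `μ₂(K) = ∫ v² K(v) dv`. -/
def mu2 (K : ℝ → ℝ) : ℝ := ∫ v, v ^ 2 * K v

/-- `R(K) = ∫ K(v)² dv`. -/
def roughness (K : ℝ → ℝ) : ℝ := ∫ v, K v ^ 2

/-! ### The estimator and its mean integrated squared error -/

/-- The directional-linear kernel density estimator at the point `p = (x, z)`, computed from the
sample `s 0, …, s (n-1)` of points `s i = (X_i, Z_i)`. -/
def estimator {q : ℕ} (L K : ℝ → ℝ) (h g : ℝ) (n : ℕ) (s : ℕ → Sph q × ℝ) (p : Sph q × ℝ) : ℝ :=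
  normConst q L h / (n * g) * ∑ i ∈ Finset.range n,
    L ((1 - inner ℝ (p.1 : Amb q) ((s i).1 : Amb q)) / h ^ 2) * K ((p.2 - (s i).2) / g)

/-- `MISE = ∫ E[(f̂(u) - f(u))²] ν(du)`, as an element of `[0, ∞]`. -/
def mise {Ω α : Type*} [MeasurableSpace Ω] [MeasurableSpace α] (P : Measure Ω) (ν : Measure α)
    (fhat : Ω → α → ℝ) (f : α → ℝ) : ENNReal :=
  ∫⁻ u, ∫⁻ ω, ENNReal.ofReal ((fhat ω u - f u) ^ 2) ∂P ∂ν

/-- `MISE[f̂_{h,g}]`, with expectation over the random sample `S 0, …, S (n-1)` and the outer integral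
with respect to `ω_q(dx) dz`. -/
def dlMise {q : ℕ} {Ω : Type*} [MeasurableSpace Ω] (P : Measure Ω) (S : ℕ → Ω → Sph q × ℝ)
    (f : Sph q × ℝ → ℝ) (L K : ℝ → ℝ) (h g : ℝ) (n : ℕ) : ENNReal :=
  mise P (cyl q) (fun ω => estimator L K h g n (fun i => S i ω)) f

/-- `I[φ] = ∫_{Ω_q × ℝ} φ(x, z) dz ω_q(dx)`. -/
def cylInt {q : ℕ} (φ : Sph q × ℝ → ℝ) : ℝ := ∫ p, φ p ∂(cyl q)

/-! ### The normalizing constant does not depend on the point -/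

/-- The action of a linear isometry of `ℝ^(q+1)` on `Ω_q`. -/
def rotSph {q : ℕ} (T : Amb q ≃ₗᵢ[ℝ] Amb q) (y : Sph q) : Sph q :=
  ⟨T y, by simp⟩

theorem continuous_rotSph {q : ℕ} (T : Amb q ≃ₗᵢ[ℝ] Amb q) : Continuous (rotSph T) :=
  Continuous.subtype_mk (T.continuous.comp continuous_subtype_val) _

/-- The action of a linear isometry on `Ω_q`, as an equivalence of measurable spaces. -/
def rotEquiv {q : ℕ} (T : Amb q ≃ₗᵢ[ℝ] Amb q) : Sph q ≃ᵐ Sph q where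
  toFun := rotSph T
  invFun := rotSph T.symm
  left_inv y := by ext1; simp [rotSph]
  right_inv y := by ext1; simp [rotSph]
  measurable_toFun := (continuous_rotSph T).measurable
  measurable_invFun := (continuous_rotSph T.symm).measurable

open scoped Pointwise in
theorem map_rotEquiv_surf {q : ℕ} (T : Amb q ≃ₗᵢ[ℝ] Amb q) :
    (surf q).map (rotEquiv T) = surf q := by
  ext s hs
  rw [MeasurableEquiv.map_apply, surf,
    Measure.toSphere_apply' _ ((rotEquiv T).measurable hs), Measure.toSphere_apply' _ hs]
  congr 1
  have key : (T : Amb q → Amb q) ⁻¹' (Set.Ioo (0 : ℝ) 1 • ((↑) '' s : Set (Amb q))) =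
      Set.Ioo (0 : ℝ) 1 • ((↑) '' ((rotEquiv T : Sph q → Sph q) ⁻¹' s) : Set (Amb q)) := by
    ext v
    simp only [Set.mem_preimage, Set.mem_smul, Set.mem_image]
    constructor
    · rintro ⟨r, hr, _, ⟨y, hy, rfl⟩, hv⟩
      refine ⟨r, hr, _, ⟨rotSph T.symm y, ?_, rfl⟩, ?_⟩
      · have : rotEquiv T (rotSph T.symm y) = y := (rotEquiv T).right_inv y
        simpa [this] using hy
      · apply T.injective
        simp [rotSph, hv]
    · rintro ⟨r, hr, _, ⟨y, hy, rfl⟩, rfl⟩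
      exact ⟨r, hr, _, ⟨rotEquiv T y, hy, rfl⟩, by simp [rotEquiv, rotSph]⟩
  rw [← key]
  exact T.measurePreserving.measure_preimage_equiv (f := T.toMeasurableEquiv) _

theorem kernelMass_eq (q : ℕ) (L : ℝ → ℝ) (h : ℝ) (x y : Sph q) :
    kernelMass q L h x = kernelMass q L h y := by
  obtain ⟨T, hT⟩ : ∃ T : Amb q ≃ₗᵢ[ℝ] Amb q, T x = y :=
    ⟨_, Submodule.reflection_sub (v := (x : Amb q)) (w := (y : Amb q)) (by simp)⟩
  unfold kernelMass
  conv_rhs => rw [← map_rotEquiv_surf T]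
  rw [MeasureTheory.integral_map_equiv]
  simp [rotEquiv, rotSph, ← hT]

theorem normConst_eq (q : ℕ) (L : ℝ → ℝ) (h : ℝ) (x : Sph q) :
    normConst q L h =
      (∫ y : Sph q, L ((1 - inner ℝ (x : Amb q) (y : Amb q)) / h ^ 2) ∂(surf q))⁻¹ := by
  rw [normConst, kernelMass_eq q L h (pole q) x, kernelMass]

end

end DirLin

open DirLin

/-! For one observation `s`, put `W_p(s) = c_{h,q}(L) g⁻¹ L((1 - xᵀy)/h²) K((z - t)/g)` with `p =
(x, z)`, `s = (y, t)`, and let `E1`, `E2` be the mean and the second moment of `W_p` under the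
density `f`. By independence the mean squared error at `p` is `(E2 - E1²)/n + (E1 - f)²`, so the
MISE is an integrated variance plus an integrated squared bias (`dlMise_eq`).

Variance. By Tonelli `∫ E2` does not depend on `f` (`obsEnergy`), and the asymptotics of zonal
integrals (`tendsto_capMoment`) give the term with `d_q(L) R(K)`. Since `f` is not assumed square
integrable, `∫ E1²` needs an argument: `∫ E1 = 1`, and `E1` is at most `B` plus a multiple of `(h^q
g)⁻¹ ∫ (f - B)⁺`. For `B` large the second part is a small multiple of `(h^q g)⁻¹`, hence `n⁻¹ ∫
E1²` is `o((n h^q g)⁻¹)` (`integrated_mean_sq`).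

Bias. `E1` is `f` smoothed in `z` by `K` and then in the direction by the normalized zonal kernel.
As the directional smoothing is a contraction of `L²`, three estimates in `L²` suffice
(`obsMoment_sub_eq`): the second order expansion of the linear smoothing (`linAvg_sub_isLittleO`),
that of the directional smoothing (`dirAvg_sub_isLittleO`), and the convergence of the directional
smoothing of `𝓗_z f` (`dirAvg_sub_tendsto`).

The derivatives of `f` are continuous and square integrable, but neither bounded nor uniformly
continuous, so Taylor remainders are small only in mean square. Two tools make this work. A weighted
Cauchy–Schwarz inequality (`sqInt_average_le`) bounds the mean square of an averaged remainder by
the mean squares of the remainders for fixed displacement. And pointwise convergence together with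
convergence of norms implies convergence in `L²` (`tendsto_sqInt_sub_of_tendsto`). Norms are known
exactly, because translations in `z` and rotations preserve them.

On the sphere a displacement is made independent of the base point by lifting to the orthogonal
group: a point is `R p₀` with `R` Haar distributed and `p₀` the pole, and `R p₀` is compared with `R
y` along the chord in the ambient space. The extension is homogeneous of degree `0`, so its Hessian
has degree `-2`, and its mean square over rotations at a chord point `v` is `‖v‖⁻⁴` times its mean
square on `Ω_q × ℝ`. For `y` in the opposite hemisphere the chord may approach the origin, and a
detour through a third point replaces it. Averaging the Taylor polynomial, the symmetry of the zonal
weight leaves the moments `m1`, `m2` of `1 - y₀`: the part with `m1 ~ b_q(L) h²` is `Ψ_x`, the part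
with `m2 = O(h⁴)` is negligible. -/

namespace DirLin
open scoped ENNReal

/-! ### Mean square estimates: averaged remainders and convergence in `L²`. -/

section SquareIntegrals

variable {X Y : Type*} [MeasurableSpace X] [MeasurableSpace Y]

/-- The integral of the square of a real function, as an element of `[0, ∞]`. -/
noncomputable def sqInt (μ : Measure X) (φ : X → ℝ) : ℝ≥0∞ := ∫⁻ x, ENNReal.ofReal (φ x ^ 2) ∂μ

theorem ofReal_sq_eq_enorm_sq (a : ℝ) : ENNReal.ofReal (a ^ 2) = ‖a‖ₑ ^ 2 := by
  rw [Real.enorm_eq_ofReal_abs, ← ENNReal.ofReal_pow (abs_nonneg _), sq_abs]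

theorem lintegral_mul_sq_le (ν : Measure Y) {F G : Y → ℝ≥0∞} (hF : AEMeasurable F ν)
    (hG : AEMeasurable G ν) :
    (∫⁻ y, F y * G y ∂ν) ^ 2 ≤ (∫⁻ y, F y ^ 2 ∂ν) * ∫⁻ y, G y ^ 2 ∂ν := by
  have h := ENNReal.lintegral_mul_le_Lp_mul_Lq ν Real.HolderConjugate.two_two hF hG
  simp only [Pi.mul_apply, ENNReal.rpow_two] at h
  calc (∫⁻ y, F y * G y ∂ν) ^ 2
      ≤ ((∫⁻ y, F y ^ 2 ∂ν) ^ (1 / 2 : ℝ) * (∫⁻ y, G y ^ 2 ∂ν) ^ (1 / 2 : ℝ)) ^ 2 := by gcongr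
    _ = _ := by
      rw [mul_pow, ← ENNReal.rpow_two, ← ENNReal.rpow_two, ← ENNReal.rpow_mul, ← ENNReal.rpow_mul]
      norm_num

/-- Cauchy–Schwarz for the splitting `k D = √(k ρ) · √(k ρ⁻¹ D²)`. Where `ρ` vanishes the inverse is
`0` and the splitting would lose `D`, which is why `D` has to vanish there too. -/
theorem ofReal_sq_integral_le (ν : Measure Y) {k ρ D : Y → ℝ} (hk : AEMeasurable k ν)
    (hk0 : ∀ y, 0 ≤ k y) (hρ : AEMeasurable ρ ν) (hρ0 : ∀ y, 0 ≤ ρ y) (hD : AEMeasurable D ν)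
    (h0 : ∀ y, ρ y = 0 → D y = 0) :
    ENNReal.ofReal ((∫ y, k y * D y ∂ν) ^ 2) ≤
      (∫⁻ y, ENNReal.ofReal (k y * ρ y) ∂ν) *
        ∫⁻ y, ENNReal.ofReal (k y * ((ρ y)⁻¹ * D y ^ 2)) ∂ν := by
  have key := lintegral_mul_sq_le ν (F := fun y => ENNReal.ofReal √(k y * ρ y))
    (G := fun y => ENNReal.ofReal √(k y * ((ρ y)⁻¹ * D y ^ 2)))
    (hk.mul hρ).sqrt.ennreal_ofReal
    (hk.mul (hρ.inv.mul (hD.pow_const 2))).sqrt.ennreal_ofReal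
  have e1 : ∀ y, ENNReal.ofReal √(k y * ρ y) ^ 2 = ENNReal.ofReal (k y * ρ y) := fun y => by
    rw [← ENNReal.ofReal_pow (Real.sqrt_nonneg _), Real.sq_sqrt (mul_nonneg (hk0 y) (hρ0 y))]
  have e2 : ∀ y, ENNReal.ofReal √(k y * ((ρ y)⁻¹ * D y ^ 2)) ^ 2 =
      ENNReal.ofReal (k y * ((ρ y)⁻¹ * D y ^ 2)) := fun y => by
    rw [← ENNReal.ofReal_pow (Real.sqrt_nonneg _), Real.sq_sqrt]
    exact mul_nonneg (hk0 y) (mul_nonneg (inv_nonneg.2 (hρ0 y)) (sq_nonneg _))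
  simp only [e1, e2] at key
  refine le_trans ?_ key
  rw [ofReal_sq_eq_enorm_sq]
  gcongr
  refine (enorm_integral_le_lintegral_enorm _).trans (lintegral_mono fun y => ?_)
  rw [Real.enorm_eq_ofReal_abs, ← ENNReal.ofReal_mul (Real.sqrt_nonneg _),
    ← Real.sqrt_mul (mul_nonneg (hk0 y) (hρ0 y))]
  apply ENNReal.ofReal_le_ofReal
  apply Real.le_sqrt_of_sq_le
  rw [sq_abs]
  rcases (hρ0 y).eq_or_lt with h | h
  · rw [h0 y h.symm]; simp
  · apply le_of_eq; field_simp

/-- Square integral of an averaged remainder: if the remainder at `y` is of size `ρ y` in mean square,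
and small relative to `ρ y` on `U`, then its average is small up to the weight outside `U`. -/
theorem sqInt_average_le (μ : Measure X) (ν : Measure Y) [SFinite μ] [SFinite ν] {k ρ : Y → ℝ}
    {D : Y → X → ℝ} (hk : Measurable k) (hk0 : ∀ y, 0 ≤ k y) (hρ : Measurable ρ)
    (hρ0 : ∀ y, 0 ≤ ρ y) (hD : Measurable (Function.uncurry D)) (h0 : ∀ y x, ρ y = 0 → D y x = 0)
    {U : Set Y} (hU : MeasurableSet U) {ε C : ℝ}
    (hC : ∀ y, sqInt μ (D y) ≤ ENNReal.ofReal (C * ρ y ^ 2))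
    (hε : ∀ y ∈ U, sqInt μ (D y) ≤ ENNReal.ofReal (ε * ρ y ^ 2)) :
    sqInt μ (fun x => ∫ y, k y * D y x ∂ν) ≤
      (∫⁻ y, ENNReal.ofReal (k y * ρ y) ∂ν) *
        (ENNReal.ofReal ε * (∫⁻ y, ENNReal.ofReal (k y * ρ y) ∂ν) +
          ENNReal.ofReal C * ∫⁻ y in Uᶜ, ENNReal.ofReal (k y * ρ y) ∂ν) := by
  have hDy : ∀ x, Measurable fun y => D y x := fun x => hD.comp (measurable_id.prodMk measurable_const)
  have hmeas : Measurable fun p : X × Y =>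
      ENNReal.ofReal (k p.2 * ((ρ p.2)⁻¹ * D p.2 p.1 ^ 2)) := by
    have : Measurable fun p : X × Y => D p.2 p.1 := hD.comp measurable_swap
    fun_prop
  -- The factor `ρ⁻¹` from Cauchy–Schwarz cancels one of the two powers of `ρ`, so that both factors
  -- end up as integrals of the same weight `k ρ`.
  have bound : ∀ (y : Y) (c : ℝ), sqInt μ (D y) ≤ ENNReal.ofReal (c * ρ y ^ 2) →
      ∫⁻ x, ENNReal.ofReal (k y * ((ρ y)⁻¹ * D y x ^ 2)) ∂μ ≤
        ENNReal.ofReal c * ENNReal.ofReal (k y * ρ y) := by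
    intro y c hc
    have : ∀ x, ENNReal.ofReal (k y * ((ρ y)⁻¹ * D y x ^ 2)) =
        ENNReal.ofReal (k y * (ρ y)⁻¹) * ENNReal.ofReal (D y x ^ 2) := fun x => by
      rw [← ENNReal.ofReal_mul (mul_nonneg (hk0 y) (inv_nonneg.2 (hρ0 y))), mul_assoc]
    simp only [this]
    rw [lintegral_const_mul' _ _ ENNReal.ofReal_ne_top]
    calc _ ≤ ENNReal.ofReal (k y * (ρ y)⁻¹) * ENNReal.ofReal (c * ρ y ^ 2) := by
          gcongr; exact hc
      _ = _ := by
        rw [← ENNReal.ofReal_mul (mul_nonneg (hk0 y) (inv_nonneg.2 (hρ0 y))), mul_comm,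
          ← ENNReal.ofReal_mul' (mul_nonneg (hk0 y) (hρ0 y))]
        congr 1
        rcases (hρ0 y).eq_or_lt with h | h
        · rw [← h]; simp
        · field_simp
  calc sqInt μ (fun x => ∫ y, k y * D y x ∂ν)
      ≤ ∫⁻ x, (∫⁻ y, ENNReal.ofReal (k y * ρ y) ∂ν) *
        ∫⁻ y, ENNReal.ofReal (k y * ((ρ y)⁻¹ * D y x ^ 2)) ∂ν ∂μ :=
        lintegral_mono fun x => ofReal_sq_integral_le ν hk.aemeasurable hk0 hρ.aemeasurable hρ0
          (hDy x).aemeasurable fun y hy => h0 y x hy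
    _ = (∫⁻ y, ENNReal.ofReal (k y * ρ y) ∂ν) *
        ∫⁻ y, ∫⁻ x, ENNReal.ofReal (k y * ((ρ y)⁻¹ * D y x ^ 2)) ∂μ ∂ν := by
        rw [lintegral_const_mul _ (Measurable.lintegral_prod_right' (f := fun p : X × Y =>
          ENNReal.ofReal (k p.2 * ((ρ p.2)⁻¹ * D p.2 p.1 ^ 2))) hmeas),
          lintegral_lintegral_swap hmeas.aemeasurable]
    _ ≤ _ := by
        gcongr
        rw [← lintegral_add_compl _ hU]
        gcongr
        · calc _ ≤ ∫⁻ y in U, ENNReal.ofReal ε * ENNReal.ofReal (k y * ρ y) ∂ν :=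
                setLIntegral_mono' hU fun y hy => bound y ε (hε y hy)
            _ = ENNReal.ofReal ε * ∫⁻ y in U, ENNReal.ofReal (k y * ρ y) ∂ν :=
                lintegral_const_mul' _ _ ENNReal.ofReal_ne_top
            _ ≤ _ := by gcongr; exact Measure.restrict_le_self
        · calc _ ≤ ∫⁻ y in Uᶜ, ENNReal.ofReal C * ENNReal.ofReal (k y * ρ y) ∂ν :=
                lintegral_mono fun y => bound y C (hC y)
            _ = _ := lintegral_const_mul' _ _ ENNReal.ofReal_ne_top

theorem sqInt_add_le (μ : Measure X) {φ ψ : X → ℝ} (hφ : AEMeasurable φ μ) :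
    sqInt μ (fun x => φ x + ψ x) ≤ 2 * sqInt μ φ + 2 * sqInt μ ψ := by
  unfold sqInt
  rw [← lintegral_const_mul' _ _ (by simp), ← lintegral_const_mul' _ _ (by simp),
    ← lintegral_add_left' ((hφ.pow_const 2).ennreal_ofReal.const_mul _)]
  refine lintegral_mono fun x => ?_
  have h2 : (2 : ℝ≥0∞) = ENNReal.ofReal 2 := by simp
  rw [h2, ← ENNReal.ofReal_mul zero_le_two, ← ENNReal.ofReal_mul zero_le_two,
    ← ENNReal.ofReal_add (by positivity) (by positivity)]
  apply ENNReal.ofReal_le_ofReal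
  nlinarith [sq_nonneg (φ x - ψ x)]

theorem sqInt_const_mul (μ : Measure X) (c : ℝ) (φ : X → ℝ) :
    sqInt μ (fun x => c * φ x) = ENNReal.ofReal (c ^ 2) * sqInt μ φ := by
  unfold sqInt
  rw [← lintegral_const_mul' _ _ ENNReal.ofReal_ne_top]
  simp only [mul_pow, ENNReal.ofReal_mul (sq_nonneg c)]

theorem sqInt_neg (μ : Measure X) (φ : X → ℝ) : sqInt μ (fun x => -φ x) = sqInt μ φ := by
  simp [sqInt]

theorem memLp_two_iff_sqInt {μ : Measure X} {φ : X → ℝ} (hφ : AEStronglyMeasurable φ μ) :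
    MemLp φ 2 μ ↔ sqInt μ φ < ⊤ := by
  rw [memLp_two_iff_integrable_sq hφ, sqInt,
    ← hasFiniteIntegral_iff_ofReal (f := fun x => φ x ^ 2) (ae_of_all _ fun x => sq_nonneg (φ x))]
  exact ⟨fun h => h.2, fun h => ⟨hφ.pow 2, h⟩⟩

theorem MemLp.sqInt_eq_ofReal {μ : Measure X} {φ : X → ℝ} (hφ : MemLp φ 2 μ) :
    sqInt μ φ = ENNReal.ofReal (∫ x, φ x ^ 2 ∂μ) :=
  (ofReal_integral_eq_lintegral_ofReal hφ.integrable_sq (ae_of_all _ fun _ => sq_nonneg _)).symm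

/-- Pointwise convergence and convergence of the square integrals give convergence in mean square. -/
theorem tendsto_sqInt_sub_of_tendsto {μ : Measure X} {a : ℕ → X → ℝ} {b : X → ℝ}
    (ha : ∀ n, Measurable (a n)) (hb : Measurable b)
    (hab : ∀ᵐ x ∂μ, Tendsto (fun n => a n x) atTop (𝓝 (b x))) (hfin : sqInt μ b ≠ ⊤)
    (hlim : Tendsto (fun n => sqInt μ (a n)) atTop (𝓝 (sqInt μ b))) :
    Tendsto (fun n => sqInt μ (fun x => a n x - b x)) atTop (𝓝 0) := by
  -- Fatou is applied to `2a² + 2b² - (a - b)² = (a + b)² ≥ 0`, whose pointwise limit is `4b²`. As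
  -- `2∫a² + 2∫b²` tends to `4∫b²`, nothing is left for `∫(a - b)²`; no dominating function is
  -- needed.
  set G : ℕ → X → ℝ≥0∞ := fun n x => ENNReal.ofReal (2 * a n x ^ 2 + 2 * b x ^ 2 - (a n x - b x) ^ 2)
  have hG0 : ∀ n x, 0 ≤ 2 * a n x ^ 2 + 2 * b x ^ 2 - (a n x - b x) ^ 2 := fun n x => by
    nlinarith [sq_nonneg (a n x + b x)]
  have hfat : ∫⁻ x, liminf (fun n => G n x) atTop ∂μ ≤ liminf (fun n => ∫⁻ x, G n x ∂μ) atTop :=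
    lintegral_liminf_le fun n => by have := ha n; fun_prop
  have hleft : ∫⁻ x, liminf (fun n => G n x) atTop ∂μ = 4 * sqInt μ b := by
    unfold sqInt
    rw [← lintegral_const_mul' _ _ (by simp)]
    refine lintegral_congr_ae (hab.mono fun x hx => ?_)
    have : Tendsto (fun n => G n x) atTop (𝓝 (ENNReal.ofReal (4 * b x ^ 2))) := by
      apply ENNReal.tendsto_ofReal
      have := ((hx.pow 2).const_mul 2).add_const (2 * b x ^ 2) |>.sub ((hx.sub_const (b x)).pow 2)
      convert this using 2
      ring
    simp only [this.liminf_eq]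
    rw [ENNReal.ofReal_mul (by norm_num)]
    simp
  have hadd : ∀ n, (∫⁻ x, G n x ∂μ) + sqInt μ (fun x => a n x - b x) =
      2 * sqInt μ (a n) + 2 * sqInt μ b := by
    intro n
    unfold sqInt
    rw [← lintegral_const_mul' _ _ (by simp), ← lintegral_const_mul' _ _ (by simp),
      ← lintegral_add_left (by have := ha n; fun_prop), ← lintegral_add_left (by
        have := ha n; fun_prop)]
    refine lintegral_congr fun x => ?_
    have h2 : (2 : ℝ≥0∞) = ENNReal.ofReal 2 := by simp
    rw [h2, ← ENNReal.ofReal_mul zero_le_two, ← ENNReal.ofReal_mul zero_le_two,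
      ← ENNReal.ofReal_add (hG0 n x) (sq_nonneg _),
      ← ENNReal.ofReal_add (by positivity) (by positivity)]
    ring_nf
  have hsum : Tendsto (fun n => 2 * sqInt μ (a n) + 2 * sqInt μ b) atTop (𝓝 (4 * sqInt μ b)) := by
    have := (ENNReal.Tendsto.const_mul hlim (Or.inr (by simp : (2 : ℝ≥0∞) ≠ ⊤))).add_const
      (2 * sqInt μ b)
    convert this using 2
    rw [← add_mul]; norm_num
  have h4 : 4 * sqInt μ b ≠ ⊤ := ENNReal.mul_ne_top (by simp) hfin
  rw [ENNReal.tendsto_nhds_zero]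
  intro ε hε
  rcases eq_or_ne ε ⊤ with rfl | hεt
  · exact Eventually.of_forall fun _ => le_top
  have hε2 : ε / 2 ≠ 0 := (ENNReal.half_pos hε.ne').ne'
  have hε2t : ε / 2 ≠ ⊤ := ENNReal.div_ne_top hεt (by simp)
  have e1 : ∀ᶠ n in atTop, 2 * sqInt μ (a n) + 2 * sqInt μ b ≤ 4 * sqInt μ b + ε / 2 :=
    (hsum.eventually_lt_const (ENNReal.lt_add_right h4 hε2)).mono fun n hn => hn.le
  -- The zero case is separate because subtracting `ε / 2` yields a strictly smaller value only from
  -- a nonzero one.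
  have e2 : ∀ᶠ n in atTop, 4 * sqInt μ b ≤ (∫⁻ x, G n x ∂μ) + ε / 2 := by
    rcases eq_or_ne (4 * sqInt μ b) 0 with h | h
    · exact Eventually.of_forall fun n => by rw [h]; exact zero_le
    · have : 4 * sqInt μ b - ε / 2 < liminf (fun n => ∫⁻ x, G n x ∂μ) atTop :=
        lt_of_lt_of_le (ENNReal.sub_lt_self h4 h hε2) (hleft ▸ hfat)
      exact (eventually_lt_of_lt_liminf this).mono fun n hn =>
        tsub_le_iff_right.1 hn.le
  filter_upwards [e1, e2] with n h1 h2
  have hGt : (∫⁻ x, G n x ∂μ) ≠ ⊤ := by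
    refine ne_top_of_le_ne_top (ENNReal.add_ne_top.2 ⟨h4, hε2t⟩) (le_trans ?_ h1)
    rw [← hadd n]; exact le_self_add
  have : (∫⁻ x, G n x ∂μ) + sqInt μ (fun x => a n x - b x) ≤ (∫⁻ x, G n x ∂μ) + ε := by
    rw [hadd n]
    refine h1.trans ((add_le_add_left h2 _).trans ?_)
    rw [add_assoc, ENNReal.add_halves]
  exact (ENNReal.add_le_add_iff_left hGt).1 this

end SquareIntegrals

/-! ### One-dimensional Taylor remainders in mean square. -/

section Taylor

/-- Jensen's inequality on the unit interval, obtained from `ofReal_sq_integral_le` with `k = ρ =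
1`; the weight only decreases the square. -/
theorem ofReal_sq_intervalIntegral_le {w D : ℝ → ℝ} (hw : Continuous w)
    (hw1 : ∀ s ∈ Set.Icc (0 : ℝ) 1, |w s| ≤ 1) (hD : ContinuousOn D (Set.Icc 0 1)) :
    ENNReal.ofReal ((∫ s in (0 : ℝ)..1, w s * D s) ^ 2) ≤
      ∫⁻ s in Set.Icc (0 : ℝ) 1, ENNReal.ofReal (D s ^ 2) := by
  rw [intervalIntegral.integral_of_le zero_le_one, ← integral_Icc_eq_integral_Ioc]
  have h := ofReal_sq_integral_le (volume.restrict (Set.Icc (0 : ℝ) 1)) (k := fun _ => 1)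
    (ρ := fun _ => 1) (D := fun s => w s * D s) aemeasurable_const (by simp) aemeasurable_const
    (by simp) ((hw.continuousOn.mul hD).aemeasurable measurableSet_Icc) (by simp)
  simp only [one_mul, mul_one, inv_one, ENNReal.ofReal_one, lintegral_const, Measure.restrict_apply
    MeasurableSet.univ, Set.univ_inter, Real.volume_Icc, sub_zero] at h
  refine h.trans (setLIntegral_mono' measurableSet_Icc fun s hs => ENNReal.ofReal_le_ofReal ?_)
  rw [mul_pow]
  have := (sq_le_one_iff_abs_le_one (w s)).2 (hw1 s hs)
  nlinarith [sq_nonneg (D s)]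

/-- Mean square bound for the increment of a `C¹` function. -/
theorem ofReal_sq_sub_le {φ φ' : ℝ → ℝ} (h1 : ∀ s ∈ Set.Icc (0 : ℝ) 1, HasDerivAt φ (φ' s) s)
    (hc : ContinuousOn φ' (Set.Icc 0 1)) :
    ENNReal.ofReal ((φ 1 - φ 0) ^ 2) ≤ ∫⁻ s in Set.Icc (0 : ℝ) 1, ENNReal.ofReal (φ' s ^ 2) := by
  have h := intervalIntegral.integral_eq_sub_of_hasDerivAt (f := φ) (f' := φ') (a := 0) (b := 1)
    (by simpa [Set.uIcc_of_le] using h1)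
    (ContinuousOn.intervalIntegrable (by simpa [Set.uIcc_of_le] using hc))
  rw [← h]
  simpa using ofReal_sq_intervalIntegral_le (w := fun _ => 1) continuous_const (by simp) hc

/-- Mean square bound for the second order Taylor remainder of a `C²` function. -/
theorem ofReal_sq_taylor_le {φ φ' φ'' : ℝ → ℝ}
    (h1 : ∀ s ∈ Set.Icc (0 : ℝ) 1, HasDerivAt φ (φ' s) s)
    (h2 : ∀ s ∈ Set.Icc (0 : ℝ) 1, HasDerivAt φ' (φ'' s) s)
    (hc : ContinuousOn φ'' (Set.Icc 0 1)) :
    ENNReal.ofReal ((φ 1 - φ 0 - φ' 0 - φ'' 0 / 2) ^ 2) ≤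
      ∫⁻ s in Set.Icc (0 : ℝ) 1, ENNReal.ofReal ((φ'' s - φ'' 0) ^ 2) := by
  -- In the derivative the two copies of `φ'` cancel. The quadratic term in the primitive is what
  -- centres `φ''` at `φ'' 0`, so that the remainder is governed by the oscillation of the second
  -- derivative.
  have h := intervalIntegral.integral_eq_sub_of_hasDerivAt
    (f := fun s => φ s + (1 - s) * φ' s + φ'' 0 * (1 - s) ^ 2 / 2)
    (f' := fun s => (1 - s) * (φ'' s - φ'' 0)) (a := 0) (b := 1)
    (by
      intro s hs
      rw [Set.uIcc_of_le zero_le_one] at hs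
      have d1 : HasDerivAt (fun s : ℝ => 1 - s) (-1) s := by simpa using (hasDerivAt_id s).const_sub 1
      have := ((h1 s hs).add (d1.mul (h2 s hs))).add (((d1.pow 2).const_mul (φ'' 0)).div_const 2)
      refine this.congr_deriv ?_
      simp; ring)
    (ContinuousOn.intervalIntegrable (by
      rw [Set.uIcc_of_le zero_le_one]
      exact (by fun_prop : Continuous fun s : ℝ => 1 - s).continuousOn.mul (hc.sub continuousOn_const)))
  have e : φ 1 - φ 0 - φ' 0 - φ'' 0 / 2 = ∫ s in (0 : ℝ)..1, (1 - s) * (φ'' s - φ'' 0) := by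
    rw [h]; ring
  rw [e]
  refine ofReal_sq_intervalIntegral_le (w := fun s => 1 - s) (by fun_prop) (fun s hs => ?_)
    (hc.sub continuousOn_const)
  rw [abs_le]; constructor <;> linarith [hs.1, hs.2]

end Taylor

end DirLin

namespace DirLin
open scoped ENNReal Real

/-! ### Polar coordinates and the law of one coordinate under the surface measure. -/

section PolarCoordinates

/-- Integration in polar coordinates. -/
theorem lintegral_polar {E : Type*} [NormedAddCommGroup E] [NormedSpace ℝ E] [Nontrivial E]
    [FiniteDimensional ℝ E] [MeasurableSpace E] [BorelSpace E] (μ : Measure E) [μ.IsAddHaarMeasure]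
    {f : E → ℝ≥0∞} (hf : Measurable f) :
    ∫⁻ v, f v ∂μ = ∫⁻ y : Metric.sphere (0 : E) 1, (∫⁻ r in Set.Ioi (0 : ℝ),
      ENNReal.ofReal (r ^ (Module.finrank ℝ E - 1)) * f (r • (y : E))) ∂μ.toSphere := by
  have hG : Measurable fun p : Metric.sphere (0 : E) 1 × Set.Ioi (0 : ℝ) =>
      f ((p.2 : ℝ) • (p.1 : E)) := by fun_prop
  calc ∫⁻ v, f v ∂μ = ∫⁻ x : ({(0)}ᶜ : Set E), f x.1 ∂(μ.comap (↑)) := by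
        rw [lintegral_subtype_comap (measurableSet_singleton _).compl f,
          restrict_compl_singleton]
    _ = ∫⁻ p, f ((p.2 : ℝ) • (p.1 : E)) ∂(μ.toSphere.prod (.volumeIoiPow (Module.finrank ℝ E - 1))) := by
        rw [← μ.measurePreserving_homeomorphUnitSphereProd.lintegral_comp_emb
          (Homeomorph.measurableEmbedding _)]
        refine lintegral_congr fun x => ?_
        congr 1
        have hx : ‖(x : E)‖ ≠ 0 := norm_ne_zero_iff.2 x.2
        simp [smul_smul, hx]
    _ = _ := by
        rw [lintegral_prod _ hG.aemeasurable]
        refine lintegral_congr fun y => ?_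
        rw [Measure.volumeIoiPow, lintegral_withDensity_eq_lintegral_mul _ (by fun_prop)
          (by fun_prop)]
        exact lintegral_subtype_comap (μ := volume) measurableSet_Ioi fun r : ℝ =>
          ENNReal.ofReal (r ^ (Module.finrank ℝ E - 1)) * f (r • (y : E))

instance {q : ℕ} : IsFiniteMeasure (surf q) :=
  inferInstanceAs (IsFiniteMeasure (volume : Measure (Amb q)).toSphere)

instance {q : ℕ} : SFinite (cyl q) := inferInstanceAs (SFinite ((surf q).prod volume))

theorem surf_univ_ne_zero (q : ℕ) : surf q Set.univ ≠ 0 := by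
  rw [Measure.measure_univ_ne_zero]
  exact Measure.toSphere_ne_zero _

/-- Fubini after splitting off the coordinate `0`. A function of `v 0` and `‖v‖` sees the other
coordinates through their norm only, which reduces zonal integrals to integrals over a half-plane.
-/
theorem lintegral_amb_succ (q : ℕ) {f : ℝ × ℝ → ℝ≥0∞} (hf : Measurable f) :
    ∫⁻ v : Amb (q + 1), f (v 0, ‖v‖) =
      ∫⁻ a : ℝ, ∫⁻ w : Amb q, f (a, √(a ^ 2 + ‖w‖ ^ 2)) := by
  have h1 := (EuclideanSpace.volume_preserving_symm_measurableEquiv_toLp (Fin (q + 1 + 1))).symm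
  rw [← (MeasurePreserving.lintegral_comp_emb h1 (MeasurableEquiv.measurableEmbedding _))]
  have h2 := (volume_preserving_piFinSuccAbove (fun _ : Fin (q + 1 + 1) => ℝ) 0).symm
  rw [← (MeasurePreserving.lintegral_comp_emb h2 (MeasurableEquiv.measurableEmbedding _))]
  have e : ∀ p : ℝ × (Fin (q + 1) → ℝ),
      ‖(WithLp.toLp 2 ((MeasurableEquiv.piFinSuccAbove (fun _ : Fin (q + 1 + 1) => ℝ) 0).symm p) :
        Amb (q + 1))‖ = √(p.1 ^ 2 + ‖(WithLp.toLp 2 p.2 : Amb q)‖ ^ 2) := by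
    intro p
    rw [EuclideanSpace.norm_eq, EuclideanSpace.norm_eq, Real.sq_sqrt (by positivity),
      Fin.sum_univ_succ]
    simp [MeasurableEquiv.piFinSuccAbove, Fin.insertNthEquiv]
  have e0 : ∀ p : ℝ × (Fin (q + 1) → ℝ),
      (WithLp.toLp 2 ((MeasurableEquiv.piFinSuccAbove (fun _ : Fin (q + 1 + 1) => ℝ) 0).symm p) :
        Amb (q + 1)) 0 = p.1 := by
    intro p
    simp [MeasurableEquiv.piFinSuccAbove, Fin.insertNthEquiv]
  have hm : Measurable fun p : ℝ × (Fin (q + 1) → ℝ) =>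
      f (p.1, √(p.1 ^ 2 + ‖(WithLp.toLp 2 p.2 : Amb q)‖ ^ 2)) := by
    have : Measurable fun w : Fin (q + 1) → ℝ => (WithLp.toLp 2 w : Amb q) :=
      (MeasurableEquiv.toLp 2 (Fin (q + 1) → ℝ)).measurable
    fun_prop
  calc _ = ∫⁻ p : ℝ × (Fin (q + 1) → ℝ),
      f (p.1, √(p.1 ^ 2 + ‖(WithLp.toLp 2 p.2 : Amb q)‖ ^ 2)) := by
        refine lintegral_congr fun p => ?_
        exact congrArg f (Prod.ext (e0 p) (e p))
    _ = ∫⁻ a : ℝ, ∫⁻ w : Fin (q + 1) → ℝ, f (a, √(a ^ 2 + ‖(WithLp.toLp 2 w : Amb q)‖ ^ 2)) := by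
        rw [Measure.volume_eq_prod, lintegral_prod _ hm.aemeasurable]
    _ = _ := by
        refine lintegral_congr fun a => ?_
        have h3 := (EuclideanSpace.volume_preserving_symm_measurableEquiv_toLp (Fin (q + 1))).symm
        rw [← (MeasurePreserving.lintegral_comp_emb h3 (MeasurableEquiv.measurableEmbedding _))]
        rfl

theorem lintegral_norm_amb (q : ℕ) {f : ℝ → ℝ≥0∞} (hf : Measurable f) :
    ∫⁻ w : Amb q, f ‖w‖ = surf q Set.univ *
      ∫⁻ r in Set.Ioi (0 : ℝ), ENNReal.ofReal (r ^ q) * f r := by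
  change ∫⁻ w : Amb q, (f ∘ norm) w = _
  rw [lintegral_polar volume (hf.comp measurable_norm)]
  have : ∀ y : Metric.sphere (0 : Amb q) 1, ∫⁻ r in Set.Ioi (0 : ℝ),
      ENNReal.ofReal (r ^ (Module.finrank ℝ (Amb q) - 1)) * (f ∘ norm) (r • (y : Amb q)) =
      ∫⁻ r in Set.Ioi (0 : ℝ), ENNReal.ofReal (r ^ q) * f r := fun y =>
    setLIntegral_congr_fun measurableSet_Ioi fun r hr => by
      simp [norm_smul, abs_of_pos (Set.mem_Ioi.1 hr)]
  simp only [this, lintegral_const]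
  rw [mul_comm]; rfl

/-- The function `φ(v₀ / ‖v‖)` is integrated over the open unit ball in two ways: in polar
coordinates of the whole space, and in polar coordinates of the half-plane of pairs `(v₀, ρ)`, with
`ρ` the norm of the other coordinates. Both produce the same radial factor `c`, which is neither `0`
nor `∞` and cancels. -/
theorem lintegral_surf_first_coord_angle (q : ℕ) {φ : ℝ → ℝ≥0∞} (hφ : Measurable φ) :
    ∫⁻ y : Sph (q + 1), φ ((y : Amb (q + 1)) 0) ∂(surf (q + 1)) =
      surf q Set.univ * ∫⁻ θ in Set.Ioo 0 π, ENNReal.ofReal (Real.sin θ ^ q) * φ (Real.cos θ) := by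
  set c : ℝ≥0∞ := ∫⁻ r in Set.Ioi (0 : ℝ),
    ENNReal.ofReal (r ^ (q + 1)) * (Set.Iio (1 : ℝ)).indicator 1 r with hc
  have hind : Measurable ((Set.Iio (1 : ℝ)).indicator (1 : ℝ → ℝ≥0∞)) :=
    measurable_one.indicator measurableSet_Iio
  have hc' : c = ∫⁻ r in Set.Ioo (0 : ℝ) 1, ENNReal.ofReal (r ^ (q + 1)) := by
    rw [hc, ← Set.Ioi_inter_Iio, Set.inter_comm, ← Measure.restrict_restrict measurableSet_Iio,
      ← lintegral_indicator measurableSet_Iio]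
    refine lintegral_congr fun r => ?_
    by_cases h : r < 1 <;> simp [h]
  have hc0 : c ≠ 0 := by
    rw [hc']
    apply ne_of_gt
    rw [setLIntegral_pos_iff (by fun_prop)]
    have : Set.Ioo (0 : ℝ) 1 ⊆ Function.support fun r : ℝ => ENNReal.ofReal (r ^ (q + 1)) := by
      intro r hr
      simp [pow_pos hr.1]
    rw [Set.inter_eq_right.2 this]
    simp
  have hct : c ≠ ⊤ := by
    rw [hc']
    refine ne_top_of_le_ne_top ENNReal.one_ne_top ?_
    calc _ ≤ ∫⁻ r in Set.Ioo (0 : ℝ) 1, 1 := setLIntegral_mono' measurableSet_Ioo fun r hr => by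
          simpa using pow_le_one₀ hr.1.le hr.2.le
      _ = 1 := by simp
  have hψ : Measurable fun p : ℝ × ℝ => φ (p.1 / p.2) * (Set.Iio (1 : ℝ)).indicator 1 p.2 := by
    fun_prop
  have hL : ∫⁻ v : Amb (q + 1), φ (v 0 / ‖v‖) * (Set.Iio (1 : ℝ)).indicator 1 ‖v‖ =
      (∫⁻ y : Sph (q + 1), φ ((y : Amb (q + 1)) 0) ∂(surf (q + 1))) * c := by
    have hc0 : Measurable fun v : Amb (q + 1) => v 0 := by fun_prop
    rw [lintegral_polar volume (by fun_prop), ← lintegral_mul_const' _ _ hct]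
    refine lintegral_congr fun y => ?_
    rw [hc, ← lintegral_const_mul _ (by fun_prop)]
    refine setLIntegral_congr_fun measurableSet_Ioi fun r hr => ?_
    have hr' : 0 < r := hr
    simp [norm_smul, abs_of_pos hr', hr'.ne']
    ring
  have hR : ∫⁻ v : Amb (q + 1), φ (v 0 / ‖v‖) * (Set.Iio (1 : ℝ)).indicator 1 ‖v‖ =
      surf q Set.univ * (∫⁻ θ in Set.Ioo 0 π, ENNReal.ofReal (Real.sin θ ^ q) * φ (Real.cos θ)) * c := by
    rw [lintegral_amb_succ q (f := fun p => φ (p.1 / p.2) * (Set.Iio (1 : ℝ)).indicator 1 p.2) hψ]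
    have hsq : ∀ p : ℝ × ℝ, 0 < p.1 → √((p.1 * Real.cos p.2) ^ 2 + (p.1 * Real.sin p.2) ^ 2) = p.1 := by
      intro p hp
      rw [mul_pow, mul_pow, ← mul_add, Real.cos_sq_add_sin_sq, mul_one, Real.sqrt_sq hp.le]
    -- Extending by `0` to `ρ ≤ 0` allows planar polar coordinates with angle in `(-π, π)`; the
    -- support condition then selects the angles in `(0, π)`.
    set H : ℝ × ℝ → ℝ≥0∞ := fun p => (Set.Ioi (0 : ℝ)).indicator (fun ρ => ENNReal.ofReal (ρ ^ q) *
      (φ (p.1 / √(p.1 ^ 2 + ρ ^ 2)) * (Set.Iio (1 : ℝ)).indicator 1 √(p.1 ^ 2 + ρ ^ 2))) p.2 with hH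
    have hHm : Measurable H := by
      have : H = (Prod.snd ⁻¹' Set.Ioi (0 : ℝ)).indicator fun p : ℝ × ℝ => ENNReal.ofReal (p.2 ^ q) *
        (φ (p.1 / √(p.1 ^ 2 + p.2 ^ 2)) * (Set.Iio (1 : ℝ)).indicator 1 √(p.1 ^ 2 + p.2 ^ 2)) := by
        ext p; simp [hH, Set.indicator]
      rw [this]
      exact Measurable.indicator (by fun_prop) (measurable_snd measurableSet_Ioi)
    have h1 : ∀ a : ℝ, ∫⁻ w : Amb q, φ (a / √(a ^ 2 + ‖w‖ ^ 2)) *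
        (Set.Iio (1 : ℝ)).indicator 1 √(a ^ 2 + ‖w‖ ^ 2) = surf q Set.univ * ∫⁻ ρ : ℝ, H (a, ρ) := by
      intro a
      rw [lintegral_norm_amb q (f := fun ρ => φ (a / √(a ^ 2 + ρ ^ 2)) *
        (Set.Iio (1 : ℝ)).indicator 1 √(a ^ 2 + ρ ^ 2)) (by fun_prop),
        ← lintegral_indicator measurableSet_Ioi]
    simp only [h1]
    rw [lintegral_const_mul' _ _ (measure_ne_top _ _), mul_assoc, ← lintegral_prod _ hHm.aemeasurable,
      ← Measure.volume_eq_prod, ← lintegral_comp_polarCoord_symm]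
    congr 1
    rw [polarCoord_target, Measure.volume_eq_prod, ← Measure.prod_restrict]
    have h2 : ∀ r ∈ Set.Ioi (0 : ℝ), ∀ θ ∈ Set.Ioo (-π) π,
        ENNReal.ofReal r • H (polarCoord.symm (r, θ)) =
        (ENNReal.ofReal (r ^ (q + 1)) * (Set.Iio (1 : ℝ)).indicator 1 r) *
          (Set.Ioo 0 π).indicator (fun θ => ENNReal.ofReal (Real.sin θ ^ q) * φ (Real.cos θ)) θ := by
      intro r hr θ hθ
      have hr' : 0 < r := hr
      have hs : r * Real.sin θ ∈ Set.Ioi (0 : ℝ) ↔ θ ∈ Set.Ioo 0 π := by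
        simp only [Set.mem_Ioi, mul_pos_iff_of_pos_left hr', Set.mem_Ioo, hθ.2, and_true]
        refine ⟨fun h => ?_, fun h => Real.sin_pos_of_pos_of_lt_pi h hθ.2⟩
        by_contra hn
        exact absurd h (not_lt.2 (Real.sin_nonpos_of_nonpos_of_neg_pi_le (not_lt.1 hn) hθ.1.le))
      have hsq' := hsq (r, θ) hr'
      simp only [hH, polarCoord_symm_apply]
      simp only at hsq'
      by_cases h : θ ∈ Set.Ioo 0 π
      · rw [Set.indicator_of_mem (hs.2 h), Set.indicator_of_mem h, smul_eq_mul, hsq',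
          mul_pow r (Real.sin θ) q, pow_succ r q, ENNReal.ofReal_mul (pow_nonneg hr'.le q),
          ENNReal.ofReal_mul (pow_nonneg hr'.le q), mul_div_cancel_left₀ _ hr'.ne']
        ring
      · rw [Set.indicator_of_notMem (mt hs.1 h), Set.indicator_of_notMem h]; simp
    rw [lintegral_prod]
    · calc _ = ∫⁻ r in Set.Ioi (0 : ℝ), ∫⁻ θ in Set.Ioo (-π) π,
            (ENNReal.ofReal (r ^ (q + 1)) * (Set.Iio (1 : ℝ)).indicator 1 r) *
            (Set.Ioo 0 π).indicator (fun θ => ENNReal.ofReal (Real.sin θ ^ q) * φ (Real.cos θ)) θ :=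
          setLIntegral_congr_fun measurableSet_Ioi fun r hr =>
            setLIntegral_congr_fun measurableSet_Ioo fun θ hθ => h2 r hr θ hθ
        _ = _ := by
          have : ∀ r : ℝ, ∫⁻ θ in Set.Ioo (-π) π,
            (ENNReal.ofReal (r ^ (q + 1)) * (Set.Iio (1 : ℝ)).indicator 1 r) *
            (Set.Ioo 0 π).indicator (fun θ => ENNReal.ofReal (Real.sin θ ^ q) * φ (Real.cos θ)) θ =
            (ENNReal.ofReal (r ^ (q + 1)) * (Set.Iio (1 : ℝ)).indicator 1 r) *
            ∫⁻ θ in Set.Ioo 0 π, ENNReal.ofReal (Real.sin θ ^ q) * φ (Real.cos θ) := by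
            intro r
            rw [lintegral_const_mul _ (Measurable.indicator (by fun_prop) measurableSet_Ioo),
              setLIntegral_indicator measurableSet_Ioo, Set.inter_eq_left.2]
            exact Set.Ioo_subset_Ioo_left (by linarith [Real.pi_pos])
          simp only [this]
          rw [lintegral_mul_const _ (by fun_prop), mul_comm]
    · have : Measurable polarCoord.symm := continuous_polarCoord_symm.measurable
      exact ((measurable_fst.ennreal_ofReal).mul (hHm.comp this)).aemeasurable
  have := hL.symm.trans hR
  exact (ENNReal.mul_left_inj hc0 hct).1 this

/-- The law of the first coordinate under the surface measure. -/
theorem lintegral_surf_first_coord (q : ℕ) {φ : ℝ → ℝ≥0∞} (hφ : Measurable φ) :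
    ∫⁻ y : Sph (q + 1), φ (1 - (y : Amb (q + 1)) 0) ∂(surf (q + 1)) =
      surf q Set.univ * ∫⁻ t in Set.Ioo (0 : ℝ) 2,
        φ t * ENNReal.ofReal ((t * (2 - t)) ^ (((q + 1 : ℕ) : ℝ) / 2 - 1)) := by
  rw [lintegral_surf_first_coord_angle q (φ := fun t => φ (1 - t)) (by fun_prop)]
  congr 1
  have hinj : Set.InjOn (fun θ => 1 - Real.cos θ) (Set.Ioo 0 π) := fun a ha b hb h =>
    Real.injOn_cos ⟨ha.1.le, ha.2.le⟩ ⟨hb.1.le, hb.2.le⟩ (by simpa using h)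
  have himg : (fun θ => 1 - Real.cos θ) '' Set.Ioo 0 π = Set.Ioo 0 2 := by
    ext t
    constructor
    · rintro ⟨θ, hθ, rfl⟩
      have h1 := Real.cos_lt_cos_of_nonneg_of_le_pi le_rfl hθ.2.le hθ.1
      have h2 := Real.cos_lt_cos_of_nonneg_of_le_pi hθ.1.le le_rfl hθ.2
      rw [Real.cos_zero] at h1
      rw [Real.cos_pi] at h2
      constructor <;> dsimp only <;> linarith
    · rintro ⟨h0, h2⟩
      refine ⟨Real.arccos (1 - t), ⟨Real.arccos_pos.2 (by linarith), ?_⟩, ?_⟩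
      · exact lt_of_le_of_ne (Real.arccos_le_pi _) fun h => by
          rw [Real.arccos_eq_pi] at h; linarith
      · simp only
        rw [Real.cos_arccos (by linarith) (by linarith)]; ring
  rw [← himg, lintegral_image_eq_lintegral_abs_deriv_mul (f' := fun θ => Real.sin θ) measurableSet_Ioo
    (fun θ _ => by simpa using ((Real.hasDerivAt_cos θ).const_sub 1).hasDerivWithinAt) hinj]
  refine setLIntegral_congr_fun measurableSet_Ioo fun θ hθ => ?_
  have hs : 0 < Real.sin θ := Real.sin_pos_of_pos_of_lt_pi hθ.1 hθ.2
  have e : (1 - Real.cos θ) * (2 - (1 - Real.cos θ)) = Real.sin θ ^ (2 : ℝ) := by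
    rw [Real.rpow_two, Real.sin_sq]; ring
  -- One factor `sin θ` is the Jacobian of `t = 1 - cos θ`; the rest is a power of `sin² θ = t (2 -
  -- t)`.
  have e2 : Real.sin θ ^ q =
      |Real.sin θ| * ((1 - Real.cos θ) * (2 - (1 - Real.cos θ))) ^ (((q + 1 : ℕ) : ℝ) / 2 - 1) := by
    rw [e, ← Real.rpow_mul hs.le, abs_of_pos hs, ← Real.rpow_natCast]
    conv_rhs => rw [← Real.rpow_one (Real.sin θ), ← Real.rpow_mul hs.le, ← Real.rpow_add hs]
    congr 1; push_cast; ring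
  rw [e2, ENNReal.ofReal_mul (abs_nonneg _)]
  ring

end PolarCoordinates

end DirLin

namespace DirLin
open scoped ENNReal Real

/-! ### Asymptotics of the zonal moments of the kernel as `h → 0`. -/

section Moments

/-- A bounded nonnegative Borel function on `ℝ` with finite half-integer moments on `(0, ∞)`. -/
structure IsBorelProfile (L : ℝ → ℝ) : Prop where
  measurable : Measurable L
  nonneg : ∀ r, 0 ≤ L r
  bounded : ∃ M, ∀ r, L r ≤ M
  moment_integrable : ∀ m : ℕ, 1 ≤ m →
    IntegrableOn (fun r => L r * r ^ ((m : ℝ) / 2 - 1)) (Set.Ioi 0)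

theorem IsBorelProfile.integrableOn_rpow {L : ℝ → ℝ} (hL : IsBorelProfile L) {s : ℝ} {m : ℕ}
    (hm : 1 ≤ m) (hs : s = (m : ℝ) / 2 - 1) : IntegrableOn (fun r => L r * r ^ s) (Set.Ioi 0) :=
  hs ▸ hL.moment_integrable m hm

theorem lintegral_Ioi_ne_top {L : ℝ → ℝ} (hL : IsBorelProfile L) {s : ℝ}
    (hs : IntegrableOn (fun r => L r * r ^ s) (Set.Ioi 0)) :
    ∫⁻ r in Set.Ioi (0 : ℝ), ENNReal.ofReal (L r * r ^ s) ≠ ⊤ :=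
  ((hasFiniteIntegral_iff_ofReal ((ae_restrict_iff' measurableSet_Ioi).2 (ae_of_all _ fun r hr =>
    mul_nonneg (hL.nonneg r) (Real.rpow_nonneg (Set.mem_Ioi.1 hr).le s)))).1 hs.2).ne

/-- On this range `h² r < 1`, so `2 - h² r` lies between `1` and `2` and its power is at most `2 ^
|α|` whatever the sign of `α`. Dominated convergence applies. -/
theorem tendsto_setLIntegral_near {L : ℝ → ℝ} (hL : IsBorelProfile L) {β : ℝ} (α : ℝ)
    (hβ : IntegrableOn (fun r => L r * r ^ β) (Set.Ioi 0)) :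
    Tendsto (fun h : ℝ => ∫⁻ r in Set.Ioo 0 (1 / h ^ 2),
      ENNReal.ofReal (L r * r ^ β * (2 - h ^ 2 * r) ^ α)) (𝓝[>] 0)
      (𝓝 (∫⁻ r in Set.Ioi (0 : ℝ), ENNReal.ofReal (L r * r ^ β * 2 ^ α))) := by
  have hLm := hL.measurable
  have hI : ∀ h : ℝ, ∫⁻ r in Set.Ioo 0 (1 / h ^ 2), ENNReal.ofReal (L r * r ^ β * (2 - h ^ 2 * r) ^ α) =
      ∫⁻ r in Set.Ioi (0 : ℝ), (Set.Iio (1 / h ^ 2)).indicator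
        (fun r => ENNReal.ofReal (L r * r ^ β * (2 - h ^ 2 * r) ^ α)) r := fun h => by
    rw [setLIntegral_indicator measurableSet_Iio, Set.inter_comm, Set.Ioi_inter_Iio]
  simp only [hI]
  refine tendsto_lintegral_filter_of_dominated_convergence
    (fun r => ENNReal.ofReal (2 ^ |α|) * ENNReal.ofReal (L r * r ^ β)) ?_ ?_ ?_ ?_
  · exact Eventually.of_forall fun h => Measurable.indicator (by fun_prop) measurableSet_Iio
  · filter_upwards [self_mem_nhdsWithin] with h hh
    have hh : 0 < h := hh
    refine (ae_restrict_iff' measurableSet_Ioi).2 (ae_of_all _ fun r hr => ?_)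
    have hr : 0 < r := hr
    rw [Set.indicator_apply]
    split_ifs with hlt
    · rw [← ENNReal.ofReal_mul (by positivity), mul_comm]
      have hlt : r < 1 / h ^ 2 := hlt
      rw [lt_div_iff₀ (by positivity)] at hlt
      have h1 : 1 ≤ 2 - h ^ 2 * r := by linarith
      have h2 : 2 - h ^ 2 * r ≤ 2 := by nlinarith [mul_pos (pow_pos hh 2) hr]
      gcongr
      · exact mul_nonneg (hL.nonneg r) (by positivity)
      · calc (2 - h ^ 2 * r) ^ α ≤ (2 - h ^ 2 * r) ^ |α| :=
              Real.rpow_le_rpow_of_exponent_le h1 (le_abs_self α)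
          _ ≤ _ := Real.rpow_le_rpow (by linarith) h2 (abs_nonneg α)
    · exact zero_le
  · rw [lintegral_const_mul' _ _ ENNReal.ofReal_ne_top]
    exact ENNReal.mul_ne_top ENNReal.ofReal_ne_top (lintegral_Ioi_ne_top hL hβ)
  · refine (ae_restrict_iff' measurableSet_Ioi).2 (ae_of_all _ fun r hr => ?_)
    have hr : 0 < r := hr
    have hc : Tendsto (fun h : ℝ => h ^ 2 * r) (𝓝[>] 0) (𝓝 0) := by
      have : Continuous fun h : ℝ => h ^ 2 * r := by fun_prop
      simpa using (this.tendsto 0).mono_left nhdsWithin_le_nhds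
    have hev : ∀ᶠ h : ℝ in 𝓝[>] 0, r < 1 / h ^ 2 := by
      filter_upwards [hc.eventually_lt_const zero_lt_one, self_mem_nhdsWithin] with h h1 hh
      rw [lt_div_iff₀ (pow_pos hh 2)]; linarith
    have hlim : Tendsto (fun h : ℝ => ENNReal.ofReal (L r * r ^ β * (2 - h ^ 2 * r) ^ α)) (𝓝[>] 0)
        (𝓝 (ENNReal.ofReal (L r * r ^ β * 2 ^ α))) := by
      apply ENNReal.tendsto_ofReal
      apply Tendsto.const_mul
      have : Tendsto (fun h : ℝ => 2 - h ^ 2 * r) (𝓝[>] 0) (𝓝 2) := by simpa using hc.const_sub 2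
      exact this.rpow_const (Or.inl two_ne_zero)
    refine hlim.congr' ?_
    filter_upwards [hev] with h hh
    rw [Set.indicator_of_mem (Set.mem_Iio.2 hh)]

/-- The exponents are chosen for `b` containing `u^(-1/2)`: the power `3/2` gives the integrable
`u^(-3/4)`, whereas the symmetric choice `2` would give `u⁻¹`. -/
theorem young_three {a b : ℝ} (ha : 0 ≤ a) (hb : 0 ≤ b) : a * b ≤ a ^ 3 + b ^ (3 / 2 : ℝ) := by
  have h := Real.young_inequality_of_nonneg ha hb (p := 3) (q := 3 / 2)
    (Real.holderConjugate_iff.2 ⟨by norm_num, by norm_num⟩)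
  have h1 : (0 : ℝ) ≤ b ^ (3 / 2 : ℝ) := Real.rpow_nonneg hb _
  have h3 : a ^ (3 : ℝ) = a ^ 3 := by exact_mod_cast Real.rpow_natCast a 3
  rw [h3] at h
  have : 0 ≤ a ^ 3 := by positivity
  linarith

/-- This is the contribution of the hemisphere around the antipode. On the circle `α = -1/2` and the
density of the first coordinate is unbounded there, so the decay of `L` has to be separated from the
singularity. Young's inequality leaves the tail of a higher moment of `L`, where boundedness turns
`L³` into `M² L`, and an integral of order `h`. -/
theorem tendsto_setLIntegral_far {L : ℝ → ℝ} (hL : IsBorelProfile L) {α β : ℝ} (hα : -(1 / 2) ≤ α)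
    (hβ : IntegrableOn (fun r => L r * r ^ (3 * (β + 1))) (Set.Ioi 0)) :
    Tendsto (fun h : ℝ => ∫⁻ r in Set.Ico (1 / h ^ 2) (2 / h ^ 2),
      ENNReal.ofReal (L r * r ^ β * (2 - h ^ 2 * r) ^ α)) (𝓝[>] 0) (𝓝 0) := by
  have hLm := hL.measurable
  obtain ⟨M, hM⟩ := hL.bounded
  have hbound : ∀ h : ℝ, 0 < h → h ≤ 1 → ∫⁻ r in Set.Ico (1 / h ^ 2) (2 / h ^ 2),
      ENNReal.ofReal (L r * r ^ β * (2 - h ^ 2 * r) ^ α) ≤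
      ENNReal.ofReal (M ^ 2) * (∫⁻ r in Set.Ici (1 / h ^ 2), ENNReal.ofReal (L r * r ^ (3 * (β + 1)))) +
        ENNReal.ofReal h * ∫⁻ u in Set.Ioc (0 : ℝ) 1, ENNReal.ofReal (u ^ (-(3 / 4) : ℝ)) := by
    intro h hh hh1
    have hpt : ∀ r ∈ Set.Ico (1 / h ^ 2) (2 / h ^ 2),
        ENNReal.ofReal (L r * r ^ β * (2 - h ^ 2 * r) ^ α) ≤
        ENNReal.ofReal (M ^ 2) * ENNReal.ofReal (L r * r ^ (3 * (β + 1))) +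
          ENNReal.ofReal h * (ENNReal.ofReal (h ^ 2) *
            ENNReal.ofReal ((2 - h ^ 2 * r) ^ (-(3 / 4) : ℝ))) := by
      rintro r ⟨hr1, hr2⟩
      have hr0 : 0 < r := lt_of_lt_of_le (by positivity) hr1
      rw [div_le_iff₀ (by positivity)] at hr1
      rw [lt_div_iff₀ (by positivity)] at hr2
      have hu0 : 0 < 2 - h ^ 2 * r := by linarith
      have hu1 : 2 - h ^ 2 * r ≤ 1 := by linarith
      set u := 2 - h ^ 2 * r
      have h0 := hL.nonneg r
      rw [← ENNReal.ofReal_mul (by positivity), ← ENNReal.ofReal_mul (by positivity),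
        ← ENNReal.ofReal_mul (by positivity), ← ENNReal.ofReal_add (by positivity) (by positivity)]
      apply ENNReal.ofReal_le_ofReal
      have e1 : u ^ α ≤ u ^ (-(1 / 2) : ℝ) := Real.rpow_le_rpow_of_exponent_ge hu0 hu1 hα
      -- A factor `r⁻¹ ≤ h²` is put with the singular term. Its power `3/2` is at most `h³`, of
      -- which `h²` is the Jacobian of `u = 2 - h² r` and one factor `h` remains as a gain.
      have e2 := young_three (a := L r * r ^ (β + 1)) (b := u ^ (-(1 / 2) : ℝ) * r⁻¹)
        (by positivity) (by positivity)
      have e3 : L r * r ^ β * u ^ (-(1 / 2) : ℝ) =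
          L r * r ^ (β + 1) * (u ^ (-(1 / 2) : ℝ) * r⁻¹) := by
        rw [Real.rpow_add hr0, Real.rpow_one]; field_simp
      have e4 : (L r * r ^ (β + 1)) ^ 3 ≤ M ^ 2 * (L r * r ^ (3 * (β + 1))) := by
        have : r ^ (3 * (β + 1)) = (r ^ (β + 1)) ^ 3 := by
          rw [← Real.rpow_natCast, ← Real.rpow_mul hr0.le]; congr 1; push_cast; ring
        rw [this, mul_pow, ← mul_assoc]
        gcongr
        have : L r ^ 2 ≤ M ^ 2 := pow_le_pow_left₀ h0 (hM r) 2
        nlinarith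
      have e5 : (u ^ (-(1 / 2) : ℝ) * r⁻¹) ^ (3 / 2 : ℝ) ≤ h * (h ^ 2 * u ^ (-(3 / 4) : ℝ)) := by
        rw [Real.mul_rpow (by positivity) (by positivity), ← Real.rpow_mul hu0.le]
        have : (-(1 / 2) * (3 / 2) : ℝ) = -(3 / 4) := by norm_num
        rw [this]
        have hr' : r⁻¹ ≤ h ^ 2 := by rw [inv_le_comm₀ hr0 (by positivity), inv_le_iff_one_le_mul₀ (by positivity)]; linarith
        have : (r⁻¹) ^ (3 / 2 : ℝ) ≤ h ^ 3 := by
          calc (r⁻¹) ^ (3 / 2 : ℝ) ≤ (h ^ 2) ^ (3 / 2 : ℝ) :=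
                Real.rpow_le_rpow (by positivity) hr' (by norm_num)
            _ = h ^ 3 := by
              rw [← Real.rpow_natCast, ← Real.rpow_mul hh.le, ← Real.rpow_natCast]; norm_num
        calc _ ≤ u ^ (-(3 / 4) : ℝ) * h ^ 3 := by gcongr
          _ = _ := by ring
      calc L r * r ^ β * u ^ α ≤ L r * r ^ β * u ^ (-(1 / 2) : ℝ) := by gcongr
        _ ≤ _ := by rw [e3]; linarith
    have hcv : ∫⁻ u in Set.Ioc (0 : ℝ) 1, ENNReal.ofReal (u ^ (-(3 / 4) : ℝ)) =
        ∫⁻ r in Set.Ico (1 / h ^ 2) (2 / h ^ 2), ENNReal.ofReal (h ^ 2) *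
            ENNReal.ofReal ((2 - h ^ 2 * r) ^ (-(3 / 4) : ℝ)) := by
      have himg : (fun r => 2 - h ^ 2 * r) '' Set.Ico (1 / h ^ 2) (2 / h ^ 2) = Set.Ioc 0 1 := by
        ext u
        constructor
        · rintro ⟨r, ⟨hr1, hr2⟩, rfl⟩
          rw [div_le_iff₀ (by positivity)] at hr1
          rw [lt_div_iff₀ (by positivity)] at hr2
          constructor <;> dsimp only <;> linarith
        · rintro ⟨h0, h1⟩
          refine ⟨(2 - u) / h ^ 2, ⟨?_, ?_⟩, ?_⟩
          · gcongr; linarith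
          · gcongr; linarith
          · simp only; field_simp; ring
      rw [← himg, lintegral_image_eq_lintegral_abs_deriv_mul (f' := fun _ => -h ^ 2) measurableSet_Ico
        (fun r _ => by
          simpa using (((hasDerivAt_id r).const_mul (h ^ 2)).const_sub 2).hasDerivWithinAt)
        (fun a _ b _ hab => by
          have : h ^ 2 * a = h ^ 2 * b := by simpa using hab
          exact mul_left_cancel₀ (by positivity) this)]
      refine setLIntegral_congr_fun measurableSet_Ico fun r hr => ?_
      simp [abs_of_pos hh]
    calc _ ≤ ∫⁻ r in Set.Ico (1 / h ^ 2) (2 / h ^ 2),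
          (ENNReal.ofReal (M ^ 2) * ENNReal.ofReal (L r * r ^ (3 * (β + 1))) +
          ENNReal.ofReal h * (ENNReal.ofReal (h ^ 2) *
            ENNReal.ofReal ((2 - h ^ 2 * r) ^ (-(3 / 4) : ℝ)))) := setLIntegral_mono' measurableSet_Ico hpt
      _ ≤ _ := by
        rw [lintegral_add_left (by fun_prop), lintegral_const_mul' _ _ ENNReal.ofReal_ne_top,
          lintegral_const_mul' _ _ ENNReal.ofReal_ne_top, hcv]
        gcongr
        exact Set.Ico_subset_Ici_self
  have hpow : ∫⁻ u in Set.Ioc (0 : ℝ) 1, ENNReal.ofReal (u ^ (-(3 / 4) : ℝ)) ≠ ⊤ := by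
    have hi : IntegrableOn (fun u : ℝ => u ^ (-(3 / 4) : ℝ)) (Set.Ioc 0 1) :=
      (intervalIntegrable_iff_integrableOn_Ioc_of_le zero_le_one).1
        (intervalIntegral.intervalIntegrable_rpow' (by norm_num))
    exact ((hasFiniteIntegral_iff_ofReal ((ae_restrict_iff' measurableSet_Ioc).2 (ae_of_all _
      fun r hr => Real.rpow_nonneg hr.1.le _))).1 hi.2).ne
  have htail : Tendsto (fun h : ℝ => ∫⁻ r in Set.Ici (1 / h ^ 2),
      ENNReal.ofReal (L r * r ^ (3 * (β + 1)))) (𝓝[>] 0) (𝓝 0) := by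
    have hI : (fun h : ℝ => ∫⁻ r in Set.Ici (1 / h ^ 2), ENNReal.ofReal (L r * r ^ (3 * (β + 1))))
        =ᶠ[𝓝[>] 0] fun h => ∫⁻ r in Set.Ioi (0 : ℝ), (Set.Ici (1 / h ^ 2)).indicator
        (fun r => ENNReal.ofReal (L r * r ^ (3 * (β + 1)))) r := by
      filter_upwards [self_mem_nhdsWithin] with h hh
      have hh : 0 < h := hh
      rw [setLIntegral_indicator measurableSet_Ici, Set.inter_eq_left.2]
      exact fun r hr => lt_of_lt_of_le (by positivity) (Set.mem_Ici.1 hr)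
    refine Tendsto.congr' hI.symm ?_
    have := tendsto_lintegral_filter_of_dominated_convergence (μ := volume.restrict (Set.Ioi (0 : ℝ)))
      (l := 𝓝[>] (0 : ℝ)) (F := fun h => (Set.Ici (1 / h ^ 2)).indicator
        (fun r => ENNReal.ofReal (L r * r ^ (3 * (β + 1))))) (f := fun _ => 0)
      (fun r => ENNReal.ofReal (L r * r ^ (3 * (β + 1))))
      (Eventually.of_forall fun h => Measurable.indicator (by fun_prop) measurableSet_Ici)
      (Eventually.of_forall fun h => ae_of_all _ fun r => Set.indicator_le_self _ _ r)
      (lintegral_Ioi_ne_top hL hβ)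
      (ae_of_all _ fun r => by
        refine tendsto_const_nhds.congr' ?_
        have hc : Tendsto (fun h : ℝ => h ^ 2 * r) (𝓝[>] 0) (𝓝 0) := by
          have : Continuous fun h : ℝ => h ^ 2 * r := by fun_prop
          simpa using (this.tendsto 0).mono_left nhdsWithin_le_nhds
        filter_upwards [hc.eventually_lt_const zero_lt_one, self_mem_nhdsWithin] with h h1 hh
        rw [Set.indicator_of_notMem]
        simp only [Set.mem_Ici, not_le]
        rw [lt_div_iff₀ (pow_pos hh 2)]; linarith)
    simpa using this
  refine tendsto_of_tendsto_of_tendsto_of_le_of_le' tendsto_const_nhds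
    (h := fun h : ℝ => ENNReal.ofReal (M ^ 2) *
      (∫⁻ r in Set.Ici (1 / h ^ 2), ENNReal.ofReal (L r * r ^ (3 * (β + 1)))) +
        ENNReal.ofReal h * ∫⁻ u in Set.Ioc (0 : ℝ) 1, ENNReal.ofReal (u ^ (-(3 / 4) : ℝ))) ?_
    (Eventually.of_forall fun _ => zero_le) ?_
  · have h1 := ENNReal.Tendsto.const_mul htail (Or.inr (ENNReal.ofReal_ne_top (r := M ^ 2)))
    have hid : Tendsto (fun h : ℝ => ENNReal.ofReal h) (𝓝[>] 0) (𝓝 0) := by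
      simpa using (ENNReal.continuous_ofReal.tendsto 0).mono_left nhdsWithin_le_nhds
    have h2 := ENNReal.Tendsto.mul_const hid (Or.inr hpow)
    simpa using h1.add h2
  · filter_upwards [self_mem_nhdsWithin, (eventually_le_nhds (zero_lt_one' ℝ)).filter_mono
      nhdsWithin_le_nhds] with h hh h1
    exact hbound h hh h1

/-- The moment `∫ L((1 - y₀) / h²) (1 - y₀)^j ω(dy)` over the sphere. -/
noncomputable def capMoment (q : ℕ) (L : ℝ → ℝ) (h : ℝ) (j : ℕ) : ℝ :=
  ∫ y : Sph q, L ((1 - (y : Amb q) 0) / h ^ 2) * (1 - (y : Amb q) 0) ^ j ∂(surf q)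

/-- The constant in the asymptotics of `capMoment`. -/
noncomputable def capConst (q : ℕ) : ℝ :=
  (surf q Set.univ).toReal * 2 ^ (((q + 1 : ℕ) : ℝ) / 2 - 1)

theorem capConst_pos (q : ℕ) : 0 < capConst q :=
  mul_pos (ENNReal.toReal_pos (surf_univ_ne_zero q) (measure_ne_top _ _)) (by positivity)

theorem one_sub_coord_nonneg {q : ℕ} (y : Sph q) (i : Fin (q + 1)) : 0 ≤ 1 - (y : Amb q) i := by
  have h1 : ‖(y : Amb q) i‖ ≤ ‖(y : Amb q)‖ := PiLp.norm_apply_le _ i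
  have h2 : ‖(y : Amb q)‖ = 1 := by simp
  rw [h2, Real.norm_eq_abs] at h1
  linarith [le_abs_self ((y : Amb q) i)]

theorem measurable_coord {q : ℕ} (i : Fin (q + 1)) : Measurable fun y : Sph q => (y : Amb q) i := by
  fun_prop

/-- The substitution `t = h² r` in `lintegral_surf_first_coord` extracts the power of `h`, and `(2 -
h² r)^α` tends to `2^α`, the factor in `capConst`. The range `r < 2 / h²` is cut at `1 / h²`, only
the near part contributing in the limit. -/
theorem tendsto_capMoment {L : ℝ → ℝ} (hL : IsBorelProfile L) (q j : ℕ) :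
    Tendsto (fun h : ℝ => capMoment (q + 1) L h j / h ^ (q + 1 + 2 * j)) (𝓝[>] 0)
      (𝓝 (capConst q * ∫ r in Set.Ioi (0 : ℝ), L r * r ^ (((q + 1 : ℕ) : ℝ) / 2 - 1 + j))) := by
  have hLm := hL.measurable
  set α : ℝ := ((q + 1 : ℕ) : ℝ) / 2 - 1 with hα
  have hα' : -(1 / 2) ≤ α := by
    have : (0 : ℝ) ≤ q := q.cast_nonneg
    rw [hα]; push_cast; linarith
  have hβ : IntegrableOn (fun r => L r * r ^ (α + j)) (Set.Ioi 0) :=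
    hL.integrableOn_rpow (m := q + 1 + 2 * j) (by omega) (by rw [hα]; push_cast; ring)
  have hβ3 : IntegrableOn (fun r => L r * r ^ (3 * (α + j + 1))) (Set.Ioi 0) :=
    hL.integrableOn_rpow (m := 3 * (q + 1) + 6 * j + 2) (by omega) (by rw [hα]; push_cast; ring)
  have hJ : Tendsto (fun h : ℝ => ∫⁻ r in Set.Ioo 0 (2 / h ^ 2),
      ENNReal.ofReal (L r * r ^ (α + j) * (2 - h ^ 2 * r) ^ α)) (𝓝[>] 0)
      (𝓝 (∫⁻ r in Set.Ioi (0 : ℝ), ENNReal.ofReal (L r * r ^ (α + j) * 2 ^ α))) := by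
    have := (tendsto_setLIntegral_near hL α hβ).add (tendsto_setLIntegral_far hL hα' hβ3)
    rw [add_zero] at this
    refine this.congr' ?_
    filter_upwards [self_mem_nhdsWithin] with h hh
    have hh : 0 < h := hh
    rw [← lintegral_union measurableSet_Ico (Set.disjoint_left.2 fun r hr hr' =>
      absurd hr.2 (not_lt.2 hr'.1)), Set.Ioo_union_Ico_eq_Ioo (by positivity) (by gcongr; norm_num)]
  have hmom : ∀ h : ℝ, 0 < h → ∫⁻ y : Sph (q + 1), ENNReal.ofReal
      (L ((1 - (y : Amb (q + 1)) 0) / h ^ 2) * (1 - (y : Amb (q + 1)) 0) ^ j) ∂(surf (q + 1)) =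
      surf q Set.univ * (ENNReal.ofReal (h ^ (q + 1 + 2 * j)) * ∫⁻ r in Set.Ioo 0 (2 / h ^ 2),
        ENNReal.ofReal (L r * r ^ (α + j) * (2 - h ^ 2 * r) ^ α)) := by
    intro h hh
    rw [lintegral_surf_first_coord q (φ := fun t => ENNReal.ofReal (L (t / h ^ 2) * t ^ j))
      (by fun_prop)]
    congr 1
    have himg : (fun r => h ^ 2 * r) '' Set.Ioo 0 (2 / h ^ 2) = Set.Ioo 0 2 := by
      rw [Set.image_mul_left_Ioo (by positivity), mul_zero, mul_div_cancel₀ _ (by positivity)]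
    rw [← himg, lintegral_image_eq_lintegral_abs_deriv_mul (f' := fun _ => h ^ 2) measurableSet_Ioo
      (fun r _ => by simpa using ((hasDerivAt_id r).const_mul (h ^ 2)).hasDerivWithinAt)
      (fun a _ b _ hab => mul_left_cancel₀ (by positivity) hab),
      ← lintegral_const_mul' _ _ ENNReal.ofReal_ne_top]
    refine setLIntegral_congr_fun measurableSet_Ioo fun r hr => ?_
    have hr0 : 0 < r := hr.1
    have hr2 := hr.2
    rw [lt_div_iff₀ (by positivity)] at hr2
    have hu : 0 < 2 - h ^ 2 * r := by linarith
    have h0 := hL.nonneg r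
    rw [mul_div_cancel_left₀ _ (by positivity), ← ENNReal.ofReal_mul (by positivity),
      ← ENNReal.ofReal_mul (by positivity), ← ENNReal.ofReal_mul (by positivity)]
    congr 1
    rw [Real.mul_rpow (by positivity) hu.le, Real.mul_rpow (by positivity) hr0.le, mul_pow,
      abs_of_pos (by positivity), Real.rpow_add hr0, Real.rpow_natCast]
    -- The three factors come from the Jacobian, from `t ^ j` and from `t ^ α`; the exponent is `2
    -- (1 + j + α)`.
    have : (h ^ 2) * ((h ^ 2) ^ j * (h ^ 2) ^ α) = h ^ (q + 1 + 2 * j) := by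
      rw [← Real.rpow_natCast (h ^ 2) j, ← Real.rpow_add (by positivity)]
      conv_lhs => rw [← Real.rpow_one (h ^ 2)]
      rw [← Real.rpow_mul (by positivity), ← Real.rpow_add (by positivity), ← Real.rpow_natCast h 2,
        ← Real.rpow_mul hh.le, ← Real.rpow_natCast]
      congr 1
      rw [hα]; push_cast; ring
    rw [← this]; ring
  have hlim : Tendsto (fun h : ℝ => surf q Set.univ * ∫⁻ r in Set.Ioo 0 (2 / h ^ 2),
        ENNReal.ofReal (L r * r ^ (α + j) * (2 - h ^ 2 * r) ^ α)) (𝓝[>] 0)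
      (𝓝 (ENNReal.ofReal (capConst q * ∫ r in Set.Ioi (0 : ℝ), L r * r ^ (α + j)))) := by
    have h1 := ENNReal.Tendsto.const_mul hJ (Or.inr (measure_ne_top (surf q) Set.univ))
    convert h1 using 2
    have hnn : 0 ≤ᵐ[volume.restrict (Set.Ioi (0 : ℝ))] fun r => L r * r ^ (α + j) :=
      (ae_restrict_iff' measurableSet_Ioi).2 (ae_of_all _ fun r hr =>
        mul_nonneg (hL.nonneg r) (Real.rpow_nonneg (Set.mem_Ioi.1 hr).le _))
    have h2α : (0 : ℝ) ≤ 2 ^ α := by positivity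
    rw [show capConst q = (surf q Set.univ).toReal * 2 ^ α from rfl,
      ENNReal.ofReal_mul (mul_nonneg ENNReal.toReal_nonneg h2α),
      ENNReal.ofReal_mul ENNReal.toReal_nonneg, ENNReal.ofReal_toReal (measure_ne_top _ _), ofReal_integral_eq_lintegral_ofReal hβ hnn, mul_assoc,
      ← lintegral_const_mul' _ _ ENNReal.ofReal_ne_top]
    congr 1
    refine lintegral_congr fun r => ?_
    rw [mul_comm _ ((2 : ℝ) ^ α), ENNReal.ofReal_mul h2α]
  have hreal := (ENNReal.tendsto_toReal ENNReal.ofReal_ne_top).comp hlim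
  rw [ENNReal.toReal_ofReal (mul_nonneg (capConst_pos q).le (setIntegral_nonneg measurableSet_Ioi
    fun r hr => mul_nonneg (hL.nonneg r) (Real.rpow_nonneg (Set.mem_Ioi.1 hr).le _)))] at hreal
  refine hreal.congr' ?_
  filter_upwards [self_mem_nhdsWithin] with h hh
  have hh : 0 < h := hh
  have hc := measurable_coord (q := q + 1) 0
  rw [capMoment, integral_eq_lintegral_of_nonneg_ae (ae_of_all _ fun y =>
    mul_nonneg (hL.nonneg _) (pow_nonneg (one_sub_coord_nonneg y 0) j))
    (by fun_prop), hmom h hh]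
  rw [mul_left_comm, ENNReal.toReal_mul (a := ENNReal.ofReal _),
    ENNReal.toReal_ofReal (by positivity), mul_div_cancel_left₀ _ (by positivity)]
  rfl

end Moments

end DirLin

namespace DirLin
open scoped ENNReal Real

/-! ### Haar measure on the orthogonal group and the lift of `Ω_q × ℝ` to it. -/

section Rotations

/-- The orthogonal group of `ℝ^(q+1)`. -/
abbrev Rot (q : ℕ) : Type := Matrix.orthogonalGroup (Fin (q + 1)) ℝ

instance {q : ℕ} : MeasurableSpace (Rot q) := borel _
instance {q : ℕ} : BorelSpace (Rot q) := ⟨rfl⟩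

instance {q : ℕ} : SecondCountableTopology (Rot q) :=
  haveI : SecondCountableTopology (Matrix (Fin (q + 1)) (Fin (q + 1)) ℝ) :=
    inferInstanceAs (SecondCountableTopology (Fin (q + 1) → Fin (q + 1) → ℝ))
  TopologicalSpace.Subtype.secondCountableTopology
    {A : Matrix (Fin (q + 1)) (Fin (q + 1)) ℝ | A ∈ Matrix.orthogonalGroup (Fin (q + 1)) ℝ}

instance {q : ℕ} : CompactSpace (Rot q) := by
  have hcpt : IsCompact (Set.pi Set.univ fun _ : Fin (q + 1) => Set.pi Set.univ
      fun _ : Fin (q + 1) => Set.Icc (-1 : ℝ) 1) :=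
    isCompact_univ_pi fun _ => isCompact_univ_pi fun _ => isCompact_Icc
  have hclosed : IsClosed {A : Matrix (Fin (q + 1)) (Fin (q + 1)) ℝ |
      A ∈ Matrix.orthogonalGroup (Fin (q + 1)) ℝ} := by
    have : {A : Matrix (Fin (q + 1)) (Fin (q + 1)) ℝ | A ∈ Matrix.orthogonalGroup (Fin (q + 1)) ℝ} =
        {A | A * star A = 1} := by
      ext A; exact Matrix.mem_orthogonalGroup_iff _ _
    rw [this]
    exact isClosed_eq (by fun_prop) continuous_const
  refine isCompact_iff_compactSpace.1 (hcpt.of_isClosed_subset hclosed fun A hA => ?_)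
  intro i _ j _
  have := entry_norm_bound_of_unitary hA i j
  rw [Real.norm_eq_abs, abs_le] at this
  exact this

/-- The isometry of `ℝ^(q+1)` given by an orthogonal matrix. -/
noncomputable def rotIso {q : ℕ} : Rot q ≃* (Amb q ≃ₗᵢ[ℝ] Amb q) :=
  let e := Matrix.toEuclideanCLM (n := Fin (q + 1)) (𝕜 := ℝ)
  (Unitary.mapEquiv (⟨⟨e.toEquiv, map_mul e⟩, map_star e⟩ :
    Matrix (Fin (q + 1)) (Fin (q + 1)) ℝ ≃⋆* (Amb q →L[ℝ] Amb q))).toMulEquiv.trans Unitary.linearIsometryEquiv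

theorem rotIso_apply {q : ℕ} (R : Rot q) (v : Amb q) (i : Fin (q + 1)) :
    rotIso R v i = ∑ j, (R : Matrix _ _ ℝ) i j * v j := by
  change (Matrix.toEuclideanCLM (n := Fin (q + 1)) (𝕜 := ℝ) R.1 v) i = _
  rw [Matrix.ofLp_toEuclideanCLM]
  rfl

theorem continuous_rotIso {q : ℕ} : Continuous fun p : Rot q × Amb q => rotIso p.1 p.2 := by
  refine (PiLp.continuous_toLp 2 _).comp (continuous_pi fun i => ?_ : Continuous
    fun p : Rot q × Amb q => fun i => rotIso p.1 p.2 i)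
  simp only [rotIso_apply]
  refine continuous_finsetSum _ fun j _ => ?_
  have h1 : Continuous fun p : Rot q × Amb q => (p.1 : Matrix (Fin (q + 1)) (Fin (q + 1)) ℝ) :=
    continuous_subtype_val.comp continuous_fst
  exact (h1.matrix_elem i j).mul (by fun_prop)

/-- The action of an orthogonal matrix on the sphere. -/
noncomputable def rotAct {q : ℕ} (R : Rot q) (y : Sph q) : Sph q := rotSph (rotIso R) y

theorem coe_rotAct {q : ℕ} (R : Rot q) (y : Sph q) : (rotAct R y : Amb q) = rotIso R y := rfl

theorem rotAct_mul {q : ℕ} (R S : Rot q) (y : Sph q) :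
    rotAct (R * S) y = rotAct R (rotAct S y) := by
  ext1; simp [coe_rotAct]

theorem continuous_rotAct {q : ℕ} : Continuous fun p : Rot q × Sph q => rotAct p.1 p.2 :=
  Continuous.subtype_mk (continuous_rotIso.comp
    (continuous_fst.prodMk (continuous_subtype_val.comp continuous_snd))) _

theorem exists_rotAct_eq {q : ℕ} (x y : Sph q) : ∃ R, rotAct R x = y := by
  obtain ⟨T, hT⟩ : ∃ T : Amb q ≃ₗᵢ[ℝ] Amb q, T x = y :=
    ⟨_, Submodule.reflection_sub (v := (x : Amb q)) (w := (y : Amb q)) (by simp)⟩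
  exact ⟨rotIso.symm T, by ext1; simp [coe_rotAct, hT]⟩

/-- A right-invariant probability measure on the orthogonal group. -/
noncomputable def rotHaar (q : ℕ) : Measure (Rot q) := (Measure.haarMeasure ⊤).inv

instance {q : ℕ} : IsProbabilityMeasure (rotHaar q) where
  measure_univ := by
    rw [rotHaar, Measure.inv_apply, Set.inv_univ]
    exact Measure.haarMeasure_self (K₀ := ⊤)

instance {q : ℕ} : (rotHaar q).IsMulRightInvariant :=
  inferInstanceAs (Measure.haarMeasure ⊤).inv.IsMulRightInvariant

theorem lintegral_surf_rotAct {q : ℕ} (R : Rot q) (φ : Sph q → ℝ≥0∞) :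
    ∫⁻ y, φ (rotAct R y) ∂(surf q) = ∫⁻ y, φ y ∂(surf q) := by
  conv_rhs => rw [← map_rotEquiv_surf (rotIso R), lintegral_map_equiv]
  rfl

theorem integral_surf_rotAct {q : ℕ} (R : Rot q) (φ : Sph q → ℝ) :
    ∫ y, φ (rotAct R y) ∂(surf q) = ∫ y, φ y ∂(surf q) := by
  conv_rhs => rw [← map_rotEquiv_surf (rotIso R), MeasureTheory.integral_map_equiv]
  rfl

/-- The orbit map of a random rotation is uniformly distributed on the sphere. -/
theorem lintegral_rotHaar {q : ℕ} (p : Sph q) {φ : Sph q → ℝ≥0∞} (hφ : Measurable φ) :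
    ∫⁻ R, φ (rotAct R p) ∂(rotHaar q) = (surf q Set.univ)⁻¹ * ∫⁻ y, φ y ∂(surf q) := by
  -- Right invariance and transitivity make the integral independent of the base point. It can
  -- therefore be averaged over the sphere, and after exchanging the integrals the rotation
  -- invariance of the surface measure evaluates it.
  have hindep : ∀ y, ∫⁻ R, φ (rotAct R y) ∂(rotHaar q) = ∫⁻ R, φ (rotAct R p) ∂(rotHaar q) := by
    intro y
    obtain ⟨S, rfl⟩ := exists_rotAct_eq p y
    simp only [← rotAct_mul]
    exact lintegral_mul_right_eq_self (fun R => φ (rotAct R p)) S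
  have h1 : ∫⁻ y, ∫⁻ R, φ (rotAct R y) ∂(rotHaar q) ∂(surf q) = ∫⁻ y, φ y ∂(surf q) := by
    rw [lintegral_lintegral_swap]
    · simp only [lintegral_surf_rotAct, lintegral_const, measure_univ, mul_one]
    · exact (hφ.comp (continuous_rotAct.measurable.comp measurable_swap)).aemeasurable
  simp only [hindep, lintegral_const] at h1
  rw [← h1, mul_comm, mul_assoc, ENNReal.mul_inv_cancel (surf_univ_ne_zero q) (measure_ne_top _ _),
    mul_one]

/-- The measure on `O(q+1) × ℝ` lifting `cyl q`. -/
noncomputable def rotCyl (q : ℕ) : Measure (Rot q × ℝ) := (rotHaar q).prod volume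

instance {q : ℕ} : SFinite (rotCyl q) := inferInstanceAs (SFinite ((rotHaar q).prod volume))

theorem lintegral_rotCyl {q : ℕ} (p : Sph q) {φ : Sph q × ℝ → ℝ≥0∞} (hφ : Measurable φ) :
    ∫⁻ w, φ (rotAct w.1 p, w.2) ∂(rotCyl q) = (surf q Set.univ)⁻¹ * ∫⁻ w, φ w ∂(cyl q) := by
  have hm : Measurable fun w : Rot q × ℝ => φ (rotAct w.1 p, w.2) :=
    hφ.comp (((continuous_rotAct.comp (Continuous.prodMk_left p)).measurable.comp
      measurable_fst).prodMk measurable_snd)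
  rw [rotCyl, cyl, lintegral_prod_symm _ hm.aemeasurable, lintegral_prod_symm _ hφ.aemeasurable,
    ← lintegral_const_mul _ (Measurable.lintegral_prod_left' hφ)]
  refine lintegral_congr fun z => ?_
  exact lintegral_rotHaar p (φ := fun y => φ (y, z)) (by fun_prop)

/-- The right-hand side does not involve `p`: over random rotations every base point sees the same
mean square. This invariance is the reason for lifting to the orthogonal group. -/
theorem sqInt_rotCyl {q : ℕ} (p : Sph q) {u : Sph q × ℝ → ℝ} (hu : Measurable u) :
    sqInt (rotCyl q) (fun w => u (rotAct w.1 p, w.2)) = (surf q Set.univ)⁻¹ * sqInt (cyl q) u :=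
  lintegral_rotCyl p (φ := fun w => ENNReal.ofReal (u w ^ 2)) (by fun_prop)

theorem sqInt_cyl_eq {q : ℕ} (p : Sph q) {u : Sph q × ℝ → ℝ} (hu : Measurable u) :
    sqInt (cyl q) u = surf q Set.univ * sqInt (rotCyl q) (fun w => u (rotAct w.1 p, w.2)) := by
  rw [sqInt_rotCyl p hu, ← mul_assoc,
    ENNReal.mul_inv_cancel (surf_univ_ne_zero q) (measure_ne_top _ _), one_mul]

end Rotations

end DirLin

namespace DirLin
open scoped ENNReal Real

/-! ### Homogeneity and regularity of the radial extension. -/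

section Derivatives

variable {q : ℕ}

/-- The set of points where the radial extension is smooth. -/
def offAxis (q : ℕ) : Set (Amb q × ℝ) := {p | p.1 ≠ 0}

theorem isOpen_offAxis : IsOpen (offAxis q) := isOpen_ne_fun continuous_fst continuous_const

theorem continuous_emb : Continuous (emb : Sph q × ℝ → Amb q × ℝ) :=
  (continuous_subtype_val.comp continuous_fst).prodMk continuous_snd

theorem sph_ne_zero (x : Sph q) : (x : Amb q) ≠ 0 := by
  intro h
  have : ‖(x : Amb q)‖ = 1 := by simp
  rw [h] at this; simp at this

theorem emb_mem_offAxis (p : Sph q × ℝ) : emb p ∈ offAxis q := sph_ne_zero p.1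

theorem radialExt_emb (f : Sph q × ℝ → ℝ) (p : Sph q × ℝ) : radialExt f (emb p) = f p := by
  have h : (p.1 : Amb q) ≠ 0 := sph_ne_zero p.1
  have h1 : ‖(p.1 : Amb q)‖ = 1 := by simp
  rw [radialExt, dif_neg (show (emb p).1 ≠ 0 from h)]
  congr 1
  refine Prod.ext (Subtype.ext ?_) rfl
  simp [emb]

theorem radialExt_smul (f : Sph q × ℝ → ℝ) {c : ℝ} (hc : 0 < c) (v : Amb q) (z : ℝ) :
    radialExt f (c • v, z) = radialExt f (v, z) := by
  by_cases hv : v = 0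
  · simp [hv]
  · have hcv : c • v ≠ 0 := smul_ne_zero hc.ne' hv
    simp only [radialExt, dif_neg hv, dif_neg hcv]
    congr 2
    ext1
    simp only [norm_smul, Real.norm_eq_abs, abs_of_pos hc, mul_inv, smul_smul]
    congr 1
    field_simp

/-- Scaling of the directional variable. -/
noncomputable def dirScale (q : ℕ) (c : ℝ) (hc : c ≠ 0) : (Amb q × ℝ) ≃L[ℝ] (Amb q × ℝ) :=
  (ContinuousLinearEquiv.smulLeft (Units.mk0 c hc)).prodCongr (ContinuousLinearEquiv.refl ℝ ℝ)

theorem dirScale_apply {c : ℝ} (hc : c ≠ 0) (p : Amb q × ℝ) :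
    dirScale q c hc p = (c • p.1, p.2) := rfl

/-- Chain rule for a homogeneous function: differentiation in the direction variable lowers the
degree by one. The free factor `a` allows the use for the extension (`a = 1`) and for its gradient
(`a = c⁻¹`). -/
theorem fderiv_dirScale {F : Amb q × ℝ → ℝ} {c a : ℝ} (hc : 0 < c)
    (hF : ∀ v z, F (c • v, z) = a * F (v, z)) (v w : Amb q) (z : ℝ) :
    c * fderiv ℝ F (c • v, z) (w, 0) = a * fderiv ℝ F (v, z) (w, 0) := by
  have h1 : F ∘ dirScale q c hc.ne' = fun p => a * F p := by
    ext p; exact hF p.1 p.2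
  have h0 : fderiv ℝ (fun p => a * F p) (v, z) = a • fderiv ℝ F (v, z) :=
    congrFun (fderiv_const_smul_field (𝕜 := ℝ) (f := F) a) (v, z)
  have h2 := (dirScale q c hc.ne').comp_right_fderiv (f := F) (x := (v, z))
  rw [h1, h0] at h2
  have h3 := congrArg (fun T => T (w, (0 : ℝ))) h2
  simp only [ContinuousLinearMap.comp_apply, smul_apply,
    ContinuousLinearEquiv.coe_coe, dirScale_apply, smul_eq_mul] at h3
  rw [h3]
  have : ((c • w, (0 : ℝ)) : Amb q × ℝ) = c • (w, (0 : ℝ)) := by ext <;> simp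
  rw [this, map_smul, smul_eq_mul]

theorem grad_smul (f : Sph q × ℝ → ℝ) {c : ℝ} (hc : 0 < c) (v : Amb q) (z : ℝ) (i : Fin (q + 1)) :
    grad (radialExt f) (c • v, z) (Sum.inl i) = c⁻¹ * grad (radialExt f) (v, z) (Sum.inl i) := by
  have := fderiv_dirScale (F := radialExt f) (a := 1) hc
    (fun v z => by rw [radialExt_smul f hc, one_mul]) v (EuclideanSpace.single i 1) z
  simp only [grad, coordDir]
  rw [eq_inv_mul_iff_mul_eq₀ hc.ne', this, one_mul]

theorem hess_smul (f : Sph q × ℝ → ℝ) {c : ℝ} (hc : 0 < c) (v : Amb q) (z : ℝ) (i j : Fin (q + 1)) :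
    hess (radialExt f) (c • v, z) (Sum.inl i) (Sum.inl j) =
      (c ^ 2)⁻¹ * hess (radialExt f) (v, z) (Sum.inl i) (Sum.inl j) := by
  have := fderiv_dirScale (F := fun p => grad (radialExt f) p (Sum.inl j)) (a := c⁻¹) hc
    (fun v z => grad_smul f hc v z j) v (EuclideanSpace.single i 1) z
  simp only [hess, coordDir]
  rw [pow_two, mul_inv, mul_assoc, eq_inv_mul_iff_mul_eq₀ hc.ne', this]

theorem measurable_grad (F : Amb q × ℝ → ℝ) (a : Fin (q + 1) ⊕ Unit) :
    Measurable fun p => grad F p a := measurable_fderiv_apply_const ℝ F _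

theorem measurable_hess (F : Amb q × ℝ → ℝ) (a b : Fin (q + 1) ⊕ Unit) :
    Measurable fun p => hess F p a b := measurable_fderiv_apply_const ℝ _ _

variable {f : Sph q × ℝ → ℝ}

theorem SmoothDensity.hasFDerivAt (hf : SmoothDensity f) {p : Amb q × ℝ} (hp : p ∈ offAxis q) :
    HasFDerivAt (radialExt f) (fderiv ℝ (radialExt f) p) p :=
  ((hf.contDiffOn.contDiffAt (isOpen_offAxis.mem_nhds hp)).differentiableAt
    (by norm_num)).hasFDerivAt

theorem SmoothDensity.contDiffOn_grad (hf : SmoothDensity f) (a : Fin (q + 1) ⊕ Unit) :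
    ContDiffOn ℝ 1 (fun p => grad (radialExt f) p a) (offAxis q) :=
  (hf.contDiffOn.fderiv_of_isOpen isOpen_offAxis (m := 1) (by norm_num)).clm_apply contDiffOn_const

theorem SmoothDensity.hasFDerivAt_grad (hf : SmoothDensity f) (a : Fin (q + 1) ⊕ Unit)
    {p : Amb q × ℝ} (hp : p ∈ offAxis q) :
    HasFDerivAt (fun p => grad (radialExt f) p a)
      (fderiv ℝ (fun p => grad (radialExt f) p a) p) p :=
  (((hf.contDiffOn_grad a).contDiffAt (isOpen_offAxis.mem_nhds hp)).differentiableAt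
    (by norm_num)).hasFDerivAt

theorem SmoothDensity.continuousOn_grad (hf : SmoothDensity f) (a : Fin (q + 1) ⊕ Unit) :
    ContinuousOn (fun p => grad (radialExt f) p a) (offAxis q) := (hf.contDiffOn_grad a).continuousOn

theorem SmoothDensity.continuousOn_hess (hf : SmoothDensity f) (a b : Fin (q + 1) ⊕ Unit) :
    ContinuousOn (fun p => hess (radialExt f) p a b) (offAxis q) :=
  (((hf.contDiffOn_grad b).fderiv_of_isOpen isOpen_offAxis (m := 0) (by norm_num)).clm_apply
    contDiffOn_const).continuousOn

theorem SmoothDensity.continuous (hf : SmoothDensity f) : Continuous f := by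
  have h : Continuous fun p => radialExt f (emb p) :=
    hf.contDiffOn.continuousOn.comp_continuous continuous_emb emb_mem_offAxis
  simpa only [radialExt_emb] using h

theorem SmoothDensity.continuous_grad_emb (hf : SmoothDensity f) (a : Fin (q + 1) ⊕ Unit) :
    Continuous fun p => grad (radialExt f) (emb p) a :=
  (hf.continuousOn_grad a).comp_continuous continuous_emb emb_mem_offAxis

theorem SmoothDensity.continuous_hess_emb (hf : SmoothDensity f) (a b : Fin (q + 1) ⊕ Unit) :
    Continuous fun p => hess (radialExt f) (emb p) a b :=
  (hf.continuousOn_hess a b).comp_continuous continuous_emb emb_mem_offAxis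

theorem dir_eq_sum (w : Amb q) :
    ((w, 0) : Amb q × ℝ) = ∑ i, w i • (coordDir (Sum.inl i) : Amb q × ℝ) := by
  have h := (EuclideanSpace.basisFun (Fin (q + 1)) ℝ).sum_repr w
  ext1
  · simp only [Prod.fst_sum, Prod.smul_fst, coordDir]
    simpa using h.symm
  · simp [Prod.snd_sum, coordDir]

theorem hasDerivAt_chord {F : Amb q × ℝ → ℝ} {v w : Amb q} {z s : ℝ}
    (hF : HasFDerivAt F (fderiv ℝ F (v + s • w, z)) (v + s • w, z)) :
    HasDerivAt (fun s : ℝ => F (v + s • w, z)) (∑ i, w i * grad F (v + s • w, z) (Sum.inl i)) s := by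
  have h1 : HasDerivAt (fun s : ℝ => ((v + s • w, z) : Amb q × ℝ)) (w, 0) s := by
    have : HasDerivAt (fun s : ℝ => v + s • w) w s := by
      simpa using ((hasDerivAt_id s).smul_const w).const_add v
    exact this.prodMk (hasDerivAt_const s z)
  have h2 := hF.comp_hasDerivAt s h1
  refine h2.congr_deriv ?_
  rw [dir_eq_sum, map_sum]
  simp [grad]

theorem SmoothDensity.hasDerivAt_chord (hf : SmoothDensity f) {v w : Amb q} {z s : ℝ}
    (h : v + s • w ≠ 0) :
    HasDerivAt (fun s : ℝ => radialExt f (v + s • w, z))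
      (∑ i, w i * grad (radialExt f) (v + s • w, z) (Sum.inl i)) s :=
  DirLin.hasDerivAt_chord (hf.hasFDerivAt h)

theorem SmoothDensity.hasDerivAt_grad_chord (hf : SmoothDensity f) {v w : Amb q} {z s : ℝ}
    (h : v + s • w ≠ 0) :
    HasDerivAt (fun s : ℝ => ∑ i, w i * grad (radialExt f) (v + s • w, z) (Sum.inl i))
      (∑ i, ∑ j, w i * w j * hess (radialExt f) (v + s • w, z) (Sum.inl i) (Sum.inl j)) s := by
  have : HasDerivAt (fun s : ℝ => ∑ j, w j * grad (radialExt f) (v + s • w, z) (Sum.inl j))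
      (∑ j, w j * ∑ i, w i * hess (radialExt f) (v + s • w, z) (Sum.inl i) (Sum.inl j)) s :=
    HasDerivAt.fun_sum fun j _ => (DirLin.hasDerivAt_chord (hf.hasFDerivAt_grad (Sum.inl j) h)).const_mul _
  refine this.congr_deriv ?_
  rw [Finset.sum_comm]
  refine Finset.sum_congr rfl fun j _ => ?_
  rw [Finset.mul_sum]
  exact Finset.sum_congr rfl fun i _ => by ring

theorem hasDerivAt_line {F : Amb q × ℝ → ℝ} {v : Amb q} {z s w : ℝ}
    (hF : HasFDerivAt F (fderiv ℝ F (v, z + s * w)) (v, z + s * w)) :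
    HasDerivAt (fun s : ℝ => F (v, z + s * w)) (w * grad F (v, z + s * w) (Sum.inr ())) s := by
  have h1 : HasDerivAt (fun s : ℝ => ((v, z + s * w) : Amb q × ℝ)) (0, w) s := by
    have : HasDerivAt (fun s : ℝ => z + s * w) w s := by
      simpa using ((hasDerivAt_id s).mul_const w).const_add z
    exact (hasDerivAt_const s v).prodMk this
  have h2 := hF.comp_hasDerivAt s h1
  refine h2.congr_deriv ?_
  have : ((0, w) : Amb q × ℝ) = w • coordDir (Sum.inr ()) := by ext <;> simp [coordDir]
  rw [this, map_smul, smul_eq_mul, grad]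

/-- The Hessian at a general point, expressed by its values on `Ω_q × ℝ`. -/
theorem hess_eq_normalized (f : Sph q × ℝ → ℝ) {v : Amb q} (hv : v ≠ 0) (z : ℝ) (i j : Fin (q + 1)) :
    hess (radialExt f) (v, z) (Sum.inl i) (Sum.inl j) = (‖v‖ ^ 2)⁻¹ *
      hess (radialExt f) (emb (⟨‖v‖⁻¹ • v, by simp [norm_smul, hv]⟩, z)) (Sum.inl i) (Sum.inl j) := by
  have h := hess_smul f (norm_pos_iff.2 hv) (‖v‖⁻¹ • v) z i j
  rwa [smul_smul, mul_inv_cancel₀ (norm_ne_zero_iff.2 hv), one_smul] at h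

theorem grad_eq_normalized (f : Sph q × ℝ → ℝ) {v : Amb q} (hv : v ≠ 0) (z : ℝ) (i : Fin (q + 1)) :
    grad (radialExt f) (v, z) (Sum.inl i) = ‖v‖⁻¹ *
      grad (radialExt f) (emb (⟨‖v‖⁻¹ • v, by simp [norm_smul, hv]⟩, z)) (Sum.inl i) := by
  have h := grad_smul f (norm_pos_iff.2 hv) (‖v‖⁻¹ • v) z i
  rwa [smul_smul, mul_inv_cancel₀ (norm_ne_zero_iff.2 hv), one_smul] at h

end Derivatives

end DirLin

namespace DirLin
open scoped ENNReal Real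

/-! ### Taylor expansion along rotated chords, in mean square over rotations. -/

section Chords

variable {q : ℕ} {f : Sph q × ℝ → ℝ}

/-- The point at parameter `s` on the chord from `x` to `y`. -/
noncomputable def chordPt (x y : Amb q) (s : ℝ) : Amb q := x + s • (y - x)

theorem rotIso_chordPt (R : Rot q) (x y : Amb q) (s : ℝ) :
    rotIso R (chordPt x y s) = rotIso R x + s • rotIso R (y - x) := by
  simp [chordPt]

theorem continuous_chordPt (x y : Amb q) : Continuous (chordPt x y) := by
  unfold chordPt; fun_prop

/-- With a nonnegative inner product, `‖(1 - s) x + s y‖² ≥ (1 - s)² + s² ≥ 1/2`. Such a chord stays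
away from the origin, where the extension is singular. -/
theorem half_le_norm_chordPt_sq {x y : Sph q} (hxy : 0 ≤ inner ℝ (x : Amb q) (y : Amb q)) {s : ℝ}
    (hs : s ∈ Set.Icc (0 : ℝ) 1) : 1 / 2 ≤ ‖chordPt (x : Amb q) y s‖ ^ 2 := by
  have hx : ‖(x : Amb q)‖ = 1 := by simp
  have hy : ‖(y : Amb q)‖ = 1 := by simp
  have e : chordPt (x : Amb q) y s = (1 - s) • (x : Amb q) + s • (y : Amb q) := by
    rw [chordPt, smul_sub, sub_smul, one_smul]; abel
  rw [e, norm_add_sq_real, norm_smul, norm_smul, hx, hy, real_inner_smul_left, real_inner_smul_right]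
  simp only [mul_one, Real.norm_eq_abs, sq_abs]
  have : 0 ≤ (1 - s) * (s * inner ℝ (x : Amb q) (y : Amb q)) :=
    mul_nonneg (by linarith [hs.2]) (mul_nonneg hs.1 hxy)
  nlinarith [sq_nonneg (1 - 2 * s)]

theorem chordPt_ne_zero {x y : Sph q} (hxy : 0 ≤ inner ℝ (x : Amb q) (y : Amb q)) {s : ℝ}
    (hs : s ∈ Set.Icc (0 : ℝ) 1) : chordPt (x : Amb q) y s ≠ 0 := by
  intro h
  have := half_le_norm_chordPt_sq hxy hs
  rw [h] at this; norm_num at this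

/-- The second order Taylor remainder along the rotated chord from `x` to `y`. -/
noncomputable def dirRem (f : Sph q × ℝ → ℝ) (x y : Sph q) (w : Rot q × ℝ) : ℝ :=
  f (rotAct w.1 y, w.2) - f (rotAct w.1 x, w.2) -
    (∑ i, rotIso w.1 ((y : Amb q) - x) i * grad (radialExt f) (emb (rotAct w.1 x, w.2)) (Sum.inl i)) -
    (∑ i, ∑ j, rotIso w.1 ((y : Amb q) - x) i * rotIso w.1 ((y : Amb q) - x) j *
      hess (radialExt f) (emb (rotAct w.1 x, w.2)) (Sum.inl i) (Sum.inl j)) / 2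

/-- An entry of the Hessian at a rotated point. -/
noncomputable def hessRot (f : Sph q × ℝ → ℝ) (i j : Fin (q + 1)) (v : Amb q) (w : Rot q × ℝ) : ℝ :=
  hess (radialExt f) (rotIso w.1 v, w.2) (Sum.inl i) (Sum.inl j)

/-- An entry of the gradient at a rotated point. -/
noncomputable def gradRot (f : Sph q × ℝ → ℝ) (i : Fin (q + 1)) (v : Amb q) (w : Rot q × ℝ) : ℝ :=
  grad (radialExt f) (rotIso w.1 v, w.2) (Sum.inl i)

theorem hessRot_apply (f : Sph q × ℝ → ℝ) (i j : Fin (q + 1)) (v : Amb q) (w : Rot q × ℝ) :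
    hessRot f i j v w = hess (radialExt f) (rotIso w.1 v, w.2) (Sum.inl i) (Sum.inl j) := rfl

theorem gradRot_apply (f : Sph q × ℝ → ℝ) (i : Fin (q + 1)) (v : Amb q) (w : Rot q × ℝ) :
    gradRot f i v w = grad (radialExt f) (rotIso w.1 v, w.2) (Sum.inl i) := rfl

theorem continuous_rotPoint : Continuous fun p : Amb q × (Rot q × ℝ) =>
    ((rotIso p.2.1 p.1, p.2.2) : Amb q × ℝ) :=
  (continuous_rotIso.comp (by fun_prop : Continuous fun p : Amb q × (Rot q × ℝ) =>
    (p.2.1, p.1))).prodMk (by fun_prop)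

theorem measurable_hessRot (f : Sph q × ℝ → ℝ) (i j : Fin (q + 1)) :
    Measurable (Function.uncurry (hessRot f i j)) :=
  (measurable_hess _ _ _).comp continuous_rotPoint.measurable

theorem measurable_gradRot (f : Sph q × ℝ → ℝ) (i : Fin (q + 1)) :
    Measurable (Function.uncurry (gradRot f i)) :=
  (measurable_grad _ _).comp continuous_rotPoint.measurable

theorem measurable_hessRot_right (f : Sph q × ℝ → ℝ) (i j : Fin (q + 1)) (v : Amb q) :
    Measurable (hessRot f i j v) :=
  Measurable.of_uncurry_left (measurable_hessRot f i j)

theorem measurable_gradRot_right (f : Sph q × ℝ → ℝ) (i : Fin (q + 1)) (v : Amb q) :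
    Measurable (gradRot f i v) :=
  Measurable.of_uncurry_left (measurable_gradRot f i)

attribute [irreducible] hessRot gradRot

theorem rotAct_normalized (R : Rot q) {v : Amb q} (hv : v ≠ 0) :
    (⟨‖rotIso R v‖⁻¹ • rotIso R v, by simp [norm_smul, hv]⟩ : Sph q) =
      rotAct R ⟨‖v‖⁻¹ • v, by simp [norm_smul, hv]⟩ := by
  ext1; simp [coe_rotAct]

/-- Homogeneity of degree `-2` extracts the power of `‖v‖`, and invariance over rotations removes
the dependence on the direction of `v`. -/
theorem sqInt_hessRot (hf : SmoothDensity f) (i j : Fin (q + 1)) {v : Amb q} (hv : v ≠ 0) :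
    sqInt (rotCyl q) (hessRot f i j v) = ENNReal.ofReal (((‖v‖ ^ 2)⁻¹) ^ 2) *
      ((surf q Set.univ)⁻¹ * sqInt (cyl q)
        (fun p => hess (radialExt f) (emb p) (Sum.inl i) (Sum.inl j))) := by
  rw [← sqInt_rotCyl ⟨‖v‖⁻¹ • v, by simp [norm_smul, hv]⟩ (hf.continuous_hess_emb _ _).measurable,
    ← sqInt_const_mul]
  congr 1
  ext w
  have hR : rotIso w.1 v ≠ 0 := by simpa using hv
  rw [hessRot_apply, hess_eq_normalized f hR, rotAct_normalized w.1 hv, LinearIsometryEquiv.norm_map]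

theorem sqInt_gradRot (hf : SmoothDensity f) (i : Fin (q + 1)) {v : Amb q} (hv : v ≠ 0) :
    sqInt (rotCyl q) (gradRot f i v) = ENNReal.ofReal ((‖v‖⁻¹) ^ 2) *
      ((surf q Set.univ)⁻¹ * sqInt (cyl q)
        (fun p => grad (radialExt f) (emb p) (Sum.inl i))) := by
  rw [← sqInt_rotCyl ⟨‖v‖⁻¹ • v, by simp [norm_smul, hv]⟩ (hf.continuous_grad_emb _).measurable,
    ← sqInt_const_mul]
  congr 1
  ext w
  have hR : rotIso w.1 v ≠ 0 := by simpa using hv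
  rw [gradRot_apply, grad_eq_normalized f hR, rotAct_normalized w.1 hv, LinearIsometryEquiv.norm_map]

theorem inv_surf_mul_sqInt_ne_top {u : Sph q × ℝ → ℝ} (hu : MemLp u 2 (cyl q)) :
    (surf q Set.univ)⁻¹ * sqInt (cyl q) u ≠ ⊤ :=
  ENNReal.mul_ne_top (ENNReal.inv_ne_top.2 (surf_univ_ne_zero q))
    ((memLp_two_iff_sqInt hu.1).1 hu).ne

/-- The Hessian entries depend continuously on the point, in mean square over rotations. -/
theorem tendsto_sqInt_hessRot_sub (hf : SmoothDensity f) (i j : Fin (q + 1)) {x : Amb q}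
    (hx : x ≠ 0) :
    Tendsto (fun v => sqInt (rotCyl q) (fun w => hessRot f i j v w - hessRot f i j x w)) (𝓝 x)
      (𝓝 0) := by
  rw [tendsto_iff_seq_tendsto]
  intro v hv
  have hne : ∀ᶠ n in atTop, v n ≠ 0 := hv.eventually_ne hx
  -- Pointwise convergence is continuity of the Hessian off the axis; convergence of the norms is
  -- read off from `sqInt_hessRot`.
  refine tendsto_sqInt_sub_of_tendsto (fun n => measurable_hessRot_right f i j (v n))
    (measurable_hessRot_right f i j x) (ae_of_all _ fun w => ?_) ?_ ?_
  · simp only [hessRot_apply]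
    have hc : ContinuousAt (fun p => hess (radialExt f) p (Sum.inl i) (Sum.inl j)) (rotIso w.1 x, w.2) :=
      (hf.continuousOn_hess _ _).continuousAt (isOpen_offAxis.mem_nhds (by simpa [offAxis] using hx))
    have h2 : Tendsto (fun n => ((rotIso w.1 (v n), w.2) : Amb q × ℝ)) atTop
        (𝓝 (rotIso w.1 x, w.2)) :=
      (((rotIso w.1).continuous.tendsto x).comp hv).prodMk_nhds tendsto_const_nhds
    exact hc.tendsto.comp h2
  · rw [sqInt_hessRot hf i j hx]
    exact ENNReal.mul_ne_top ENNReal.ofReal_ne_top (inv_surf_mul_sqInt_ne_top (hf.hess_sq _ _))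
  · rw [sqInt_hessRot hf i j hx]
    have h1 : Tendsto (fun n => ENNReal.ofReal (((‖v n‖ ^ 2)⁻¹) ^ 2)) atTop
        (𝓝 (ENNReal.ofReal (((‖x‖ ^ 2)⁻¹) ^ 2))) :=
      ENNReal.tendsto_ofReal (((hv.norm.pow 2).inv₀ (by simpa using hx)).pow 2)
    have h2 := ENNReal.Tendsto.mul_const h1
      (Or.inr (inv_surf_mul_sqInt_ne_top (hf.hess_sq (Sum.inl i) (Sum.inl j))))
    refine h2.congr' (hne.mono fun n hn => ?_)
    exact (sqInt_hessRot hf i j hn).symm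

theorem sum_sq_le_norm_sq_mul {ι : Type*} [Fintype ι] (w : EuclideanSpace ℝ ι) (a : ι → ℝ) :
    (∑ i, w i * a i) ^ 2 ≤ ‖w‖ ^ 2 * ∑ i, a i ^ 2 := by
  rw [EuclideanSpace.real_norm_sq_eq]
  exact Finset.sum_mul_sq_le_sq_mul_sq _ _ _

theorem sum_sum_sq_le_norm_sq_mul {ι : Type*} [Fintype ι] (w : EuclideanSpace ℝ ι) (a : ι → ι → ℝ) :
    (∑ i, ∑ j, w i * w j * a i j) ^ 2 ≤ ‖w‖ ^ 4 * ∑ i, ∑ j, a i j ^ 2 := by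
  have h1 : ∑ i, ∑ j, w i * w j * a i j = ∑ i, w i * ∑ j, w j * a i j :=
    Finset.sum_congr rfl fun i _ => by
      rw [Finset.mul_sum]; exact Finset.sum_congr rfl fun j _ => by ring
  rw [h1]
  calc (∑ i, w i * ∑ j, w j * a i j) ^ 2 ≤ ‖w‖ ^ 2 * ∑ i, (∑ j, w j * a i j) ^ 2 :=
        sum_sq_le_norm_sq_mul w _
    _ ≤ ‖w‖ ^ 2 * ∑ i, ‖w‖ ^ 2 * ∑ j, a i j ^ 2 := by
        gcongr with i; exact sum_sq_le_norm_sq_mul w _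
    _ = _ := by rw [← Finset.mul_sum]; ring

/-- Mean square bound for the Taylor remainder along a chord. -/
theorem sqInt_dirRem_le (hf : SmoothDensity f) {x y : Sph q}
    (hxy : 0 ≤ inner ℝ (x : Amb q) (y : Amb q)) {η : ℝ≥0∞}
    (hη : ∀ i j, ∀ s ∈ Set.Icc (0 : ℝ) 1, sqInt (rotCyl q)
      (fun w => hessRot f i j (chordPt x y s) w - hessRot f i j x w) ≤ η) :
    sqInt (rotCyl q) (dirRem f x y) ≤
      ENNReal.ofReal (‖(y : Amb q) - x‖ ^ 4) * (((q + 1 : ℕ) : ℝ≥0∞) ^ 2 * η) := by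
  have hpt : ∀ w : Rot q × ℝ, ENNReal.ofReal (dirRem f x y w ^ 2) ≤
      ∫⁻ s in Set.Icc (0 : ℝ) 1, ENNReal.ofReal (‖(y : Amb q) - x‖ ^ 4) * ∑ i, ∑ j,
        ENNReal.ofReal ((hessRot f i j (chordPt x y s) w - hessRot f i j x w) ^ 2) := by
    rintro ⟨R, z⟩
    have hne : ∀ s ∈ Set.Icc (0 : ℝ) 1, rotIso R (x : Amb q) + s • rotIso R ((y : Amb q) - x) ≠ 0 := by
      intro s hs
      rw [← rotIso_chordPt]
      simpa using chordPt_ne_zero hxy hs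
    have hcont : ContinuousOn (fun s : ℝ => ∑ i, ∑ j, rotIso R ((y : Amb q) - x) i *
        rotIso R ((y : Amb q) - x) j *
        hess (radialExt f) (rotIso R (x : Amb q) + s • rotIso R ((y : Amb q) - x), z)
          (Sum.inl i) (Sum.inl j)) (Set.Icc 0 1) := by
      refine continuousOn_finsetSum _ fun i _ => continuousOn_finsetSum _ fun j _ =>
        continuousOn_const.mul ?_
      exact (hf.continuousOn_hess (Sum.inl i) (Sum.inl j)).comp
        (by fun_prop : Continuous fun s : ℝ =>
          ((rotIso R (x : Amb q) + s • rotIso R ((y : Amb q) - x), z) : Amb q × ℝ)).continuousOn hne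
    have h := ofReal_sq_taylor_le (fun s hs => hf.hasDerivAt_chord (z := z) (hne s hs))
      (fun s hs => hf.hasDerivAt_grad_chord (z := z) (hne s hs)) hcont
    have e1 : radialExt f (rotIso R (x : Amb q) + (1 : ℝ) • rotIso R ((y : Amb q) - x), z) =
        f (rotAct R y, z) := by
      rw [← radialExt_emb f (rotAct R y, z)]
      simp [emb, coe_rotAct]
    have e0 : radialExt f (rotIso R (x : Amb q) + (0 : ℝ) • rotIso R ((y : Amb q) - x), z) =
        f (rotAct R x, z) := by
      rw [← radialExt_emb f (rotAct R x, z)]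
      simp [emb, coe_rotAct]
    rw [e1, e0] at h
    simp only [zero_smul, add_zero] at h
    have hemb : emb (rotAct R x, z) = (rotIso R (x : Amb q), z) := rfl
    simp only [dirRem, hemb]
    refine le_trans h (setLIntegral_mono' measurableSet_Icc fun s hs => ?_)
    simp only [← Finset.sum_sub_distrib, ← mul_sub]
    -- The quadratic form is bounded by the sum of the squared entries, and a rotation preserves the
    -- length of the chord.
    have hsq := sum_sum_sq_le_norm_sq_mul (rotIso R ((y : Amb q) - x)) fun i j =>
      hessRot f i j (chordPt x y s) (R, z) - hessRot f i j x (R, z)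
    rw [LinearIsometryEquiv.norm_map] at hsq
    simp only [hessRot_apply, rotIso_chordPt] at hsq ⊢
    refine (ENNReal.ofReal_le_ofReal hsq).trans ?_
    rw [ENNReal.ofReal_mul (by positivity), ENNReal.ofReal_sum_of_nonneg fun i _ =>
      Finset.sum_nonneg fun j _ => sq_nonneg _]
    simp only [ENNReal.ofReal_sum_of_nonneg fun i _ => sq_nonneg _, le_refl]
  have hm : ∀ i j, Measurable fun p : (Rot q × ℝ) × ℝ => ENNReal.ofReal
      ((hessRot f i j (chordPt x y p.2) p.1 - hessRot f i j x p.1) ^ 2) := by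
    intro i j
    have h1 : Measurable fun p : (Rot q × ℝ) × ℝ => hessRot f i j (chordPt x y p.2) p.1 :=
      (measurable_hessRot f i j).comp
        (((continuous_chordPt (x : Amb q) y).measurable.comp measurable_snd).prodMk measurable_fst)
    have h2 : Measurable fun p : (Rot q × ℝ) × ℝ => hessRot f i j x p.1 :=
      (measurable_hessRot_right f i j x).comp measurable_fst
    fun_prop
  calc sqInt (rotCyl q) (dirRem f x y)
      ≤ ∫⁻ w, (∫⁻ s in Set.Icc (0 : ℝ) 1, ENNReal.ofReal (‖(y : Amb q) - x‖ ^ 4) * ∑ i, ∑ j,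
        ENNReal.ofReal ((hessRot f i j (chordPt x y s) w - hessRot f i j x w) ^ 2)) ∂(rotCyl q) :=
        lintegral_mono hpt
    -- After Tonelli the chord parameter `s` is fixed, so that `hη` applies to a single point of the
    -- chord at a time.
    _ = ∫⁻ s in Set.Icc (0 : ℝ) 1, ∫⁻ w, ENNReal.ofReal (‖(y : Amb q) - x‖ ^ 4) * ∑ i, ∑ j,
        ENNReal.ofReal ((hessRot f i j (chordPt x y s) w - hessRot f i j x w) ^ 2) ∂(rotCyl q) := by
        rw [lintegral_lintegral_swap]
        exact (Measurable.const_mul (Finset.measurable_fun_sum _ fun i _ =>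
          Finset.measurable_fun_sum _ fun j _ => hm i j) _).aemeasurable
    _ ≤ ∫⁻ s in Set.Icc (0 : ℝ) 1,
        ENNReal.ofReal (‖(y : Amb q) - x‖ ^ 4) * (((q + 1 : ℕ) : ℝ≥0∞) ^ 2 * η) := by
        apply setLIntegral_mono' measurableSet_Icc
        intro s hs
        have hms : ∀ i j, Measurable fun w : Rot q × ℝ => ENNReal.ofReal
            ((hessRot f i j (chordPt x y s) w - hessRot f i j x w) ^ 2) := fun i j =>
          (((measurable_hessRot_right f i j _).sub
            (measurable_hessRot_right f i j x)).pow_const 2).ennreal_ofReal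
        rw [lintegral_const_mul' _ _ ENNReal.ofReal_ne_top, lintegral_finsetSum _ fun i _ =>
          Finset.measurable_fun_sum _ fun j _ => hms i j]
        gcongr
        calc ∑ i, ∫⁻ w, (∑ j, ENNReal.ofReal
              ((hessRot f i j (chordPt x y s) w - hessRot f i j x w) ^ 2)) ∂(rotCyl q)
            = ∑ i, ∑ j, sqInt (rotCyl q)
              (fun w => hessRot f i j (chordPt x y s) w - hessRot f i j x w) := by
              refine Finset.sum_congr rfl fun i _ => ?_
              rw [lintegral_finsetSum _ fun j _ => hms i j]
              rfl
          _ ≤ ∑ _i : Fin (q + 1), ∑ _j : Fin (q + 1), η :=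
              Finset.sum_le_sum fun i _ => Finset.sum_le_sum fun j _ => hη i j s hs
          _ = _ := by simp; ring
    _ = _ := by simp

/-- Mean square bound for the increment along a chord. -/
theorem sqInt_rotAct_sub_le (hf : SmoothDensity f) {x y : Sph q}
    (hxy : 0 ≤ inner ℝ (x : Amb q) (y : Amb q)) {η : ℝ≥0∞}
    (hη : ∀ i, ∀ s ∈ Set.Icc (0 : ℝ) 1, sqInt (rotCyl q) (gradRot f i (chordPt x y s)) ≤ η) :
    sqInt (rotCyl q) (fun w => f (rotAct w.1 y, w.2) - f (rotAct w.1 x, w.2)) ≤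
      ENNReal.ofReal (‖(y : Amb q) - x‖ ^ 2) * (((q + 1 : ℕ) : ℝ≥0∞) * η) := by
  have hpt : ∀ w : Rot q × ℝ, ENNReal.ofReal ((f (rotAct w.1 y, w.2) - f (rotAct w.1 x, w.2)) ^ 2) ≤
      ∫⁻ s in Set.Icc (0 : ℝ) 1, ENNReal.ofReal (‖(y : Amb q) - x‖ ^ 2) * ∑ i,
        ENNReal.ofReal (gradRot f i (chordPt x y s) w ^ 2) := by
    rintro ⟨R, z⟩
    have hne : ∀ s ∈ Set.Icc (0 : ℝ) 1, rotIso R (x : Amb q) + s • rotIso R ((y : Amb q) - x) ≠ 0 := by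
      intro s hs
      rw [← rotIso_chordPt]
      simpa using chordPt_ne_zero hxy hs
    have hcont : ContinuousOn (fun s : ℝ => ∑ i, rotIso R ((y : Amb q) - x) i *
        grad (radialExt f) (rotIso R (x : Amb q) + s • rotIso R ((y : Amb q) - x), z)
          (Sum.inl i)) (Set.Icc 0 1) := by
      refine continuousOn_finsetSum _ fun i _ => continuousOn_const.mul ?_
      exact (hf.continuousOn_grad (Sum.inl i)).comp
        (by fun_prop : Continuous fun s : ℝ =>
          ((rotIso R (x : Amb q) + s • rotIso R ((y : Amb q) - x), z) : Amb q × ℝ)).continuousOn hne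
    have h := ofReal_sq_sub_le (fun s hs => hf.hasDerivAt_chord (z := z) (hne s hs)) hcont
    have e1 : radialExt f (rotIso R (x : Amb q) + (1 : ℝ) • rotIso R ((y : Amb q) - x), z) =
        f (rotAct R y, z) := by
      rw [← radialExt_emb f (rotAct R y, z)]
      simp [emb, coe_rotAct]
    have e0 : radialExt f (rotIso R (x : Amb q) + (0 : ℝ) • rotIso R ((y : Amb q) - x), z) =
        f (rotAct R x, z) := by
      rw [← radialExt_emb f (rotAct R x, z)]
      simp [emb, coe_rotAct]
    rw [e1, e0] at h
    dsimp only
    refine le_trans h (setLIntegral_mono' measurableSet_Icc fun s hs => ?_)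
    have hsq := sum_sq_le_norm_sq_mul (rotIso R ((y : Amb q) - x)) fun i =>
      gradRot f i (chordPt x y s) (R, z)
    rw [LinearIsometryEquiv.norm_map] at hsq
    simp only [gradRot_apply, rotIso_chordPt] at hsq ⊢
    refine (ENNReal.ofReal_le_ofReal hsq).trans ?_
    rw [ENNReal.ofReal_mul (by positivity), ENNReal.ofReal_sum_of_nonneg fun i _ => sq_nonneg _]
  have hm : ∀ i, Measurable fun p : (Rot q × ℝ) × ℝ => ENNReal.ofReal
      (gradRot f i (chordPt x y p.2) p.1 ^ 2) := by
    intro i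
    have h1 : Measurable fun p : (Rot q × ℝ) × ℝ => gradRot f i (chordPt x y p.2) p.1 :=
      (measurable_gradRot f i).comp
        (((continuous_chordPt (x : Amb q) y).measurable.comp measurable_snd).prodMk measurable_fst)
    fun_prop
  calc _ ≤ ∫⁻ w, (∫⁻ s in Set.Icc (0 : ℝ) 1, ENNReal.ofReal (‖(y : Amb q) - x‖ ^ 2) * ∑ i,
        ENNReal.ofReal (gradRot f i (chordPt x y s) w ^ 2)) ∂(rotCyl q) := lintegral_mono hpt
    _ = ∫⁻ s in Set.Icc (0 : ℝ) 1, ∫⁻ w, ENNReal.ofReal (‖(y : Amb q) - x‖ ^ 2) * ∑ i,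
        ENNReal.ofReal (gradRot f i (chordPt x y s) w ^ 2) ∂(rotCyl q) := by
        rw [lintegral_lintegral_swap]
        exact (Measurable.const_mul (Finset.measurable_fun_sum _ fun i _ => hm i) _).aemeasurable
    _ ≤ ∫⁻ s in Set.Icc (0 : ℝ) 1,
        ENNReal.ofReal (‖(y : Amb q) - x‖ ^ 2) * (((q + 1 : ℕ) : ℝ≥0∞) * η) := by
        apply setLIntegral_mono' measurableSet_Icc
        intro s hs
        have hms : ∀ i, Measurable fun w : Rot q × ℝ => ENNReal.ofReal
            (gradRot f i (chordPt x y s) w ^ 2) := fun i =>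
          ((measurable_gradRot_right f i _).pow_const 2).ennreal_ofReal
        rw [lintegral_const_mul' _ _ ENNReal.ofReal_ne_top, lintegral_finsetSum _ fun i _ => hms i]
        gcongr
        calc ∑ i, ∫⁻ w, ENNReal.ofReal (gradRot f i (chordPt x y s) w ^ 2) ∂(rotCyl q)
            ≤ ∑ _i : Fin (q + 1), η := Finset.sum_le_sum fun i _ => hη i s hs
          _ = _ := by simp
    _ = _ := by simp

end Chords

end DirLin

namespace DirLin
open scoped ENNReal Real

/-! ### The directional remainder: a global bound and smallness near the pole. -/

section Remainder

variable {q : ℕ} {f : Sph q × ℝ → ℝ}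

theorem inner_pole (y : Sph q) : inner ℝ (pole q : Amb q) (y : Amb q) = (y : Amb q) 0 := by
  simp [pole, EuclideanSpace.inner_single_left]

theorem norm_sub_sq_sph (x y : Sph q) :
    ‖(y : Amb q) - x‖ ^ 2 = 2 * (1 - inner ℝ (x : Amb q) (y : Amb q)) := by
  rw [norm_sub_sq_real, real_inner_comm]
  simp; ring

theorem norm_sub_sph_le (x y : Sph q) : ‖(y : Amb q) - x‖ ≤ 2 := by
  calc ‖(y : Amb q) - x‖ ≤ ‖(y : Amb q)‖ + ‖(x : Amb q)‖ := norm_sub_le _ _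
    _ = 2 := by simp; norm_num

theorem dirRem_eq (f : Sph q × ℝ → ℝ) (x y : Sph q) (w : Rot q × ℝ) :
    dirRem f x y w = f (rotAct w.1 y, w.2) - f (rotAct w.1 x, w.2) -
      (∑ i, rotIso w.1 ((y : Amb q) - (x : Amb q)) i * gradRot f i x w) -
      (∑ i, ∑ j, rotIso w.1 ((y : Amb q) - (x : Amb q)) i * rotIso w.1 ((y : Amb q) - (x : Amb q)) j *
        hessRot f i j x w) / 2 := by
  simp only [gradRot_apply, hessRot_apply]
  rfl

theorem measurable_dirRem (hf : SmoothDensity f) (x : Sph q) :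
    Measurable (Function.uncurry (dirRem f x)) := by
  have h1 : Measurable fun p : Sph q × (Rot q × ℝ) => f (rotAct p.2.1 p.1, p.2.2) :=
    hf.continuous.measurable.comp ((continuous_rotAct.comp (by fun_prop :
      Continuous fun p : Sph q × (Rot q × ℝ) => (p.2.1, p.1))).measurable.prodMk (by fun_prop))
  have h2 : Measurable fun p : Sph q × (Rot q × ℝ) => f (rotAct p.2.1 x, p.2.2) :=
    hf.continuous.measurable.comp ((continuous_rotAct.comp (by fun_prop :
      Continuous fun p : Sph q × (Rot q × ℝ) => (p.2.1, x))).measurable.prodMk (by fun_prop))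
  have h3 : ∀ i, Measurable fun p : Sph q × (Rot q × ℝ) => rotIso p.2.1 ((p.1 : Amb q) - x) i :=
    fun i => ((by fun_prop : Continuous fun v : Amb q => v i).comp (continuous_rotIso.comp
      (by fun_prop : Continuous fun p : Sph q × (Rot q × ℝ) => (p.2.1, (p.1 : Amb q) - x)))).measurable
  have h4 : ∀ i, Measurable fun p : Sph q × (Rot q × ℝ) => gradRot f i x p.2 := fun i =>
    (measurable_gradRot_right f i x).comp measurable_snd
  have h5 : ∀ i j, Measurable fun p : Sph q × (Rot q × ℝ) => hessRot f i j x p.2 := fun i j =>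
    (measurable_hessRot_right f i j x).comp measurable_snd
  have e : Function.uncurry (dirRem f x) = fun p : Sph q × (Rot q × ℝ) =>
      f (rotAct p.2.1 p.1, p.2.2) - f (rotAct p.2.1 x, p.2.2) -
      (∑ i, rotIso p.2.1 ((p.1 : Amb q) - x) i * gradRot f i x p.2) -
      (∑ i, ∑ j, rotIso p.2.1 ((p.1 : Amb q) - x) i * rotIso p.2.1 ((p.1 : Amb q) - x) j *
        hessRot f i j x p.2) / 2 := by
    ext ⟨y, w⟩; exact dirRem_eq f x y w
  rw [e]
  exact ((h1.sub h2).sub (Finset.measurable_fun_sum _ fun i _ => (h3 i).mul (h4 i))).sub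
    ((Finset.measurable_fun_sum _ fun i _ => Finset.measurable_fun_sum _ fun j _ =>
      ((h3 i).mul (h3 j)).mul (h5 i j)).div_const 2)

/-- A common bound for the mean squares of the Hessian entries. -/
noncomputable def hessBound (f : Sph q × ℝ → ℝ) : ℝ≥0∞ := ∑ i, ∑ j, (surf q Set.univ)⁻¹ *
  sqInt (cyl q) (fun p => hess (radialExt f) (emb p) (Sum.inl i) (Sum.inl j))

/-- A common bound for the mean squares of the gradient entries. -/
noncomputable def gradBound (f : Sph q × ℝ → ℝ) : ℝ≥0∞ := ∑ i, (surf q Set.univ)⁻¹ *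
  sqInt (cyl q) (fun p => grad (radialExt f) (emb p) (Sum.inl i))

theorem hessBound_ne_top (hf : SmoothDensity f) : hessBound f ≠ ⊤ :=
  ENNReal.sum_ne_top.2 fun _ _ => ENNReal.sum_ne_top.2 fun _ _ =>
    inv_surf_mul_sqInt_ne_top (hf.hess_sq _ _)

theorem gradBound_ne_top (hf : SmoothDensity f) : gradBound f ≠ ⊤ :=
  ENNReal.sum_ne_top.2 fun _ _ => inv_surf_mul_sqInt_ne_top (hf.grad_sq _)

theorem sqInt_hessRot_le (hf : SmoothDensity f) (i j : Fin (q + 1)) {v : Amb q}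
    (hv : 1 / 2 ≤ ‖v‖ ^ 2) : sqInt (rotCyl q) (hessRot f i j v) ≤ 4 * hessBound f := by
  have hv0 : v ≠ 0 := by rintro rfl; norm_num at hv
  rw [sqInt_hessRot hf i j hv0]
  gcongr
  · rw [← ENNReal.ofReal_ofNat 4]
    apply ENNReal.ofReal_le_ofReal
    have : (‖v‖ ^ 2)⁻¹ ≤ 2 := by
      rw [inv_le_comm₀ (by positivity) two_pos]; linarith
    nlinarith [inv_nonneg.2 (sq_nonneg ‖v‖)]
  · exact (Finset.single_le_sum (f := fun j => (surf q Set.univ)⁻¹ * sqInt (cyl q)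
      (fun p => hess (radialExt f) (emb p) (Sum.inl i) (Sum.inl j))) (fun _ _ => zero_le)
      (Finset.mem_univ j)).trans (Finset.single_le_sum (f := fun i => ∑ j, (surf q Set.univ)⁻¹ *
      sqInt (cyl q) (fun p => hess (radialExt f) (emb p) (Sum.inl i) (Sum.inl j)))
      (fun _ _ => zero_le) (Finset.mem_univ i))

theorem sqInt_gradRot_le (hf : SmoothDensity f) (i : Fin (q + 1)) {v : Amb q}
    (hv : 1 / 2 ≤ ‖v‖ ^ 2) : sqInt (rotCyl q) (gradRot f i v) ≤ 2 * gradBound f := by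
  have hv0 : v ≠ 0 := by rintro rfl; norm_num at hv
  rw [sqInt_gradRot hf i hv0]
  gcongr
  · refine le_of_le_of_eq (ENNReal.ofReal_le_ofReal (q := 2) ?_) (by simp)
    rw [inv_pow, inv_le_comm₀ (by positivity) two_pos]; linarith
  · exact Finset.single_le_sum (f := fun i => (surf q Set.univ)⁻¹ * sqInt (cyl q)
      (fun p => grad (radialExt f) (emb p) (Sum.inl i))) (fun _ _ => zero_le) (Finset.mem_univ i)

theorem half_le_norm_sq_sph (x : Sph q) : 1 / 2 ≤ ‖(x : Amb q)‖ ^ 2 := by simp; norm_num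

theorem sqInt_dirRem_le_of_inner_nonneg (hf : SmoothDensity f) {x y : Sph q}
    (hxy : 0 ≤ inner ℝ (x : Amb q) (y : Amb q)) :
    sqInt (rotCyl q) (dirRem f x y) ≤
      ENNReal.ofReal (‖(y : Amb q) - x‖ ^ 4) * (((q + 1 : ℕ) : ℝ≥0∞) ^ 2 * (16 * hessBound f)) := by
  refine sqInt_dirRem_le hf hxy fun i j s hs => ?_
  have h1 := sqInt_add_le (rotCyl q) (φ := hessRot f i j (chordPt x y s))
    (ψ := fun w => -hessRot f i j x w) (measurable_hessRot_right f i j _).aemeasurable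
  rw [sqInt_neg] at h1
  simp only [← sub_eq_add_neg] at h1
  refine h1.trans ?_
  calc _ ≤ 2 * (4 * hessBound f) + 2 * (4 * hessBound f) := by
        gcongr
        · exact sqInt_hessRot_le hf i j (half_le_norm_chordPt_sq hxy hs)
        · exact sqInt_hessRot_le hf i j (half_le_norm_sq_sph x)
    _ = _ := by ring

theorem sqInt_rotAct_sub_le_of_inner_nonneg (hf : SmoothDensity f) {x y : Sph q}
    (hxy : 0 ≤ inner ℝ (x : Amb q) (y : Amb q)) :
    sqInt (rotCyl q) (fun w => f (rotAct w.1 y, w.2) - f (rotAct w.1 x, w.2)) ≤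
      4 * (((q + 1 : ℕ) : ℝ≥0∞) * (2 * gradBound f)) := by
  refine (sqInt_rotAct_sub_le hf hxy fun i s hs =>
    sqInt_gradRot_le hf i (half_le_norm_chordPt_sq hxy hs)).trans ?_
  gcongr
  rw [← ENNReal.ofReal_ofNat 4]
  apply ENNReal.ofReal_le_ofReal
  have := norm_sub_sph_le x y
  nlinarith [norm_nonneg ((y : Amb q) - x)]

theorem sqInt_lin_le (x y : Sph q) :
    sqInt (rotCyl q) (fun w => ∑ i, rotIso w.1 ((y : Amb q) - (x : Amb q)) i * gradRot f i x w) ≤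
      4 * ∑ i, sqInt (rotCyl q) (gradRot f i x) := by
  unfold sqInt
  rw [← lintegral_finsetSum _ fun i _ => ((measurable_gradRot_right f i x).pow_const 2).ennreal_ofReal,
    ← lintegral_const_mul' _ _ (by simp)]
  refine lintegral_mono fun w => ?_
  have h := sum_sq_le_norm_sq_mul (rotIso w.1 ((y : Amb q) - (x : Amb q))) fun i => gradRot f i x w
  rw [LinearIsometryEquiv.norm_map] at h
  rw [← ENNReal.ofReal_sum_of_nonneg fun i _ => sq_nonneg _, ← ENNReal.ofReal_ofNat 4,
    ← ENNReal.ofReal_mul (by norm_num)]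
  refine ENNReal.ofReal_le_ofReal (h.trans ?_)
  gcongr
  have := norm_sub_sph_le x y
  nlinarith [norm_nonneg ((y : Amb q) - x)]

theorem sqInt_quad_le (x y : Sph q) :
    sqInt (rotCyl q) (fun w => ∑ i, ∑ j, rotIso w.1 ((y : Amb q) - (x : Amb q)) i *
      rotIso w.1 ((y : Amb q) - (x : Amb q)) j * hessRot f i j x w) ≤
      16 * ∑ i, ∑ j, sqInt (rotCyl q) (hessRot f i j x) := by
  unfold sqInt
  have hm : ∀ i j, Measurable fun w => ENNReal.ofReal (hessRot f i j x w ^ 2) := fun i j =>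
    ((measurable_hessRot_right f i j x).pow_const 2).ennreal_ofReal
  simp only [← lintegral_finsetSum Finset.univ fun j _ => hm _ j]
  rw [← lintegral_finsetSum _ fun i _ => Finset.measurable_fun_sum _ fun j _ => hm i j,
    ← lintegral_const_mul' _ _ (by simp)]
  refine lintegral_mono fun w => ?_
  have h := sum_sum_sq_le_norm_sq_mul (rotIso w.1 ((y : Amb q) - (x : Amb q))) fun i j => hessRot f i j x w
  rw [LinearIsometryEquiv.norm_map] at h
  simp only [← ENNReal.ofReal_sum_of_nonneg fun i _ => sq_nonneg _]
  rw [← ENNReal.ofReal_sum_of_nonneg fun i _ => Finset.sum_nonneg fun j _ => sq_nonneg _,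
    ← ENNReal.ofReal_ofNat 16, ← ENNReal.ofReal_mul (by norm_num)]
  refine ENNReal.ofReal_le_ofReal (h.trans ?_)
  gcongr
  calc ‖(y : Amb q) - x‖ ^ 4 ≤ 2 ^ 4 := by gcongr; exact norm_sub_sph_le x y
    _ = 16 := by norm_num

theorem sqInt_add_four_le {X : Type*} [MeasurableSpace X] (μ : Measure X) {a b c : X → ℝ}
    (ha : AEMeasurable a μ) (hb : AEMeasurable b μ) (hc : AEMeasurable c μ) (d : X → ℝ) :
    sqInt μ (fun x => a x + b x + c x + d x) ≤
      2 * (2 * (2 * sqInt μ a + 2 * sqInt μ b) + 2 * sqInt μ c) + 2 * sqInt μ d := by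
  refine (sqInt_add_le μ (φ := fun x => a x + b x + c x) ((ha.add hb).add hc)).trans ?_
  gcongr
  refine (sqInt_add_le μ (φ := fun x => a x + b x) (ha.add hb)).trans ?_
  gcongr
  exact sqInt_add_le μ ha

/-- Meant for `y` in the opposite hemisphere, where the chord from `x` may approach the origin. The
increment of `f` is split at `m` into two increments along safe chords; only increments of `f` are
used, as `f` itself is not assumed square integrable. The Taylor terms at `x` are bounded directly.
-/
theorem sqInt_dirRem_le_const (hf : SmoothDensity f) {x y m : Sph q}
    (hxm : 0 ≤ inner ℝ (x : Amb q) (m : Amb q)) (hmy : 0 ≤ inner ℝ (m : Amb q) (y : Amb q)) :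
    sqInt (rotCyl q) (dirRem f x y) ≤
      2 * (2 * (2 * (4 * (((q + 1 : ℕ) : ℝ≥0∞) * (2 * gradBound f))) +
        2 * (4 * (((q + 1 : ℕ) : ℝ≥0∞) * (2 * gradBound f)))) +
        2 * (4 * ∑ i, sqInt (rotCyl q) (gradRot f i x))) +
      2 * (16 * ∑ i, ∑ j, sqInt (rotCyl q) (hessRot f i j x)) := by
  have hmf : ∀ y : Sph q, Measurable fun w : Rot q × ℝ => f (rotAct w.1 y, w.2) := fun y =>
    hf.continuous.measurable.comp ((continuous_rotAct.comp (by fun_prop :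
      Continuous fun p : Rot q × ℝ => (p.1, y))).measurable.prodMk (by fun_prop))
  have hw : ∀ i, Measurable fun w : Rot q × ℝ => rotIso w.1 ((y : Amb q) - (x : Amb q)) i :=
    fun i => ((by fun_prop : Continuous fun v : Amb q => v i).comp (continuous_rotIso.comp
      (by fun_prop : Continuous fun p : Rot q × ℝ => (p.1, (y : Amb q) - (x : Amb q))))).measurable
  have hlin : Measurable fun w => ∑ i, rotIso w.1 ((y : Amb q) - (x : Amb q)) i * gradRot f i x w :=
    Finset.measurable_fun_sum _ fun i _ => (hw i).mul (measurable_gradRot_right f i x)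
  have e : dirRem f x y = fun w => (((f (rotAct w.1 y, w.2) - f (rotAct w.1 m, w.2)) +
      (f (rotAct w.1 m, w.2) - f (rotAct w.1 x, w.2))) +
      -(∑ i, rotIso w.1 ((y : Amb q) - (x : Amb q)) i * gradRot f i x w)) +
      (-(1 / 2)) * (∑ i, ∑ j, rotIso w.1 ((y : Amb q) - (x : Amb q)) i * rotIso w.1 ((y : Amb q) - (x : Amb q)) j *
        hessRot f i j x w) := by
    ext w; rw [dirRem_eq]; ring
  rw [e]
  have h := sqInt_add_four_le (rotCyl q) ((hmf y).sub (hmf m)).aemeasurable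
    ((hmf m).sub (hmf x)).aemeasurable hlin.neg.aemeasurable
    (fun w => (-(1 / 2)) * (∑ i, ∑ j, rotIso w.1 ((y : Amb q) - (x : Amb q)) i *
      rotIso w.1 ((y : Amb q) - (x : Amb q)) j * hessRot f i j x w))
  refine le_trans h ?_
  gcongr
  · exact sqInt_rotAct_sub_le_of_inner_nonneg hf hmy
  · exact sqInt_rotAct_sub_le_of_inner_nonneg hf hxm
  · exact le_of_eq_of_le (sqInt_neg _ _) (sqInt_lin_le x y)
  · rw [sqInt_const_mul]
    refine le_trans ?_ (sqInt_quad_le x y)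
    refine mul_le_of_le_one_left' ?_
    rw [← ENNReal.ofReal_one]
    exact ENNReal.ofReal_le_ofReal (by norm_num)

/-- The point is `± e₁`, orthogonal to the pole, with the sign of the coordinate `1` of `y`. A
second coordinate has to exist, hence the index `q + 1`. -/
theorem exists_sph_between (y : Sph (q + 1)) : ∃ m : Sph (q + 1),
    0 ≤ inner ℝ (pole (q + 1) : Amb (q + 1)) (m : Amb (q + 1)) ∧
      0 ≤ inner ℝ (m : Amb (q + 1)) (y : Amb (q + 1)) := by
  rcases le_total 0 ((y : Amb (q + 1)) 1) with h | h
  · refine ⟨⟨EuclideanSpace.single 1 1, by simp⟩, ?_, ?_⟩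
    · simp [pole, EuclideanSpace.inner_single_left]
    · simpa [EuclideanSpace.inner_single_left] using h
  · refine ⟨⟨EuclideanSpace.single 1 (-1), by simp⟩, ?_, ?_⟩
    · simp [pole, EuclideanSpace.inner_single_left]
    · simpa [EuclideanSpace.inner_single_left] using h

/-- In the hemisphere of the pole the chord estimate gives the right order, as `‖y - x‖⁴ = 4 (1 -
y₀)²`. In the other one `1 - y₀ > 1`, so a constant bound is enough. -/
theorem exists_sqInt_dirRem_le {f : Sph (q + 1) × ℝ → ℝ} (hf : SmoothDensity f) :
    ∃ C : ℝ, ∀ y, sqInt (rotCyl (q + 1)) (dirRem f (pole (q + 1)) y) ≤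
      ENNReal.ofReal (C * (1 - (y : Amb (q + 1)) 0) ^ 2) := by
  set x := pole (q + 1)
  set A : ℝ≥0∞ := 2 * (2 * (2 * (4 * (((q + 1 + 1 : ℕ) : ℝ≥0∞) * (2 * gradBound f))) +
        2 * (4 * (((q + 1 + 1 : ℕ) : ℝ≥0∞) * (2 * gradBound f)))) +
        2 * (4 * ∑ i, sqInt (rotCyl (q + 1)) (gradRot f i x))) +
      2 * (16 * ∑ i, ∑ j, sqInt (rotCyl (q + 1)) (hessRot f i j x)) with hA
  set B : ℝ≥0∞ := ((q + 1 + 1 : ℕ) : ℝ≥0∞) ^ 2 * (16 * hessBound f) with hB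
  have hgb := gradBound_ne_top hf
  have hhb := hessBound_ne_top hf
  have hg : ∀ i, sqInt (rotCyl (q + 1)) (gradRot f i x) ≠ ⊤ := fun i =>
    ne_top_of_le_ne_top (by finiteness) (sqInt_gradRot_le hf i (half_le_norm_sq_sph x))
  have hh : ∀ i j, sqInt (rotCyl (q + 1)) (hessRot f i j x) ≠ ⊤ := fun i j =>
    ne_top_of_le_ne_top (by finiteness) (sqInt_hessRot_le hf i j (half_le_norm_sq_sph x))
  have hg' : ∑ i, sqInt (rotCyl (q + 1)) (gradRot f i x) ≠ ⊤ := ENNReal.sum_ne_top.2 fun i _ => hg i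
  have hh' : ∑ i, ∑ j, sqInt (rotCyl (q + 1)) (hessRot f i j x) ≠ ⊤ :=
    ENNReal.sum_ne_top.2 fun i _ => ENNReal.sum_ne_top.2 fun j _ => hh i j
  have hAt : A ≠ ⊤ := by rw [hA]; finiteness
  have hBt : B ≠ ⊤ := by rw [hB]; finiteness
  refine ⟨A.toReal + 4 * B.toReal, fun y => ?_⟩
  have hrho := one_sub_coord_nonneg y 0
  rcases le_or_gt 0 ((y : Amb (q + 1)) 0) with hy | hy
  · have h := sqInt_dirRem_le_of_inner_nonneg hf (x := x) (y := y) (by rwa [inner_pole])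
    refine h.trans ?_
    have e : ‖(y : Amb (q + 1)) - x‖ ^ 4 = 4 * (1 - (y : Amb (q + 1)) 0) ^ 2 := by
      have := norm_sub_sq_sph x y
      rw [inner_pole] at this
      calc ‖(y : Amb (q + 1)) - x‖ ^ 4 = (‖(y : Amb (q + 1)) - x‖ ^ 2) ^ 2 := by ring
        _ = _ := by rw [this]; ring
    rw [e, ← hB]
    conv_lhs => rw [← ENNReal.ofReal_toReal hBt]
    rw [← ENNReal.ofReal_mul (by positivity)]
    apply ENNReal.ofReal_le_ofReal
    have : 0 ≤ A.toReal * (1 - (y : Amb (q + 1)) 0) ^ 2 := by positivity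
    linarith
  · obtain ⟨m, h1, h2⟩ := exists_sph_between y
    refine (sqInt_dirRem_le_const hf h1 h2).trans ?_
    rw [← hA]
    conv_lhs => rw [← ENNReal.ofReal_toReal hAt]
    apply ENNReal.ofReal_le_ofReal
    have h3 : 1 ≤ (1 - (y : Amb (q + 1)) 0) ^ 2 := by nlinarith
    have h4 : 0 ≤ B.toReal := ENNReal.toReal_nonneg
    have h5 : 0 ≤ A.toReal := ENNReal.toReal_nonneg
    nlinarith

theorem sqInt_dirRem_isLittleO (hf : SmoothDensity f) {ε : ℝ} (hε : 0 < ε) :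
    ∃ δ > 0, ∀ y : Sph q, 1 - (y : Amb q) 0 < δ →
      sqInt (rotCyl q) (dirRem f (pole q) y) ≤ ENNReal.ofReal (ε * (1 - (y : Amb q) 0) ^ 2) := by
  set x := pole q
  have hq : (0 : ℝ) < ((q + 1 : ℕ) : ℝ) := by positivity
  -- The factor `4` compensates `‖y - x‖⁴ = 4 (1 - y₀)²`, and `(q + 1)²` is the number of entries of
  -- the Hessian.
  set η : ℝ := ε / (4 * ((q + 1 : ℕ) : ℝ) ^ 2) with hη
  have hη0 : 0 < η := by positivity
  have hev : ∀ᶠ v in 𝓝 (x : Amb q), ∀ i j, sqInt (rotCyl q)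
      (fun w => hessRot f i j v w - hessRot f i j x w) ≤ ENNReal.ofReal η :=
    eventually_all.2 fun i => eventually_all.2 fun j =>
      ((ENNReal.tendsto_nhds_zero.1 (tendsto_sqInt_hessRot_sub hf i j (sph_ne_zero x)))
        (ENNReal.ofReal η) (ENNReal.ofReal_pos.2 hη0))
  obtain ⟨r, hr, hball⟩ := Metric.eventually_nhds_iff.1 hev
  -- The bound `1` keeps `y` in the hemisphere of the pole, and `r ^ 2 / 2` keeps the whole chord in
  -- the ball of radius `r`.
  refine ⟨min 1 (r ^ 2 / 2), by positivity, fun y hy => ?_⟩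
  have hy1 : 1 - (y : Amb q) 0 < 1 := lt_of_lt_of_le hy (min_le_left _ _)
  have hy2 : 1 - (y : Amb q) 0 < r ^ 2 / 2 := lt_of_lt_of_le hy (min_le_right _ _)
  have hn := norm_sub_sq_sph x y
  rw [inner_pole] at hn
  have hlt : ‖(y : Amb q) - x‖ < r := by
    apply lt_of_pow_lt_pow_left₀ 2 hr.le
    rw [hn]; linarith
  have h := sqInt_dirRem_le hf (x := x) (y := y) (by rw [inner_pole]; linarith)
    (η := ENNReal.ofReal η) fun i j s hs => hball (by
      rw [dist_eq_norm]
      have : chordPt (x : Amb q) y s - x = s • ((y : Amb q) - x) := by simp [chordPt]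
      rw [this, norm_smul, Real.norm_eq_abs, abs_of_nonneg hs.1]
      calc s * ‖(y : Amb q) - x‖ ≤ 1 * ‖(y : Amb q) - x‖ := by gcongr; exact hs.2
        _ < r := by rwa [one_mul]) i j
  refine h.trans ?_
  rw [← ENNReal.ofReal_natCast, ← ENNReal.ofReal_pow hq.le, ← ENNReal.ofReal_mul (by positivity),
    ← ENNReal.ofReal_mul (by positivity)]
  apply ENNReal.ofReal_le_ofReal
  apply le_of_eq
  have e : ‖(y : Amb q) - x‖ ^ 4 = 4 * (1 - (y : Amb q) 0) ^ 2 := by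
    calc ‖(y : Amb q) - x‖ ^ 4 = (‖(y : Amb q) - x‖ ^ 2) ^ 2 := by ring
      _ = _ := by rw [hn]; ring
  rw [e, hη]
  field_simp

end Remainder

end DirLin

namespace DirLin
open scoped ENNReal Real

/-! ### First and second moments of the normalized zonal weight. -/

section Zonal

variable {q : ℕ} {L : ℝ → ℝ} {h : ℝ}

theorem integral_surf_rotSph (T : Amb q ≃ₗᵢ[ℝ] Amb q) (φ : Sph q → ℝ) :
    ∫ y, φ (rotSph T y) ∂(surf q) = ∫ y, φ y ∂(surf q) := by
  conv_rhs => rw [← map_rotEquiv_surf T, MeasureTheory.integral_map_equiv]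
  rfl

/-- The normalized zonal weight around the pole. -/
noncomputable def zonalW (L : ℝ → ℝ) (h : ℝ) (y : Sph q) : ℝ :=
  normConst q L h * L ((1 - (y : Amb q) 0) / h ^ 2)

/-- Directional smoothing by the normalized zonal kernel. -/
noncomputable def dirAvg (L : ℝ → ℝ) (h : ℝ) (u : Sph q × ℝ → ℝ) (p : Sph q × ℝ) : ℝ :=
  normConst q L h *
    ∫ y : Sph q, L ((1 - inner ℝ (p.1 : Amb q) (y : Amb q)) / h ^ 2) * u (y, p.2) ∂(surf q)

theorem kernelMass_pole (q : ℕ) (L : ℝ → ℝ) (h : ℝ) : kernelMass q L h (pole q) = capMoment q L h 0 := by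
  simp [kernelMass, capMoment, inner_pole]

theorem normConst_eq_inv (q : ℕ) (L : ℝ → ℝ) (h : ℝ) : normConst q L h = (capMoment q L h 0)⁻¹ := by
  rw [normConst, kernelMass_pole]

theorem IsBorelProfile.capMoment_nonneg (hL : IsBorelProfile L) (h : ℝ) (j : ℕ) :
    0 ≤ capMoment q L h j :=
  integral_nonneg fun y => mul_nonneg (hL.nonneg _) (pow_nonneg (one_sub_coord_nonneg y 0) j)

theorem IsBorelProfile.normConst_nonneg (hL : IsBorelProfile L) (q : ℕ) (h : ℝ) :
    0 ≤ normConst q L h := by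
  rw [normConst_eq_inv]; exact inv_nonneg.2 (hL.capMoment_nonneg h 0)

theorem IsBorelProfile.zonalW_nonneg (hL : IsBorelProfile L) (h : ℝ) (y : Sph q) : 0 ≤ zonalW L h y :=
  mul_nonneg (hL.normConst_nonneg q h) (hL.nonneg _)

theorem IsBorelProfile.measurable_zonalW (hL : IsBorelProfile L) (h : ℝ) :
    Measurable (zonalW L h : Sph q → ℝ) := by
  have := hL.measurable
  have := measurable_coord (q := q) 0
  unfold zonalW
  fun_prop

theorem IsBorelProfile.integrable_zonalW_mul (hL : IsBorelProfile L) (h : ℝ) {φ : Sph q → ℝ}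
    (hφ : Continuous φ) : Integrable (fun y => zonalW L h y * φ y) (surf q) := by
  obtain ⟨M, hM⟩ := hL.bounded
  have hφi : Integrable φ (surf q) := hφ.integrable_of_hasCompactSupport (HasCompactSupport.of_compactSpace φ)
  refine hφi.bdd_mul (c := normConst q L h * M) (hL.measurable_zonalW h).aestronglyMeasurable
    (ae_of_all _ fun y => ?_)
  rw [Real.norm_eq_abs, abs_of_nonneg (hL.zonalW_nonneg h y)]
  exact mul_le_mul_of_nonneg_left (hM _) (hL.normConst_nonneg q h)

theorem continuous_coord (i : Fin (q + 1)) : Continuous fun y : Sph q => (y : Amb q) i := by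
  fun_prop

theorem integral_zonalW_pow (L : ℝ → ℝ) (h : ℝ) (j : ℕ) :
    ∫ y : Sph q, zonalW L h y * (1 - (y : Amb q) 0) ^ j ∂(surf q) =
      normConst q L h * capMoment q L h j := by
  simp only [zonalW, mul_assoc]
  rw [integral_const_mul, capMoment]

/-- The rotation is moved from the kernel to the function, so that the smoothing becomes an average
with a weight independent of `R`, the form required by `sqInt_average_le`. -/
theorem dirAvg_rotAct (L : ℝ → ℝ) (h : ℝ) (u : Sph q × ℝ → ℝ) (R : Rot q) (z : ℝ) :
    dirAvg L h u (rotAct R (pole q), z) = ∫ y, zonalW L h y * u (rotAct R y, z) ∂(surf q) := by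
  rw [dirAvg, ← integral_surf_rotAct R, ← integral_const_mul]
  refine integral_congr_ae (ae_of_all _ fun y => ?_)
  simp only [coe_rotAct, LinearIsometryEquiv.inner_map_map, inner_pole, zonalW, mul_assoc]

/-- Reflection of one coordinate. -/
noncomputable def flipIso (q : ℕ) (a : Fin (q + 1)) : Amb q ≃ₗᵢ[ℝ] Amb q :=
  LinearIsometryEquiv.piLpCongrRight 2 fun i =>
    if i = a then LinearIsometryEquiv.neg ℝ else LinearIsometryEquiv.refl ℝ ℝ

theorem flipIso_apply (a : Fin (q + 1)) (v : Amb q) (i : Fin (q + 1)) :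
    flipIso q a v i = if i = a then -v i else v i := by
  simp only [flipIso, LinearIsometryEquiv.piLpCongrRight_apply]
  split_ifs <;> simp

/-- Exchange of two coordinates. -/
noncomputable def swapIso (q : ℕ) (a b : Fin (q + 1)) : Amb q ≃ₗᵢ[ℝ] Amb q :=
  LinearIsometryEquiv.piLpCongrLeft 2 ℝ ℝ (Equiv.swap a b)

theorem swapIso_apply (a b : Fin (q + 1)) (v : Amb q) (i : Fin (q + 1)) :
    swapIso q a b v i = v (Equiv.swap a b i) := by
  simp [swapIso, LinearIsometryEquiv.piLpCongrLeft_apply, Equiv.piCongrLeft'_apply]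

/-- The weight depends on the coordinate `0` alone, hence is invariant under reflections of the
other coordinates, and odd integrands average to zero. The exchange of two such coordinates is used
in the same way below. -/
theorem integral_zonalW_flip (L : ℝ → ℝ) (h : ℝ) {a : Fin (q + 1)} (ha : a ≠ 0) {φ : Sph q → ℝ}
    (hφ : ∀ y, φ (rotSph (flipIso q a) y) = -φ y) : ∫ y, zonalW L h y * φ y ∂(surf q) = 0 := by
  have h1 := integral_surf_rotSph (flipIso q a) fun y => zonalW L h y * φ y
  have h2 : ∀ y : Sph q, zonalW L h (rotSph (flipIso q a) y) = zonalW L h y := fun y => by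
    simp [zonalW, rotSph, flipIso_apply, Ne.symm ha]
  simp only [h2, hφ, mul_neg, integral_neg] at h1
  linarith

theorem integral_zonalW_coord_sq (L : ℝ → ℝ) (h : ℝ) {a b : Fin (q + 1)} (ha : a ≠ 0) (hb : b ≠ 0) :
    ∫ y : Sph q, zonalW L h y * (y : Amb q) a ^ 2 ∂(surf q) =
      ∫ y : Sph q, zonalW L h y * (y : Amb q) b ^ 2 ∂(surf q) := by
  have h1 := integral_surf_rotSph (swapIso q a b) fun y => zonalW L h y * (y : Amb q) b ^ 2
  rw [← h1]
  refine integral_congr_ae (ae_of_all _ fun y => ?_)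
  simp [zonalW, rotSph, swapIso_apply, Equiv.swap_apply_of_ne_of_ne ha.symm hb.symm]

theorem sum_coord_sq (y : Sph q) : ∑ i, (y : Amb q) i ^ 2 = 1 := by
  rw [← EuclideanSpace.real_norm_sq_eq]; simp

/-- The common value of the second moments in the directions orthogonal to the pole. -/
theorem integral_zonalW_coord_sq_eq (hL : IsBorelProfile L) (h : ℝ) (hq : q ≠ 0) {a : Fin (q + 1)}
    (ha : a ≠ 0) :
    ∫ y : Sph q, zonalW L h y * (y : Amb q) a ^ 2 ∂(surf q) = (q : ℝ)⁻¹ *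
      (2 * (normConst q L h * capMoment q L h 1) - normConst q L h * capMoment q L h 2) := by
  have hint : ∀ i : Fin (q + 1), Integrable (fun y : Sph q => zonalW L h y * (y : Amb q) i ^ 2) (surf q) :=
    fun i => hL.integrable_zonalW_mul h ((continuous_coord i).pow 2)
  -- With `t = 1 - y₀`, the squares of the other coordinates sum to `1 - y₀² = 2t - t²`.
  have h1 : ∑ i : Fin q, ∫ y : Sph q, zonalW L h y * (y : Amb q) i.succ ^ 2 ∂(surf q) =
      2 * (normConst q L h * capMoment q L h 1) - normConst q L h * capMoment q L h 2 := by
    rw [← integral_zonalW_pow, ← integral_zonalW_pow, ← integral_finsetSum _ fun i _ => hint _,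
      ← integral_const_mul, ← integral_sub]
    · refine integral_congr_ae (ae_of_all _ fun y => ?_)
      simp only
      rw [← Finset.mul_sum]
      have := sum_coord_sq y
      rw [Fin.sum_univ_succ] at this
      have e : ∑ i : Fin q, (y : Amb q) i.succ ^ 2 = 1 - (y : Amb q) 0 ^ 2 := by linarith
      rw [e]; ring
    · exact (hL.integrable_zonalW_mul h (by fun_prop)).const_mul _
    · exact hL.integrable_zonalW_mul h (by fun_prop)
  have h2 : ∀ i : Fin q, ∫ y : Sph q, zonalW L h y * (y : Amb q) i.succ ^ 2 ∂(surf q) =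
      ∫ y : Sph q, zonalW L h y * (y : Amb q) a ^ 2 ∂(surf q) := fun i =>
    integral_zonalW_coord_sq L h (Fin.succ_ne_zero i) ha
  simp only [h2, Finset.sum_const, Finset.card_univ, Fintype.card_fin, nsmul_eq_mul] at h1
  have : (q : ℝ) ≠ 0 := by exact_mod_cast hq
  rw [← h1]; field_simp

theorem pole_coord (a : Fin (q + 1)) : (pole q : Amb q) a = if a = 0 then 1 else 0 := by
  simp [pole]

theorem rotIso_pole (R : Rot q) (i : Fin (q + 1)) :
    rotIso R (pole q : Amb q) i = R.1 i 0 := by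
  simp [rotIso_apply, pole_coord]

theorem sum_rot_mul (R : Rot q) (i j : Fin (q + 1)) :
    ∑ a, R.1 i a * R.1 j a = if i = j then 1 else 0 := by
  have h := (Matrix.mem_orthogonalGroup_iff _ _).1 R.2
  have := congrFun (congrFun h i) j
  simpa [Matrix.mul_apply, Matrix.one_apply] using this

/-- By reflection symmetry only the component along the pole survives, where `y₀ - 1` is minus the
variable of the first moment; the rotation is then applied to the resulting vector. -/
theorem integral_zonalW_linear (hL : IsBorelProfile L) (h : ℝ) (R : Rot q) (i : Fin (q + 1)) :
    ∫ y : Sph q, zonalW L h y * rotIso R ((y : Amb q) - (pole q : Amb q)) i ∂(surf q) =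
      -(normConst q L h * capMoment q L h 1) * rotIso R (pole q : Amb q) i := by
  have hc : ∀ a, ∫ y : Sph q, zonalW L h y * ((y : Amb q) - (pole q : Amb q)) a ∂(surf q) =
      if a = 0 then -(normConst q L h * capMoment q L h 1) else 0 := by
    intro a
    split_ifs with ha
    · subst ha
      rw [← integral_zonalW_pow, ← integral_neg]
      refine integral_congr_ae (ae_of_all _ fun y => ?_)
      simp [pole_coord]; ring
    · refine integral_zonalW_flip L h ha fun y => ?_
      simp [rotSph, flipIso_apply, pole_coord, ha]
  have hint : ∀ a, Integrable (fun y : Sph q => R.1 i a *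
      (zonalW L h y * ((y : Amb q) - (pole q : Amb q)) a)) (surf q) :=
    fun a => (hL.integrable_zonalW_mul h (by fun_prop)).const_mul _
  calc ∫ y : Sph q, zonalW L h y * rotIso R ((y : Amb q) - (pole q : Amb q)) i ∂(surf q)
      = ∫ y : Sph q, ∑ a, R.1 i a *
          (zonalW L h y * ((y : Amb q) - (pole q : Amb q)) a) ∂(surf q) := by
        refine integral_congr_ae (ae_of_all _ fun y => ?_)
        simp only [rotIso_apply, Finset.mul_sum]
        exact Finset.sum_congr rfl fun a _ => by ring
    _ = ∑ a, R.1 i a * if a = 0 then -(normConst q L h * capMoment q L h 1) else 0 := by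
        rw [integral_finsetSum _ fun a _ => hint a]
        exact Finset.sum_congr rfl fun a _ => by rw [integral_const_mul, hc a]
    _ = _ := by simp [rotIso_pole]; ring

/-- Reflections and exchanges of coordinates force the second moment matrix about the pole `e` to be
`α (I - e eᵀ) + m2 e eᵀ`, with `α` the common moment in the `q` tangential directions. Conjugation
by `R` replaces `e` by `R e`. -/
theorem integral_zonalW_quadratic (hL : IsBorelProfile L) (h : ℝ) (hq : q ≠ 0) (R : Rot q)
    (i j : Fin (q + 1)) {m1 m2 : ℝ} (hm1 : m1 = normConst q L h * capMoment q L h 1)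
    (hm2 : m2 = normConst q L h * capMoment q L h 2) :
    ∫ y : Sph q, zonalW L h y * (rotIso R ((y : Amb q) - (pole q : Amb q)) i *
      rotIso R ((y : Amb q) - (pole q : Amb q)) j) ∂(surf q) =
      (q : ℝ)⁻¹ * (2 * m1 - m2) * (if i = j then 1 else 0) +
        (m2 - (q : ℝ)⁻¹ * (2 * m1 - m2)) * (rotIso R (pole q : Amb q) i * rotIso R (pole q : Amb q) j) := by
  set α := (q : ℝ)⁻¹ * (2 * m1 - m2) with hα
  have hc : ∀ a b, ∫ y : Sph q, zonalW L h y * (((y : Amb q) - (pole q : Amb q)) a *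
      ((y : Amb q) - (pole q : Amb q)) b) ∂(surf q) =
      α * (if a = b then 1 else 0) + (m2 - α) * ((if a = 0 then 1 else 0) * (if b = 0 then 1 else 0)) := by
    intro a b
    by_cases hab : a = b
    · subst hab
      by_cases ha : a = 0
      · subst ha
        simp only [if_true, mul_one]
        rw [hm2, ← integral_zonalW_pow, add_sub_cancel]
        refine integral_congr_ae (ae_of_all _ fun y => ?_)
        simp only [PiLp.sub_apply, pole_coord, if_true]; ring
      · simp only [if_true, mul_one, if_neg ha, mul_zero, add_zero]
        rw [hα, hm1, hm2, ← integral_zonalW_coord_sq_eq hL h hq ha]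
        refine integral_congr_ae (ae_of_all _ fun y => ?_)
        simp [pole_coord, ha, sq]
    · simp only [if_neg hab, mul_zero, zero_add]
      by_cases ha : a = 0
      · have hb : b ≠ 0 := fun hb => hab (ha.trans hb.symm)
        simp only [if_neg hb, mul_zero]
        refine integral_zonalW_flip L h hb fun y => ?_
        simp [rotSph, flipIso_apply, pole_coord, hb, hab]
      · simp only [if_neg ha, zero_mul, mul_zero]
        refine integral_zonalW_flip L h ha fun y => ?_
        simp [rotSph, flipIso_apply, pole_coord, ha, Ne.symm hab]
  have hint : ∀ a b, Integrable (fun y : Sph q => R.1 i a * R.1 j b *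
      (zonalW L h y * (((y : Amb q) - (pole q : Amb q)) a * ((y : Amb q) - (pole q : Amb q)) b)))
      (surf q) :=
    fun a b => (hL.integrable_zonalW_mul h (by fun_prop)).const_mul _
  calc _ = ∫ y : Sph q, ∑ a, ∑ b, R.1 i a * R.1 j b *
      (zonalW L h y * (((y : Amb q) - (pole q : Amb q)) a * ((y : Amb q) - (pole q : Amb q)) b))
      ∂(surf q) := by
        refine integral_congr_ae (ae_of_all _ fun y => ?_)
        simp only [rotIso_apply]
        rw [Finset.sum_mul_sum]
        simp only [Finset.mul_sum]
        exact Finset.sum_congr rfl fun a _ => Finset.sum_congr rfl fun b _ => by ring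
    _ = ∑ a, ∑ b, R.1 i a * R.1 j b *
        (α * (if a = b then 1 else 0) + (m2 - α) * ((if a = 0 then 1 else 0) * (if b = 0 then 1 else 0))) := by
        rw [integral_finsetSum _ fun a _ => integrable_finsetSum _ fun b _ => hint a b]
        refine Finset.sum_congr rfl fun a _ => ?_
        rw [integral_finsetSum _ fun b _ => hint a b]
        exact Finset.sum_congr rfl fun b _ => by rw [integral_const_mul, hc a b]
    _ = _ := by
        rw [← sum_rot_mul R i j, rotIso_pole, rotIso_pole]
        simp only [mul_add, Finset.sum_add_distrib]
        congr 1
        · simp [Finset.mul_sum, mul_comm]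
        · simp [mul_comm]

end Zonal

end DirLin

namespace DirLin
open scoped ENNReal Real

/-! ### Exact expansion of the directional smoothing. -/

section Directional

variable {q : ℕ} {L : ℝ → ℝ} {h : ℝ}

/-- The moments of the normalized zonal kernel. -/
noncomputable def normMoment (q : ℕ) (L : ℝ → ℝ) (h : ℝ) (j : ℕ) : ℝ :=
  normConst q L h * capMoment q L h j

theorem IsBorelProfile.normMoment_nonneg (hL : IsBorelProfile L) (h : ℝ) (j : ℕ) :
    0 ≤ normMoment q L h j := mul_nonneg (hL.normConst_nonneg q h) (hL.capMoment_nonneg h j)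

/-- The moments of the profile in the dimension of `Ω_(q+1)`. -/
noncomputable def profMoment (q : ℕ) (L : ℝ → ℝ) (j : ℕ) : ℝ :=
  ∫ r in Set.Ioi (0 : ℝ), L r * r ^ (((q + 1 : ℕ) : ℝ) / 2 - 1 + j)

theorem tendsto_capMoment_zero (hL : IsBorelProfile L) (q : ℕ) :
    Tendsto (fun h : ℝ => capMoment (q + 1) L h 0 / h ^ (q + 1)) (𝓝[>] 0)
      (𝓝 (capConst q * profMoment q L 0)) := by
  simpa [profMoment] using tendsto_capMoment hL q 0

theorem tendsto_normConst_mul (hL : IsBorelProfile L) (q : ℕ) (hpos : 0 < profMoment q L 0) :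
    Tendsto (fun h : ℝ => normConst (q + 1) L h * h ^ (q + 1)) (𝓝[>] 0)
      (𝓝 (capConst q * profMoment q L 0)⁻¹) := by
  refine ((tendsto_capMoment_zero hL q).inv₀ (mul_pos (capConst_pos q) hpos).ne').congr fun h => ?_
  rw [normConst_eq_inv, inv_div, div_eq_mul_inv, mul_comm]

/-- The inverse of zero being zero, the normalized weight has mass one only if the cap mass does not
vanish. For small `h` this follows from the positive limit of the rescaled mass. -/
theorem eventually_normMoment_zero (hL : IsBorelProfile L) (q : ℕ) (hpos : 0 < profMoment q L 0) :
    ∀ᶠ h in 𝓝[>] (0 : ℝ), normMoment (q + 1) L h 0 = 1 := by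
  filter_upwards [(tendsto_capMoment_zero hL q).eventually_const_lt (mul_pos (capConst_pos q) hpos)]
    with h hh
  rw [normMoment, normConst_eq_inv, inv_mul_cancel₀]
  rintro h0
  rw [h0, zero_div] at hh
  exact lt_irrefl _ hh

theorem tendsto_normMoment (hL : IsBorelProfile L) (q : ℕ) (hpos : 0 < profMoment q L 0) (j : ℕ) :
    Tendsto (fun h : ℝ => normMoment (q + 1) L h j / h ^ (2 * j)) (𝓝[>] 0)
      (𝓝 (profMoment q L j / profMoment q L 0)) := by
  have h1 := (tendsto_normConst_mul hL q hpos).mul (tendsto_capMoment hL q j)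
  have e : (capConst q * profMoment q L 0)⁻¹ * (capConst q * ∫ r in Set.Ioi (0 : ℝ),
      L r * r ^ (((q + 1 : ℕ) : ℝ) / 2 - 1 + j)) = profMoment q L j / profMoment q L 0 := by
    have := (capConst_pos q).ne'
    rw [show (∫ r in Set.Ioi (0 : ℝ), L r * r ^ (((q + 1 : ℕ) : ℝ) / 2 - 1 + j)) = profMoment q L j
      from rfl]
    field_simp
  rw [e] at h1
  refine h1.congr' ?_
  filter_upwards [self_mem_nhdsWithin] with h hh
  have hh : h ≠ 0 := (Set.mem_Ioi.1 hh).ne'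
  rw [normMoment, pow_add h (q + 1)]
  field_simp

theorem bConst_eq (q : ℕ) (L : ℝ → ℝ) :
    bConst (q + 1) L = profMoment q L 1 / profMoment q L 0 := by
  simp [bConst, profMoment]

theorem measurable_dirAvg (hL : IsBorelProfile L) (h : ℝ) {u : Sph q × ℝ → ℝ} (hu : Measurable u) :
    Measurable (dirAvg L h u) := by
  have hLm := hL.measurable
  have hm : Measurable fun p : (Sph q × ℝ) × Sph q =>
      L ((1 - inner ℝ (p.1.1 : Amb q) (p.2 : Amb q)) / h ^ 2) * u (p.2, p.1.2) := by
    have h1 : Measurable fun p : (Sph q × ℝ) × Sph q =>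
        L ((1 - inner ℝ (p.1.1 : Amb q) (p.2 : Amb q)) / h ^ 2) := by fun_prop
    exact h1.mul (hu.comp (by fun_prop))
  exact (hm.stronglyMeasurable.integral_prod_right'.measurable).const_mul _

theorem lintegral_zonalW_mul (hL : IsBorelProfile L) (h : ℝ) (j : ℕ) :
    ∫⁻ y : Sph q, ENNReal.ofReal (zonalW L h y * (1 - (y : Amb q) 0) ^ j) ∂(surf q) =
      ENNReal.ofReal (normMoment q L h j) := by
  rw [normMoment, ← integral_zonalW_pow, ofReal_integral_eq_lintegral_ofReal
    (hL.integrable_zonalW_mul h (by fun_prop)) (ae_of_all _ fun y =>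
      mul_nonneg (hL.zonalW_nonneg h y) (pow_nonneg (one_sub_coord_nonneg y 0) j))]

/-- The polar cap of points `y` with `1 - y₀ < δ`. -/
def polarCap (q : ℕ) (δ : ℝ) : Set (Sph q) := {y | 1 - (y : Amb q) 0 < δ}

theorem measurableSet_polarCap (δ : ℝ) : MeasurableSet (polarCap q δ) :=
  measurableSet_lt (by fun_prop) measurable_const

/-- Markov's inequality, with `(1 - y₀) / δ ≥ 1` outside the cap. The moment of order `j + 1` is
smaller than that of order `j` by a factor of order `h²`, so the far part is negligible. -/
theorem lintegral_zonalW_compl_cap_le (hL : IsBorelProfile L) (h : ℝ) (j : ℕ) {δ : ℝ} (hδ : 0 < δ) :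
    ∫⁻ y in (polarCap q δ)ᶜ, ENNReal.ofReal (zonalW L h y * (1 - (y : Amb q) 0) ^ j) ∂(surf q) ≤
      ENNReal.ofReal (normMoment q L h (j + 1) / δ) := by
  calc _ ≤ ∫⁻ y in (polarCap q δ)ᶜ, ENNReal.ofReal (δ⁻¹) *
        ENNReal.ofReal (zonalW L h y * (1 - (y : Amb q) 0) ^ (j + 1)) ∂(surf q) := by
        refine setLIntegral_mono' (measurableSet_polarCap δ).compl fun y hy => ?_
        have hy : δ ≤ 1 - (y : Amb q) 0 := not_lt.1 hy
        rw [← ENNReal.ofReal_mul (by positivity)]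
        apply ENNReal.ofReal_le_ofReal
        have h0 : 0 ≤ zonalW L h y * (1 - (y : Amb q) 0) ^ j :=
          mul_nonneg (hL.zonalW_nonneg h y) (pow_nonneg (one_sub_coord_nonneg y 0) j)
        rw [pow_succ, ← mul_assoc (zonalW L h y), inv_mul_eq_div, le_div_iff₀ hδ]
        exact mul_le_mul_of_nonneg_left hy h0
    _ ≤ ∫⁻ y, ENNReal.ofReal (δ⁻¹) *
        ENNReal.ofReal (zonalW L h y * (1 - (y : Amb q) 0) ^ (j + 1)) ∂(surf q) :=
        setLIntegral_le_lintegral _ _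
    _ = _ := by
        rw [lintegral_const_mul' _ _ ENNReal.ofReal_ne_top, lintegral_zonalW_mul hL,
          ← ENNReal.ofReal_mul (by positivity), div_eq_mul_inv, mul_comm]

/-- The contribution of the fourth order in the directional bias. -/
noncomputable def thetaX (f : Sph q × ℝ → ℝ) (p : Sph q × ℝ) : ℝ :=
  1 / 2 * ((∑ i, ∑ j, (p.1 : Amb q) i * hess (radialExt f) (emb p) (Sum.inl i) (Sum.inl j) *
      (p.1 : Amb q) j) - (q : ℝ)⁻¹ *
    ((∑ i, hess (radialExt f) (emb p) (Sum.inl i) (Sum.inl i)) -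
      ∑ i, ∑ j, (p.1 : Amb q) i * hess (radialExt f) (emb p) (Sum.inl i) (Sum.inl j) *
        (p.1 : Amb q) j))

/-- Taylor's formula along the chords is integrated against the zonal weight. The quadratic term
contributes to both moments: its `m1` part is `q⁻¹ (∇² f - xᵀ 𝓗 f x)`, which joins the linear term
`-xᵀ ∇f` to form `psiX`, and its `m2` part is `thetaX`. -/
theorem dirAvg_sub_eq {f : Sph q × ℝ → ℝ} (hf : SmoothDensity f) (hL : IsBorelProfile L)
    (hq : q ≠ 0) (hmass : normMoment q L h 0 = 1) (w : Rot q × ℝ) :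
    dirAvg L h f (rotAct w.1 (pole q), w.2) - f (rotAct w.1 (pole q), w.2) =
      (∫ y, zonalW L h y * dirRem f (pole q) y w ∂(surf q)) +
        (normMoment q L h 1 * psiX f (rotAct w.1 (pole q), w.2) +
          normMoment q L h 2 * thetaX f (rotAct w.1 (pole q), w.2)) := by
  obtain ⟨R, z⟩ := w
  set x := rotAct R (pole q) with hx
  set G : Fin (q + 1) → ℝ := fun i => grad (radialExt f) (emb (x, z)) (Sum.inl i) with hG
  set H : Fin (q + 1) → Fin (q + 1) → ℝ := fun i j =>
    hess (radialExt f) (emb (x, z)) (Sum.inl i) (Sum.inl j) with hH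
  set m1 := normMoment q L h 1 with hm1
  set m2 := normMoment q L h 2 with hm2
  have hrot : ∀ i, Continuous fun y : Sph q => rotIso R ((y : Amb q) - (pole q : Amb q)) i :=
    fun i => (by fun_prop : Continuous fun v : Amb q => v i).comp
      ((rotIso R).continuous.comp (by fun_prop))
  have hfc : Continuous fun y : Sph q => f (rotAct R y, z) :=
    hf.continuous.comp ((continuous_rotAct.comp (Continuous.prodMk_right R)).prodMk continuous_const)
  have i1 : Integrable (fun y => zonalW L h y * f (rotAct R y, z)) (surf q) :=
    hL.integrable_zonalW_mul h hfc
  have i2 : Integrable (fun y : Sph q => zonalW L h y * f (x, z)) (surf q) :=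
    hL.integrable_zonalW_mul h continuous_const
  have i3 : ∀ i, Integrable (fun y : Sph q => G i *
      (zonalW L h y * rotIso R ((y : Amb q) - (pole q : Amb q)) i)) (surf q) :=
    fun i => (hL.integrable_zonalW_mul h (hrot i)).const_mul _
  have i4 : ∀ i j, Integrable (fun y : Sph q => H i j / 2 *
      (zonalW L h y * (rotIso R ((y : Amb q) - (pole q : Amb q)) i *
        rotIso R ((y : Amb q) - (pole q : Amb q)) j))) (surf q) :=
    fun i j => (hL.integrable_zonalW_mul h ((hrot i).mul (hrot j))).const_mul _
  have i12 : Integrable (fun y : Sph q => zonalW L h y * f (rotAct R y, z) -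
      zonalW L h y * f (x, z)) (surf q) := i1.sub i2
  have i3s : Integrable (fun y : Sph q => ∑ i, G i *
      (zonalW L h y * rotIso R ((y : Amb q) - (pole q : Amb q)) i)) (surf q) :=
    integrable_finsetSum _ fun i _ => i3 i
  have i4s : Integrable (fun y : Sph q => ∑ i, ∑ j, H i j / 2 *
      (zonalW L h y * (rotIso R ((y : Amb q) - (pole q : Amb q)) i *
        rotIso R ((y : Amb q) - (pole q : Amb q)) j))) (surf q) :=
    integrable_finsetSum _ fun i _ => integrable_finsetSum _ fun j _ => i4 i j
  have i123 : Integrable (fun y : Sph q => zonalW L h y * f (rotAct R y, z) -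
      zonalW L h y * f (x, z) - ∑ i, G i *
      (zonalW L h y * rotIso R ((y : Amb q) - (pole q : Amb q)) i)) (surf q) := i12.sub i3s
  have e : ∫ y, zonalW L h y * dirRem f (pole q) y (R, z) ∂(surf q) =
      dirAvg L h f (x, z) - f (x, z) - (∑ i, G i * (-m1 * (x : Amb q) i)) -
      ∑ i, ∑ j, H i j / 2 * ((q : ℝ)⁻¹ * (2 * m1 - m2) * (if i = j then 1 else 0) +
        (m2 - (q : ℝ)⁻¹ * (2 * m1 - m2)) * ((x : Amb q) i * (x : Amb q) j)) := by
    have hpt : ∀ y : Sph q, zonalW L h y * dirRem f (pole q) y (R, z) =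
        zonalW L h y * f (rotAct R y, z) - zonalW L h y * f (x, z) -
        (∑ i, G i * (zonalW L h y * rotIso R ((y : Amb q) - (pole q : Amb q)) i)) -
        ∑ i, ∑ j, H i j / 2 * (zonalW L h y * (rotIso R ((y : Amb q) - (pole q : Amb q)) i *
          rotIso R ((y : Amb q) - (pole q : Amb q)) j)) := by
      intro y
      simp only [dirRem, mul_sub, hG, hH, hx, Finset.mul_sum, Finset.sum_div]
      congr 1
      · congr 1
        exact Finset.sum_congr rfl fun i _ => by ring
      · exact Finset.sum_congr rfl fun i _ => Finset.sum_congr rfl fun j _ => by ring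
    simp only [hpt]
    rw [integral_sub i123 i4s, integral_sub i12 i3s, integral_sub i1 i2,
      integral_finsetSum _ (fun i _ => i3 i),
      integral_finsetSum _ (fun i _ => integrable_finsetSum _ fun j _ => i4 i j),
      ← dirAvg_rotAct L h f R z, integral_mul_const]
    have h0 : ∫ y : Sph q, zonalW L h y ∂(surf q) = 1 := by
      have := integral_zonalW_pow (q := q) L h 0
      simp only [pow_zero, mul_one] at this
      rw [this]; exact hmass
    rw [h0, one_mul]
    congr 1
    · congr 1
      exact Finset.sum_congr rfl fun i _ => by
        rw [integral_const_mul, integral_zonalW_linear hL h R i]; rfl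
    · refine Finset.sum_congr rfl fun i _ => ?_
      rw [integral_finsetSum _ fun j _ => i4 i j]
      exact Finset.sum_congr rfl fun j _ => by
        rw [integral_const_mul, integral_zonalW_quadratic hL h hq R i j hm1 hm2]; rfl
  rw [e]
  have s1 : ∑ i, G i * (-m1 * (x : Amb q) i) = -m1 * ∑ i, (x : Amb q) i * G i := by
    rw [Finset.mul_sum]; exact Finset.sum_congr rfl fun i _ => by ring
  have s2 : ∑ i, ∑ j, H i j / 2 * ((q : ℝ)⁻¹ * (2 * m1 - m2) * (if i = j then 1 else 0) +
        (m2 - (q : ℝ)⁻¹ * (2 * m1 - m2)) * ((x : Amb q) i * (x : Amb q) j)) =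
      (q : ℝ)⁻¹ * (2 * m1 - m2) / 2 * (∑ i, H i i) + (m2 - (q : ℝ)⁻¹ * (2 * m1 - m2)) / 2 *
        ∑ i, ∑ j, (x : Amb q) i * H i j * (x : Amb q) j := by
    simp only [Finset.mul_sum]
    rw [← Finset.sum_add_distrib]
    refine Finset.sum_congr rfl fun i _ => ?_
    have : ∀ j, H i j / 2 * ((q : ℝ)⁻¹ * (2 * m1 - m2) * (if i = j then 1 else 0) +
        (m2 - (q : ℝ)⁻¹ * (2 * m1 - m2)) * ((x : Amb q) i * (x : Amb q) j)) =
        (if i = j then (q : ℝ)⁻¹ * (2 * m1 - m2) / 2 * H i j else 0) +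
        (m2 - (q : ℝ)⁻¹ * (2 * m1 - m2)) / 2 * ((x : Amb q) i * H i j * (x : Amb q) j) := by
      intro j; split_ifs <;> ring
    simp only [this, Finset.sum_add_distrib]
    simp
  rw [s1, s2]
  simp only [psiX, thetaX]
  change _ = _ + (m1 * (-(∑ i, (x : Amb q) i * G i) + (q : ℝ)⁻¹ * ((∑ i, H i i) -
      ∑ i, ∑ j, (x : Amb q) i * H i j * (x : Amb q) j)) +
    m2 * (1 / 2 * ((∑ i, ∑ j, (x : Amb q) i * H i j * (x : Amb q) j) - (q : ℝ)⁻¹ * ((∑ i, H i i) -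
      ∑ i, ∑ j, (x : Amb q) i * H i j * (x : Amb q) j))))
  ring

end Directional

end DirLin

namespace DirLin
open scoped ENNReal Real

/-! ### Directional bias and directional smoothing in `L²`. -/

section DirectionalBias

variable {q : ℕ} {L : ℝ → ℝ} {h : ℝ} {f : Sph q × ℝ → ℝ}

theorem abs_coord_le (y : Sph q) (i : Fin (q + 1)) : |(y : Amb q) i| ≤ 1 := by
  have := PiLp.norm_apply_le (y : Amb q) i
  simpa using this

theorem memLp_coord_mul {u : Sph q × ℝ → ℝ} (hu : MemLp u 2 (cyl q)) (i : Fin (q + 1)) :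
    MemLp (fun p => (p.1 : Amb q) i * u p) 2 (cyl q) := by
  refine hu.of_le ((by fun_prop : Continuous fun p : Sph q × ℝ =>
    (p.1 : Amb q) i).aestronglyMeasurable.mul hu.1) (ae_of_all _ fun p => ?_)
  rw [norm_mul]
  exact mul_le_of_le_one_left (norm_nonneg _) (abs_coord_le p.1 i)

theorem SmoothDensity.memLp_hess_trace (hf : SmoothDensity f) :
    MemLp (fun p => ∑ i, hess (radialExt f) (emb p) (Sum.inl i) (Sum.inl i)) 2 (cyl q) :=
  memLp_finsetSum _ fun _ _ => hf.hess_sq _ _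

theorem SmoothDensity.memLp_hess_radial (hf : SmoothDensity f) :
    MemLp (fun p => ∑ i, ∑ j, (p.1 : Amb q) i *
      hess (radialExt f) (emb p) (Sum.inl i) (Sum.inl j) * (p.1 : Amb q) j) 2 (cyl q) := by
  refine memLp_finsetSum _ fun i _ => memLp_finsetSum _ fun j _ => ?_
  have := memLp_coord_mul (memLp_coord_mul (hf.hess_sq (Sum.inl i) (Sum.inl j)) i) j
  simpa only [mul_comm ((_ : Amb q) j)] using this

theorem SmoothDensity.memLp_psiX (hf : SmoothDensity f) : MemLp (psiX f) 2 (cyl q) :=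
  (memLp_finsetSum _ fun i _ => memLp_coord_mul (hf.grad_sq (Sum.inl i)) i).neg.add
    ((hf.memLp_hess_trace.sub hf.memLp_hess_radial).const_mul _)

theorem SmoothDensity.memLp_thetaX (hf : SmoothDensity f) : MemLp (thetaX f) 2 (cyl q) :=
  (hf.memLp_hess_radial.sub
    ((hf.memLp_hess_trace.sub hf.memLp_hess_radial).const_mul _)).const_mul _

theorem SmoothDensity.memLp_hessZ (hf : SmoothDensity f) : MemLp (hessZ f) 2 (cyl q) := hf.hess_sq _ _

theorem SmoothDensity.continuous_hessZ (hf : SmoothDensity f) : Continuous (hessZ f) :=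
  hf.continuous_hess_emb _ _

theorem SmoothDensity.continuous_psiX (hf : SmoothDensity f) : Continuous (psiX f) := by
  have h1 := hf.continuous_grad_emb
  have h2 := hf.continuous_hess_emb
  unfold psiX
  fun_prop

theorem SmoothDensity.continuous_thetaX (hf : SmoothDensity f) : Continuous (thetaX f) := by
  have h2 := hf.continuous_hess_emb
  unfold thetaX
  fun_prop

theorem dirRem_eq_zero {x y : Sph q} (hxy : y = x) (w : Rot q × ℝ) : dirRem f x y w = 0 := by
  subst hxy
  simp [dirRem]

theorem eq_pole_of_one_sub_eq_zero {y : Sph q} (hy : 1 - (y : Amb q) 0 = 0) : y = pole q := by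
  have := norm_sub_sq_sph (pole q) y
  rw [inner_pole, hy] at this
  ext1
  rw [← sub_eq_zero, ← norm_eq_zero]
  simpa using this

theorem measurable_rotAct_pair {u : Sph q × ℝ → ℝ} (hu : Measurable u) :
    Measurable fun p : Sph q × (Rot q × ℝ) => u (rotAct p.2.1 p.1, p.2.2) :=
  hu.comp ((continuous_rotAct.comp (by fun_prop :
    Continuous fun p : Sph q × (Rot q × ℝ) => (p.2.1, p.1))).measurable.prodMk (by fun_prop))

theorem measurable_rotAct_left {u : Sph q × ℝ → ℝ} (hu : Measurable u) (x : Sph q) :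
    Measurable fun w : Rot q × ℝ => u (rotAct w.1 x, w.2) :=
  hu.comp ((continuous_rotAct.comp (by fun_prop :
    Continuous fun w : Rot q × ℝ => (w.1, x))).measurable.prodMk (by fun_prop))

/-- Averaged remainders with respect to the zonal kernel. -/
theorem sqInt_zonal_average_le (hL : IsBorelProfile L) (j : ℕ) {D : Sph q → Rot q × ℝ → ℝ}
    (hD : Measurable (Function.uncurry D))
    (h0 : ∀ (y : Sph q) w, (1 - (y : Amb q) 0) ^ j = 0 → D y w = 0) {ε C δ : ℝ} (hε : 0 ≤ ε) (hC0 : 0 ≤ C)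
    (hδ : 0 < δ)
    (hC : ∀ y, sqInt (rotCyl q) (D y) ≤ ENNReal.ofReal (C * ((1 - (y : Amb q) 0) ^ j) ^ 2))
    (hεδ : ∀ y : Sph q, 1 - (y : Amb q) 0 < δ →
      sqInt (rotCyl q) (D y) ≤ ENNReal.ofReal (ε * ((1 - (y : Amb q) 0) ^ j) ^ 2)) :
    sqInt (rotCyl q) (fun w => ∫ y, zonalW L h y * D y w ∂(surf q)) ≤
      ENNReal.ofReal (normMoment q L h j *
        (ε * normMoment q L h j + C * (normMoment q L h (j + 1) / δ))) := by
  have hm := fun j => hL.normMoment_nonneg (q := q) h j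
  refine (sqInt_average_le (rotCyl q) (surf q) (hL.measurable_zonalW h) (hL.zonalW_nonneg h)
    (ρ := fun y => (1 - (y : Amb q) 0) ^ j) (by fun_prop)
    (fun y => pow_nonneg (one_sub_coord_nonneg y 0) j) hD h0
    (measurableSet_polarCap (q := q) δ) hC hεδ).trans ?_
  rw [lintegral_zonalW_mul hL h j, ENNReal.ofReal_mul (hm j),
    ENNReal.ofReal_add (mul_nonneg hε (hm j)) (mul_nonneg hC0 (div_nonneg (hm _) hδ.le)),
    ENNReal.ofReal_mul hε, ENNReal.ofReal_mul hC0]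
  gcongr
  exact lintegral_zonalW_compl_cap_le hL h j hδ

theorem measurable_zonal_average (hL : IsBorelProfile L) {D : Sph q → Rot q × ℝ → ℝ}
    (hD : Measurable (Function.uncurry D)) :
    Measurable fun w => ∫ y, zonalW L h y * D y w ∂(surf q) := by
  have h1 : Measurable fun p : (Rot q × ℝ) × Sph q => D p.2 p.1 := hD.comp measurable_swap
  have h2 : Measurable fun p : (Rot q × ℝ) × Sph q => zonalW L h p.2 * D p.2 p.1 :=
    ((hL.measurable_zonalW h).comp measurable_snd).mul h1
  exact h2.stronglyMeasurable.integral_prod_right'.measurable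

theorem sqInt_ne_top {X : Type*} [MeasurableSpace X] {μ : Measure X} {φ : X → ℝ}
    (hφ : MemLp φ 2 μ) : sqInt μ φ ≠ ⊤ := ((memLp_two_iff_sqInt hφ.1).1 hφ).ne

/-- The directional bias of a smooth density, in mean square. -/
theorem dirAvg_sub_isLittleO {f : Sph (q + 1) × ℝ → ℝ} (hf : SmoothDensity f) (hL : IsBorelProfile L)
    (hpos : 0 < profMoment q L 0) {ε : ℝ} (hε : 0 < ε) :
    ∀ᶠ h in 𝓝[>] (0 : ℝ), sqInt (cyl (q + 1)) (fun p => dirAvg L h f p - f p -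
      h ^ 2 * bConst (q + 1) L * psiX f p) ≤ ENNReal.ofReal (ε * h ^ 4) := by
  set b := bConst (q + 1) L with hb
  set W := (surf (q + 1) Set.univ).toReal with hW
  have hW0 : 0 ≤ W := ENNReal.toReal_nonneg
  have hWe : surf (q + 1) Set.univ = ENNReal.ofReal W := (ENNReal.ofReal_toReal (measure_ne_top _ _)).symm
  set A := (sqInt (cyl (q + 1)) (psiX f)).toReal with hA
  set B := (sqInt (cyl (q + 1)) (thetaX f)).toReal with hB
  have hA0 : 0 ≤ A := ENNReal.toReal_nonneg
  have hB0 : 0 ≤ B := ENNReal.toReal_nonneg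
  have hAe := (ENNReal.ofReal_toReal (sqInt_ne_top hf.memLp_psiX)).symm
  have hBe := (ENNReal.ofReal_toReal (sqInt_ne_top hf.memLp_thetaX)).symm
  obtain ⟨C', hC'⟩ := exists_sqInt_dirRem_le hf
  set C := |C'| with hC
  set ε₁ := ε / (4 * (W * b ^ 2 + 1)) with hε₁
  have hε₁0 : 0 < ε₁ := by positivity
  obtain ⟨δ, hδ, hδ'⟩ := sqInt_dirRem_isLittleO hf hε₁0
  set m : ℕ → ℝ → ℝ := fun j h => normMoment (q + 1) L h j with hm
  set r : ℕ → ℝ := fun j => profMoment q L j / profMoment q L 0 with hr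
  have hrb : r 1 = b := (bConst_eq q L).symm
  have ht : ∀ j, Tendsto (fun h => m j h / h ^ (2 * j)) (𝓝[>] 0) (𝓝 (r j)) :=
    tendsto_normMoment hL q hpos
  have hid : Tendsto (fun h : ℝ => h) (𝓝[>] 0) (𝓝 0) := tendsto_id.mono_left nhdsWithin_le_nhds
  -- After division by `h⁴` the terms with `m 2 h` and with `m 1 h - h² b` tend to zero, so that `2
  -- W ε₁ b²` remains, which the choice of `ε₁` keeps below `ε`. The summand `1` in that choice
  -- covers `b = 0`.
  set bound : ℝ → ℝ := fun h => 2 * (W * (m 1 h * (ε₁ * m 1 h + C * (m 2 h / δ)))) +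
    2 * (2 * ((m 1 h - h ^ 2 * b) ^ 2 * A) + 2 * (m 2 h ^ 2 * B)) with hbound
  have hlim : Tendsto (fun h => bound h / h ^ 4) (𝓝[>] 0) (𝓝 (2 * (W * (b * (ε₁ * b))))) := by
    have h1 := ht 1
    have h2 := ht 2
    rw [hrb] at h1
    have t := (((h1.mul ((h1.const_mul ε₁).add (((h2.mul (hid.pow 2)).div_const δ).const_mul C))).const_mul
      W).const_mul 2).add (((((h1.sub_const b).pow 2).mul_const A).const_mul 2).add
      (((h2.mul (hid.pow 2)).pow 2).mul_const B |>.const_mul 2) |>.const_mul 2)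
    have e : 2 * (W * (b * (ε₁ * b + C * (r 2 * 0 ^ 2 / δ)))) +
        2 * (2 * ((b - b) ^ 2 * A) + 2 * ((r 2 * 0 ^ 2) ^ 2 * B)) = 2 * (W * (b * (ε₁ * b))) := by
      ring
    rw [e] at t
    refine t.congr' ?_
    filter_upwards [self_mem_nhdsWithin] with h hh
    have hh : h ≠ 0 := (Set.mem_Ioi.1 hh).ne'
    simp only [hbound]
    field_simp
    ring
  have hlt : 2 * (W * (b * (ε₁ * b))) < ε := by
    have : 2 * (W * (b * (ε₁ * b))) = ε * (W * b ^ 2 / (2 * (W * b ^ 2 + 1))) := by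
      rw [hε₁]; field_simp; ring
    rw [this]
    apply mul_lt_of_lt_one_right hε
    rw [div_lt_one (by positivity)]
    nlinarith [mul_nonneg hW0 (sq_nonneg b)]
  filter_upwards [hlim.eventually_lt_const hlt, eventually_normMoment_zero hL q hpos,
    self_mem_nhdsWithin] with h hh hmass hh0
  have hh0 : 0 < h := hh0
  have hle : bound h ≤ ε * h ^ 4 := by
    rw [div_lt_iff₀ (by positivity)] at hh; exact hh.le
  refine le_trans ?_ (ENNReal.ofReal_le_ofReal hle)
  have hmn : ∀ j, 0 ≤ m j h := fun j => hL.normMoment_nonneg h j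
  have hmeas : Measurable fun p => dirAvg L h f p - f p - h ^ 2 * b * psiX f p := by
    have h1 := measurable_dirAvg hL h hf.continuous.measurable
    have h2 := hf.continuous.measurable
    have h3 := hf.continuous_psiX.measurable
    fun_prop
  have hrem : sqInt (rotCyl (q + 1)) (fun w => ∫ y, zonalW L h y * dirRem f (pole (q + 1)) y w
      ∂(surf (q + 1))) ≤ ENNReal.ofReal (m 1 h * (ε₁ * m 1 h + C * (m 2 h / δ))) := by
    refine sqInt_zonal_average_le hL 1 (measurable_dirRem hf _) (fun y w hy => ?_) hε₁0.le
      (abs_nonneg C') hδ (fun y => ?_) fun y hy => ?_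
    · rw [pow_one] at hy
      exact dirRem_eq_zero (eq_pole_of_one_sub_eq_zero hy) w
    · rw [pow_one]
      refine (hC' y).trans (ENNReal.ofReal_le_ofReal ?_)
      exact mul_le_mul_of_nonneg_right (le_abs_self C') (sq_nonneg _)
    · rw [pow_one]; exact hδ' y hy
  have hlin : surf (q + 1) Set.univ * sqInt (rotCyl (q + 1)) (fun w =>
      (m 1 h - h ^ 2 * b) * psiX f (rotAct w.1 (pole (q + 1)), w.2) +
        m 2 h * thetaX f (rotAct w.1 (pole (q + 1)), w.2)) ≤
      ENNReal.ofReal (2 * ((m 1 h - h ^ 2 * b) ^ 2 * A) + 2 * (m 2 h ^ 2 * B)) := by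
    have hψ := hf.continuous_psiX.measurable
    have hθ := hf.continuous_thetaX.measurable
    rw [← sqInt_cyl_eq (pole (q + 1)) (u := fun p => (m 1 h - h ^ 2 * b) * psiX f p +
      m 2 h * thetaX f p) (by fun_prop)]
    refine (sqInt_add_le (cyl (q + 1)) (φ := fun p => (m 1 h - h ^ 2 * b) * psiX f p)
      (hψ.const_mul _).aemeasurable).trans ?_
    rw [sqInt_const_mul, sqInt_const_mul, hAe, hBe, ENNReal.ofReal_add (by positivity) (by positivity),
      ENNReal.ofReal_mul zero_le_two, ENNReal.ofReal_mul zero_le_two,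
      ENNReal.ofReal_mul (sq_nonneg _), ENNReal.ofReal_mul (sq_nonneg _), ENNReal.ofReal_ofNat]
  rw [sqInt_cyl_eq (pole (q + 1)) hmeas]
  have hsplit : (fun w : Rot (q + 1) × ℝ => dirAvg L h f (rotAct w.1 (pole (q + 1)), w.2) -
      f (rotAct w.1 (pole (q + 1)), w.2) - h ^ 2 * b * psiX f (rotAct w.1 (pole (q + 1)), w.2)) =
      fun w => (∫ y, zonalW L h y * dirRem f (pole (q + 1)) y w ∂(surf (q + 1))) +
        ((m 1 h - h ^ 2 * b) * psiX f (rotAct w.1 (pole (q + 1)), w.2) +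
        m 2 h * thetaX f (rotAct w.1 (pole (q + 1)), w.2)) := by
    ext w
    rw [dirAvg_sub_eq hf hL (Nat.succ_ne_zero q) hmass w]
    ring
  rw [hsplit]
  have hme : Measurable fun w => ∫ y, zonalW L h y * dirRem f (pole (q + 1)) y w ∂(surf (q + 1)) := by
    exact measurable_zonal_average hL (measurable_dirRem hf _)
  have hadd := sqInt_add_le (rotCyl (q + 1))
    (φ := fun w => ∫ y, zonalW L h y * dirRem f (pole (q + 1)) y w ∂(surf (q + 1)))
    (ψ := fun w => (m 1 h - h ^ 2 * b) * psiX f (rotAct w.1 (pole (q + 1)), w.2) +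
        m 2 h * thetaX f (rotAct w.1 (pole (q + 1)), w.2)) hme.aemeasurable
  calc _ ≤ surf (q + 1) Set.univ * (2 * ENNReal.ofReal (m 1 h * (ε₁ * m 1 h + C * (m 2 h / δ))) +
        2 * sqInt (rotCyl (q + 1)) (fun w =>
          (m 1 h - h ^ 2 * b) * psiX f (rotAct w.1 (pole (q + 1)), w.2) +
          m 2 h * thetaX f (rotAct w.1 (pole (q + 1)), w.2))) := by
        exact mul_le_mul_right (hadd.trans (add_le_add_left (mul_le_mul_right hrem 2) _)) _
    _ = 2 * (ENNReal.ofReal W * ENNReal.ofReal (m 1 h * (ε₁ * m 1 h + C * (m 2 h / δ)))) +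
        2 * (surf (q + 1) Set.univ * sqInt (rotCyl (q + 1)) (fun w =>
          (m 1 h - h ^ 2 * b) * psiX f (rotAct w.1 (pole (q + 1)), w.2) +
          m 2 h * thetaX f (rotAct w.1 (pole (q + 1)), w.2))) := by
        rw [← hWe]; ring
    _ ≤ 2 * (ENNReal.ofReal W * ENNReal.ofReal (m 1 h * (ε₁ * m 1 h + C * (m 2 h / δ)))) +
        2 * ENNReal.ofReal (2 * ((m 1 h - h ^ 2 * b) ^ 2 * A) + 2 * (m 2 h ^ 2 * B)) := by
        gcongr
    _ = _ := by
        have key : ∀ {a c : ℝ}, 0 ≤ a → 0 ≤ c → 2 * (ENNReal.ofReal W * ENNReal.ofReal a) +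
            2 * ENNReal.ofReal c = ENNReal.ofReal (2 * (W * a) + 2 * c) := fun ha hc => by
          rw [ENNReal.ofReal_add (by positivity) (by positivity), ENNReal.ofReal_mul zero_le_two,
            ENNReal.ofReal_mul zero_le_two, ENNReal.ofReal_mul hW0, ENNReal.ofReal_ofNat]
        have := hmn 1
        have := hmn 2
        exact key (by positivity) (by positivity)

/-- Directional smoothing is a contraction in mean square. -/
theorem sqInt_dirAvg_le (hL : IsBorelProfile L) (hmass : normMoment q L h 0 = 1)
    {u : Sph q × ℝ → ℝ} (hu : Measurable u) :
    sqInt (cyl q) (dirAvg L h u) ≤ sqInt (cyl q) u := by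
  by_cases htop : sqInt (cyl q) u = ⊤
  · rw [htop]; exact le_top
  rw [sqInt_cyl_eq (pole q) (measurable_dirAvg hL h hu), sqInt_cyl_eq (pole q) hu]
  gcongr
  have hN : ∀ y, sqInt (rotCyl q) (fun w => u (rotAct w.1 y, w.2)) =
      sqInt (rotCyl q) (fun w => u (rotAct w.1 (pole q), w.2)) := fun y => by
    rw [sqInt_rotCyl y hu, sqInt_rotCyl (pole q) hu]
  have hfin : sqInt (rotCyl q) (fun w => u (rotAct w.1 (pole q), w.2)) ≠ ⊤ := by
    rw [sqInt_rotCyl _ hu]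
    exact ENNReal.mul_ne_top (ENNReal.inv_ne_top.2 (surf_univ_ne_zero q)) htop
  set C := (sqInt (rotCyl q) (fun w => u (rotAct w.1 (pole q), w.2))).toReal with hC
  have hCe := ENNReal.ofReal_toReal hfin
  have hsq : ∀ y, sqInt (rotCyl q) (fun w => u (rotAct w.1 y, w.2)) ≤ ENNReal.ofReal (C * 1 ^ 2) := by
    intro y; rw [hN, one_pow, mul_one, hCe]
  -- With `ρ = 1` and the whole sphere as near set this is Jensen's inequality for a probability
  -- weight, all rotated copies of `u` having the same mean square.
  have key := sqInt_average_le (rotCyl q) (surf q) (hL.measurable_zonalW h) (hL.zonalW_nonneg h)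
    (ρ := fun _ => 1) measurable_const (fun _ => zero_le_one)
    (D := fun y w => u (rotAct w.1 y, w.2)) (measurable_rotAct_pair hu) (by simp) MeasurableSet.univ
    (ε := C) (C := C) hsq fun y _ => hsq y
  have e0 := lintegral_zonalW_mul (q := q) hL h 0
  simp only [pow_zero] at e0
  rw [e0, hmass] at key
  simp only [dirAvg_rotAct]
  rw [← hCe, ← hC]
  refine key.trans (le_of_eq ?_)
  simp

/-- Strong continuity of rotations in mean square. -/
theorem tendsto_sqInt_rotAct_sub {u : Sph q × ℝ → ℝ} (hu : Continuous u) (hu2 : MemLp u 2 (cyl q))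
    (x : Sph q) :
    Tendsto (fun y => sqInt (rotCyl q) (fun w => u (rotAct w.1 y, w.2) - u (rotAct w.1 x, w.2)))
      (𝓝 x) (𝓝 0) := by
  rw [tendsto_iff_seq_tendsto]
  intro v hv
  have h1 : ∀ᵐ w : Rot q × ℝ ∂(rotCyl q), Tendsto (fun n => u (rotAct w.1 (v n), w.2)) atTop
      (𝓝 (u (rotAct w.1 x, w.2))) := by
    refine ae_of_all _ fun w => ?_
    have hc : Continuous fun y : Sph q => u (rotAct w.1 y, w.2) :=
      hu.comp ((continuous_rotAct.comp (Continuous.prodMk_right w.1)).prodMk continuous_const)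
    exact (hc.tendsto x).comp hv
  have h2 : sqInt (rotCyl q) (fun w => u (rotAct w.1 x, w.2)) ≠ ⊤ := by
    rw [sqInt_rotCyl x hu.measurable]
    exact inv_surf_mul_sqInt_ne_top hu2
  have h3 : Tendsto (fun n => sqInt (rotCyl q) (fun w => u (rotAct w.1 (v n), w.2))) atTop
      (𝓝 (sqInt (rotCyl q) (fun w => u (rotAct w.1 x, w.2)))) := by
    have e : ∀ n, (surf q Set.univ)⁻¹ * sqInt (cyl q) u =
        sqInt (rotCyl q) (fun w => u (rotAct w.1 (v n), w.2)) := fun n =>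
      (sqInt_rotCyl (v n) hu.measurable).symm
    rw [sqInt_rotCyl x hu.measurable]
    exact Tendsto.congr e tendsto_const_nhds
  exact tendsto_sqInt_sub_of_tendsto (μ := rotCyl q) (a := fun n w => u (rotAct w.1 (v n), w.2))
    (b := fun w => u (rotAct w.1 x, w.2)) (fun n => measurable_rotAct_left hu.measurable (v n))
    (measurable_rotAct_left hu.measurable x) h1 h2 h3

/-- Directional smoothing of a continuous square integrable function converges in mean square. -/
theorem dirAvg_sub_tendsto {u : Sph (q + 1) × ℝ → ℝ} (hu : Continuous u)
    (hu2 : MemLp u 2 (cyl (q + 1))) (hL : IsBorelProfile L) (hpos : 0 < profMoment q L 0)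
    {ε : ℝ} (hε : 0 < ε) :
    ∀ᶠ h in 𝓝[>] (0 : ℝ), sqInt (cyl (q + 1)) (fun p => dirAvg L h u p - u p) ≤ ENNReal.ofReal ε := by
  set W := (surf (q + 1) Set.univ).toReal with hW
  have hW0 : 0 < W := ENNReal.toReal_pos (surf_univ_ne_zero _) (measure_ne_top _ _)
  have hWe : surf (q + 1) Set.univ = ENNReal.ofReal W := (ENNReal.ofReal_toReal (measure_ne_top _ _)).symm
  set x := pole (q + 1)
  set D : Sph (q + 1) → Rot (q + 1) × ℝ → ℝ := fun y w => u (rotAct w.1 y, w.2) - u (rotAct w.1 x, w.2)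
    with hD
  have hDm : Measurable (Function.uncurry D) := (measurable_rotAct_pair hu.measurable).sub
    ((measurable_rotAct_left hu.measurable x).comp measurable_snd)
  set C := (4 * ((surf (q + 1) Set.univ)⁻¹ * sqInt (cyl (q + 1)) u)).toReal with hC
  have hCe : ENNReal.ofReal C = 4 * ((surf (q + 1) Set.univ)⁻¹ * sqInt (cyl (q + 1)) u) :=
    ENNReal.ofReal_toReal (ENNReal.mul_ne_top (by simp) (inv_surf_mul_sqInt_ne_top hu2))
  have hDC : ∀ y, sqInt (rotCyl (q + 1)) (D y) ≤ ENNReal.ofReal C := by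
    intro y
    have h1 := sqInt_add_le (rotCyl (q + 1)) (φ := fun w => u (rotAct w.1 y, w.2))
      (ψ := fun w => -u (rotAct w.1 x, w.2)) (measurable_rotAct_left hu.measurable y).aemeasurable
    rw [sqInt_neg, sqInt_rotCyl _ hu.measurable, sqInt_rotCyl _ hu.measurable] at h1
    rw [hCe]
    refine h1.trans (le_of_eq ?_)
    ring
  set ε₁ := ε / (2 * W) with hε₁
  have hε₁0 : 0 < ε₁ := by positivity
  obtain ⟨δ, hδ, hδ'⟩ : ∃ δ > 0, ∀ y : Sph (q + 1), 1 - (y : Amb (q + 1)) 0 < δ →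
      sqInt (rotCyl (q + 1)) (D y) ≤ ENNReal.ofReal ε₁ := by
    have hev := (tendsto_sqInt_rotAct_sub hu hu2 x).eventually_le_const
      (ENNReal.ofReal_pos.2 hε₁0)
    obtain ⟨r, hr, hball⟩ := Metric.eventually_nhds_iff.1 hev
    refine ⟨r ^ 2 / 2, by positivity, fun y hy => hball ?_⟩
    have e := norm_sub_sq_sph x y
    rw [inner_pole] at e
    rw [Subtype.dist_eq, dist_eq_norm, norm_sub_rev] at *
    apply lt_of_pow_lt_pow_left₀ 2 hr.le
    rw [e]
    linarith
  have hlim : Tendsto (fun h => W * (1 * (ε₁ * 1 + C * (normMoment (q + 1) L h 1 / δ)))) (𝓝[>] 0)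
      (𝓝 (W * (1 * (ε₁ * 1 + C * (0 / δ))))) := by
    have h1 : Tendsto (fun h => normMoment (q + 1) L h 1) (𝓝[>] 0) (𝓝 0) := by
      have h2 := (tendsto_normMoment hL q hpos 1).mul
        ((tendsto_id.mono_left (nhdsWithin_le_nhds (a := (0 : ℝ)) (s := Set.Ioi 0))).pow 2)
      rw [zero_pow two_ne_zero, mul_zero] at h2
      refine h2.congr' ?_
      filter_upwards [self_mem_nhdsWithin] with h hh
      have hh : h ≠ 0 := (Set.mem_Ioi.1 hh).ne'
      simp only [id, mul_one]
      field_simp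
    exact ((((h1.div_const δ).const_mul C).const_add (ε₁ * 1)).const_mul 1).const_mul W
  have hlt : W * (1 * (ε₁ * 1 + C * (0 / δ))) < ε := by
    have : W * (1 * (ε₁ * 1 + C * (0 / δ))) = ε / 2 := by rw [hε₁]; field_simp; ring
    rw [this]; linarith
  filter_upwards [hlim.eventually_lt_const hlt, eventually_normMoment_zero hL q hpos] with h hh hmass
  have hmeas : Measurable fun p => dirAvg L h u p - u p :=
    (measurable_dirAvg hL h hu.measurable).sub hu.measurable
  rw [sqInt_cyl_eq x hmeas]
  have hsplit : (fun w : Rot (q + 1) × ℝ => dirAvg L h u (rotAct w.1 x, w.2) - u (rotAct w.1 x, w.2)) =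
      fun w => ∫ y, zonalW L h y * D y w ∂(surf (q + 1)) := by
    ext ⟨R, z⟩
    have hc : Continuous fun y : Sph (q + 1) => u (rotAct R y, z) :=
      hu.comp ((continuous_rotAct.comp (Continuous.prodMk_right R)).prodMk continuous_const)
    have h0 : ∫ y : Sph (q + 1), zonalW L h y ∂(surf (q + 1)) = 1 := by
      have := integral_zonalW_pow (q := q + 1) L h 0
      simp only [pow_zero, mul_one] at this
      rw [this]; exact hmass
    simp only [hD, mul_sub]
    rw [integral_sub (hL.integrable_zonalW_mul h hc) (hL.integrable_zonalW_mul h continuous_const),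
      integral_mul_const, h0, one_mul, ← dirAvg_rotAct]
  rw [hsplit]
  -- The exponent is `0` since the continuity of rotations comes without a rate; the weight far from
  -- the pole is controlled by the first moment, which tends to zero.
  have key := sqInt_zonal_average_le (h := h) hL 0 hDm (fun y w hy => by simp at hy) hε₁0.le
    (ENNReal.toReal_nonneg : 0 ≤ C) hδ (fun y => by rw [pow_zero, one_pow, mul_one]; exact hDC y)
    (fun y hy => by rw [pow_zero, one_pow, mul_one]; exact hδ' y hy)
  rw [hmass] at key
  rw [hWe]
  refine (mul_le_mul_right key _).trans ?_
  rw [← ENNReal.ofReal_mul hW0.le]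
  exact ENNReal.ofReal_le_ofReal hh.le

end DirectionalBias

end DirLin

namespace DirLin
open scoped ENNReal Real

/-! ### Linear smoothing and its bias in `L²`. -/

section LinearBias

variable {q : ℕ} {K : ℝ → ℝ} {f : Sph q × ℝ → ℝ}

theorem lintegral_cyl_translate {φ : Sph q × ℝ → ℝ≥0∞} (hφ : Measurable φ) (t : ℝ) :
    ∫⁻ p, φ (p.1, p.2 + t) ∂(cyl q) = ∫⁻ p, φ p ∂(cyl q) := by
  have hm : Measurable fun p : Sph q × ℝ => φ (p.1, p.2 + t) := by fun_prop
  rw [cyl, lintegral_prod _ hm.aemeasurable, lintegral_prod _ hφ.aemeasurable]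
  refine lintegral_congr fun x => ?_
  exact lintegral_add_right_eq_self (fun z => φ (x, z)) t

theorem sqInt_cyl_translate {u : Sph q × ℝ → ℝ} (hu : Measurable u) (t : ℝ) :
    sqInt (cyl q) (fun p => u (p.1, p.2 + t)) = sqInt (cyl q) u :=
  lintegral_cyl_translate (φ := fun p => ENNReal.ofReal (u p ^ 2)) (by fun_prop) t

/-- Strong continuity of the translations in the linear variable, in mean square. -/
theorem tendsto_sqInt_translate_sub {u : Sph q × ℝ → ℝ} (hu : Continuous u) (hu2 : MemLp u 2 (cyl q)) :
    Tendsto (fun t : ℝ => sqInt (cyl q) (fun p => u (p.1, p.2 + t) - u p)) (𝓝 0) (𝓝 0) := by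
  rw [tendsto_iff_seq_tendsto]
  intro t ht
  have h1 : ∀ᵐ p : Sph q × ℝ ∂(cyl q), Tendsto (fun n => u (p.1, p.2 + t n)) atTop (𝓝 (u p)) := by
    refine ae_of_all _ fun p => ?_
    have hc : Continuous fun s : ℝ => u (p.1, p.2 + s) := by fun_prop
    have := (hc.tendsto 0).comp ht
    simpa [Function.comp_def] using this
  have h3 : Tendsto (fun n => sqInt (cyl q) (fun p => u (p.1, p.2 + t n))) atTop
      (𝓝 (sqInt (cyl q) u)) :=
    Tendsto.congr (fun n => (sqInt_cyl_translate hu.measurable (t n)).symm) tendsto_const_nhds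
  exact tendsto_sqInt_sub_of_tendsto (μ := cyl q) (a := fun n p => u (p.1, p.2 + t n))
    (b := u) (fun n => (by fun_prop : Continuous fun p : Sph q × ℝ => u (p.1, p.2 + t n)).measurable)
    hu.measurable h1 (sqInt_ne_top hu2) h3

/-- The second order Taylor remainder in the linear variable. -/
noncomputable def linRem (f : Sph q × ℝ → ℝ) (w : ℝ) (p : Sph q × ℝ) : ℝ :=
  f (p.1, p.2 + w) - f p - w * grad (radialExt f) (emb p) (Sum.inr ()) - w ^ 2 * hessZ f p / 2

theorem ofReal_linRem_sq_le (hf : SmoothDensity f) (w : ℝ) (p : Sph q × ℝ) :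
    ENNReal.ofReal (linRem f w p ^ 2) ≤ ENNReal.ofReal (w ^ 4) *
      ∫⁻ s in Set.Icc (0 : ℝ) 1, ENNReal.ofReal ((hessZ f (p.1, p.2 + s * w) - hessZ f p) ^ 2) := by
  obtain ⟨x, z⟩ := p
  have hmem : ∀ s : ℝ, ((x : Amb q), z + s * w) ∈ offAxis q := fun s => sph_ne_zero x
  have h := ofReal_sq_taylor_le (φ := fun s => radialExt f ((x : Amb q), z + s * w))
    (φ' := fun s => w * grad (radialExt f) ((x : Amb q), z + s * w) (Sum.inr ()))
    (φ'' := fun s => w * (w * hessZ f (x, z + s * w)))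
    (fun s _ => hasDerivAt_line (hf.hasFDerivAt (hmem s)))
    (fun s _ => (hasDerivAt_line (hf.hasFDerivAt_grad (Sum.inr ()) (hmem s))).const_mul w)
    (by have := hf.continuous_hessZ; fun_prop)
  have e1 : ∀ s : ℝ, radialExt f ((x : Amb q), z + s * w) = f (x, z + s * w) := fun s =>
    radialExt_emb f (x, z + s * w)
  simp only [e1] at h
  rw [← lintegral_const_mul' _ _ ENNReal.ofReal_ne_top]
  refine le_trans (le_of_eq ?_) (h.trans (le_of_eq ?_))
  · congr 2
    simp only [linRem, emb, zero_mul, one_mul, add_zero]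
    ring
  · refine lintegral_congr fun s => ?_
    rw [← ENNReal.ofReal_mul (by positivity)]
    congr 1
    simp only [zero_mul, add_zero]
    ring

theorem sqInt_linRem_le (hf : SmoothDensity f) (w : ℝ) {η : ℝ≥0∞}
    (hη : ∀ s ∈ Set.Icc (0 : ℝ) 1, sqInt (cyl q)
      (fun p => hessZ f (p.1, p.2 + s * w) - hessZ f p) ≤ η) :
    sqInt (cyl q) (linRem f w) ≤ ENNReal.ofReal (w ^ 4) * η := by
  have hH := hf.continuous_hessZ
  have hm : Measurable (Function.uncurry fun (p : Sph q × ℝ) (s : ℝ) =>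
      ENNReal.ofReal ((hessZ f (p.1, p.2 + s * w) - hessZ f p) ^ 2)) := by
    have : Continuous fun a : (Sph q × ℝ) × ℝ => (hessZ f (a.1.1, a.1.2 + a.2 * w) - hessZ f a.1) ^ 2 := by
      fun_prop
    exact this.measurable.ennreal_ofReal
  calc sqInt (cyl q) (linRem f w) ≤ ∫⁻ p, ENNReal.ofReal (w ^ 4) *
        (∫⁻ s in Set.Icc (0 : ℝ) 1, ENNReal.ofReal ((hessZ f (p.1, p.2 + s * w) - hessZ f p) ^ 2))
          ∂(cyl q) := lintegral_mono fun p => ofReal_linRem_sq_le hf w p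
    _ = ENNReal.ofReal (w ^ 4) * ∫⁻ s in Set.Icc (0 : ℝ) 1, sqInt (cyl q)
          (fun p => hessZ f (p.1, p.2 + s * w) - hessZ f p) := by
        rw [lintegral_const_mul' _ _ ENNReal.ofReal_ne_top, lintegral_lintegral_swap hm.aemeasurable]
        rfl
    _ ≤ ENNReal.ofReal (w ^ 4) * ∫⁻ s in Set.Icc (0 : ℝ) 1, η := by
        refine mul_le_mul_right (setLIntegral_mono' measurableSet_Icc hη) _
    _ = _ := by simp

theorem measurable_linRem (hf : SmoothDensity f) :
    Measurable (Function.uncurry (linRem f)) := by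
  have h1 := hf.continuous
  have h2 := hf.continuous_hessZ
  have h3 := hf.continuous_grad_emb (Sum.inr ())
  have h4 : Continuous fun a : ℝ × (Sph q × ℝ) => f (a.2.1, a.2.2 + a.1) := by fun_prop
  have h5 : Continuous fun a : ℝ × (Sph q × ℝ) => linRem f a.1 a.2 :=
    ((h4.sub (h1.comp continuous_snd)).sub (continuous_fst.mul (h3.comp continuous_snd))).sub
      (((continuous_fst.pow 2).mul (h2.comp continuous_snd)).div_const 2)
  exact h5.measurable

/-- The translated and the original second derivative have equal mean squares, so their difference
costs at most the factor `4 = 2 + 2`. -/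
theorem exists_sqInt_linRem_le (hf : SmoothDensity f) :
    ∃ C : ℝ, 0 ≤ C ∧ ∀ w, sqInt (cyl q) (linRem f w) ≤ ENNReal.ofReal (C * w ^ 4) := by
  have hfin := sqInt_ne_top hf.memLp_hessZ
  refine ⟨(4 * sqInt (cyl q) (hessZ f)).toReal, ENNReal.toReal_nonneg, fun w => ?_⟩
  rw [mul_comm, ENNReal.ofReal_mul (by positivity),
    ENNReal.ofReal_toReal (ENNReal.mul_ne_top (by simp) hfin)]
  refine sqInt_linRem_le hf w fun s _ => ?_
  have h1 := sqInt_add_le (cyl q) (φ := fun p => hessZ f (p.1, p.2 + s * w))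
      (ψ := fun p => -hessZ f p) (hf.continuous_hessZ.comp (by fun_prop :
        Continuous fun p : Sph q × ℝ => (p.1, p.2 + s * w))).measurable.aemeasurable
  rw [sqInt_neg, sqInt_cyl_translate hf.continuous_hessZ.measurable] at h1
  refine h1.trans (le_of_eq ?_)
  ring

theorem sqInt_linRem_isLittleO (hf : SmoothDensity f) {ε : ℝ} (hε : 0 < ε) :
    ∃ δ > 0, ∀ w, |w| < δ → sqInt (cyl q) (linRem f w) ≤ ENNReal.ofReal (ε * w ^ 4) := by
  have hev := (tendsto_sqInt_translate_sub hf.continuous_hessZ hf.memLp_hessZ).eventually_le_const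
    (ENNReal.ofReal_pos.2 hε)
  obtain ⟨δ, hδ, hb⟩ := Metric.eventually_nhds_iff.1 hev
  refine ⟨δ, hδ, fun w hw => ?_⟩
  rw [mul_comm, ENNReal.ofReal_mul (by positivity)]
  refine sqInt_linRem_le hf w fun s hs => hb ?_
  rw [Real.dist_eq, sub_zero, abs_mul, abs_of_nonneg hs.1]
  exact lt_of_le_of_lt (mul_le_of_le_one_left (abs_nonneg w) hs.2) hw

/-- Smoothing in the linear variable. -/
noncomputable def linAvg (K : ℝ → ℝ) (g : ℝ) (u : Sph q × ℝ → ℝ) (p : Sph q × ℝ) : ℝ :=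
  ∫ v, K v * u (p.1, p.2 - g * v)

theorem measurable_linAvg (hK : Measurable K) (g : ℝ) {u : Sph q × ℝ → ℝ} (hu : Measurable u) :
    Measurable (linAvg K g u) := by
  have : Measurable fun a : (Sph q × ℝ) × ℝ => K a.2 * u (a.1.1, a.1.2 - g * a.2) := by fun_prop
  exact this.stronglyMeasurable.integral_prod_right'.measurable

theorem IsLinKernel.integrable_mul_id (hK : IsLinKernel K) : Integrable fun v => K v * v := by
  refine (hK.integrable.add hK.second_moment).mono'
    (hK.measurable.mul measurable_id).aestronglyMeasurable (ae_of_all _ fun v => ?_)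
  rw [norm_mul, Real.norm_of_nonneg (hK.nonneg v), Real.norm_eq_abs]
  simp only [Pi.add_apply]
  have : |v| ≤ 1 + v ^ 2 := by nlinarith [sq_nonneg (|v| - 1), sq_abs v, abs_nonneg v]
  nlinarith [mul_le_mul_of_nonneg_left this (hK.nonneg v)]

theorem IsLinKernel.integral_mul_id (hK : IsLinKernel K) : ∫ v, K v * v = 0 := by
  have h := integral_neg_eq_self (fun v => K v * v) volume
  simp only [hK.symmetric, mul_neg, integral_neg] at h
  linarith

theorem IsLinKernel.mu2_nonneg (hK : IsLinKernel K) : 0 ≤ mu2 K :=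
  integral_nonneg fun v => mul_nonneg (sq_nonneg v) (hK.nonneg v)

/-- Only almost every section of `f` is integrable, and this is what allows the smoothing integral
to be split term by term. The bias identity accordingly holds almost everywhere. -/
theorem integrable_section (hf : Integrable f (cyl q)) :
    ∀ᵐ p ∂(cyl q), Integrable fun z => f (p.1, z) :=
  Measure.quasiMeasurePreserving_fst.ae (hf.prod_right_ae)

/-- The symmetry of `K` removes the linear Taylor term, the unit mass reproduces `f`, and the second
moment yields the factor `mu2 K * g ^ 2 / 2`. -/
theorem linAvg_sub_eq (hK : IsLinKernel K) {p : Sph q × ℝ} {g : ℝ} (hg : g ≠ 0)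
    (hp : Integrable fun z => f (p.1, z)) :
    linAvg K g f p - f p - 1 / 2 * mu2 K * g ^ 2 * hessZ f p = ∫ v, K v * linRem f (-(g * v)) p := by
  obtain ⟨M, hM⟩ := hK.bounded
  have i1 : Integrable fun v => K v * f (p.1, p.2 - g * v) := by
    have : Integrable fun v => f (p.1, p.2 - g * v) :=
      (hp.comp_sub_left p.2).comp_mul_left' hg
    refine this.bdd_mul (c := M) hK.measurable.aestronglyMeasurable (ae_of_all _ fun v => ?_)
    rw [Real.norm_of_nonneg (hK.nonneg v)]; exact hM v
  have i2 : Integrable fun v => K v * f p := hK.integrable.mul_const _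
  set G := grad (radialExt f) (emb p) (Sum.inr ())
  have i3 : Integrable fun v => g * G * (K v * v) := hK.integrable_mul_id.const_mul _
  have i4 : Integrable fun v => g ^ 2 * hessZ f p / 2 * (v ^ 2 * K v) := hK.second_moment.const_mul _
  have e : ∀ v, K v * linRem f (-(g * v)) p = K v * f (p.1, p.2 - g * v) - K v * f p +
      g * G * (K v * v) - g ^ 2 * hessZ f p / 2 * (v ^ 2 * K v) := fun v => by
    simp only [linRem, ← sub_eq_add_neg]
    ring
  have i12 : Integrable fun v => K v * f (p.1, p.2 - g * v) - K v * f p := i1.sub i2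
  have i123 : Integrable fun v => K v * f (p.1, p.2 - g * v) - K v * f p + g * G * (K v * v) :=
    i12.add i3
  simp only [e]
  rw [integral_sub i123 i4, integral_add i12 i3, integral_sub i1 i2, integral_const_mul,
    integral_const_mul, integral_mul_const, hK.integral_eq_one, hK.integral_mul_id, linAvg, mu2]
  ring

/-- No moment of `K` beyond the second is assumed, so Markov's inequality with a higher moment, as
used on the sphere, is replaced by dominated convergence. -/
theorem tendsto_lintegral_tail (hK : IsLinKernel K) {δ : ℝ} (hδ : 0 < δ) :
    Tendsto (fun g : ℝ => ∫⁻ v in {v : ℝ | |g * v| < δ}ᶜ, ENNReal.ofReal (K v * v ^ 2)) (𝓝[>] 0)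
      (𝓝 0) := by
  have hms : ∀ g : ℝ, MeasurableSet {v : ℝ | |g * v| < δ}ᶜ := fun g =>
    (measurableSet_lt (by fun_prop) measurable_const).compl
  have hKm := hK.measurable
  simp only [← lintegral_indicator (hms _)]
  have hfin : ∫⁻ v, ENNReal.ofReal (K v * v ^ 2) ≠ ⊤ := by
    have := hK.second_moment.lintegral_lt_top.ne
    simpa only [mul_comm] using this
  have := tendsto_lintegral_filter_of_dominated_convergence (μ := (volume : Measure ℝ))
    (l := 𝓝[>] (0 : ℝ)) (F := fun (g : ℝ) v => ({v : ℝ | |g * v| < δ}ᶜ).indicator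
      (fun v => ENNReal.ofReal (K v * v ^ 2)) v) (f := fun _ => 0)
    (fun v => ENNReal.ofReal (K v * v ^ 2))
    (Eventually.of_forall fun g => (by fun_prop : Measurable fun v =>
      ENNReal.ofReal (K v * v ^ 2)).indicator (hms g))
    (Eventually.of_forall fun g => ae_of_all _ fun v => Set.indicator_le_self _ _ v) hfin
    (ae_of_all _ fun v => by
      have hc : Tendsto (fun g : ℝ => |g * v|) (𝓝[>] 0) (𝓝 0) := by
        have : Tendsto (fun g : ℝ => |g * v|) (𝓝 0) (𝓝 |0 * v|) :=
          (by fun_prop : Continuous fun g : ℝ => |g * v|).tendsto 0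
        rw [zero_mul, abs_zero] at this
        exact this.mono_left nhdsWithin_le_nhds
      refine tendsto_const_nhds.congr' ?_
      filter_upwards [hc.eventually_lt_const hδ] with g hg
      rw [Set.indicator_of_notMem]
      simpa using hg)
  simpa using this

theorem linAvg_sub_isLittleO (hf : SmoothDensity f) (hfi : Integrable f (cyl q)) (hK : IsLinKernel K)
    {ε : ℝ} (hε : 0 < ε) :
    ∀ᶠ g in 𝓝[>] (0 : ℝ), sqInt (cyl q) (fun p => linAvg K g f p - f p -
      1 / 2 * mu2 K * g ^ 2 * hessZ f p) ≤ ENNReal.ofReal (ε * g ^ 4) := by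
  obtain ⟨C, hC0, hC⟩ := exists_sqInt_linRem_le hf
  have hm0 := hK.mu2_nonneg
  set m := mu2 K with hm
  -- The averaging lemma with `ρ v = v²` yields the bound `m (ε₁ m + C η) g⁴`. This choice and that
  -- of `η` below make each of its two terms at most `(ε / 2) g⁴`.
  set ε₁ := ε / (2 * (m ^ 2 + 1)) with hε₁
  have hε₁0 : 0 < ε₁ := by positivity
  obtain ⟨δ, hδ, hδ'⟩ := sqInt_linRem_isLittleO hf hε₁0
  set η := ε / (2 * (m * C + 1)) with hη
  have hη0 : 0 < η := by positivity
  have hKm := hK.measurable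
  have hme : ∫⁻ v, ENNReal.ofReal (K v * v ^ 2) = ENNReal.ofReal m := by
    rw [hm, mu2, ofReal_integral_eq_lintegral_ofReal hK.second_moment
      (ae_of_all _ fun v => mul_nonneg (sq_nonneg v) (hK.nonneg v))]
    simp only [mul_comm]
  filter_upwards [(tendsto_lintegral_tail hK hδ).eventually_le_const (ENNReal.ofReal_pos.2 hη0),
    self_mem_nhdsWithin] with g htail hg
  have hg : 0 < g := hg
  have hcongr : sqInt (cyl q) (fun p => linAvg K g f p - f p - 1 / 2 * m * g ^ 2 * hessZ f p) =
      sqInt (cyl q) (fun p => ∫ v, K v * linRem f (-(g * v)) p) := by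
    refine lintegral_congr_ae ((integrable_section hfi).mono fun p hp => ?_)
    simp only []
    rw [linAvg_sub_eq hK hg.ne' hp]
  rw [hcongr]
  have hU : MeasurableSet {v : ℝ | |g * v| < δ} := measurableSet_lt (by fun_prop) measurable_const
  have hD : Measurable (Function.uncurry fun (v : ℝ) (p : Sph q × ℝ) => linRem f (-(g * v)) p) :=
    (measurable_linRem hf).comp (by fun_prop :
      Measurable fun a : ℝ × (Sph q × ℝ) => (-(g * a.1), a.2))
  have key := sqInt_average_le (cyl q) (volume : Measure ℝ) hKm hK.nonneg (ρ := fun v => v ^ 2)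
    (by fun_prop) (fun v => sq_nonneg v) (D := fun v p => linRem f (-(g * v)) p) hD
    (fun v p hv => by
      have : v = 0 := by simpa using hv
      subst this
      simp [linRem]) hU (ε := ε₁ * g ^ 4) (C := C * g ^ 4)
    (fun v => (hC _).trans (ENNReal.ofReal_le_ofReal (le_of_eq (by ring))))
    (fun v hv => (hδ' _ (by rwa [abs_neg])).trans (ENNReal.ofReal_le_ofReal (le_of_eq (by ring))))
  refine key.trans ?_
  rw [hme]
  calc _ ≤ ENNReal.ofReal m * (ENNReal.ofReal (ε₁ * g ^ 4) * ENNReal.ofReal m +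
        ENNReal.ofReal (C * g ^ 4) * ENNReal.ofReal η) := by gcongr
    _ = ENNReal.ofReal (m * (ε₁ * g ^ 4 * m + C * g ^ 4 * η)) := by
        rw [ENNReal.ofReal_mul hm0, ENNReal.ofReal_add (by positivity) (by positivity),
          ENNReal.ofReal_mul (by positivity : 0 ≤ ε₁ * g ^ 4),
          ENNReal.ofReal_mul (by positivity : 0 ≤ C * g ^ 4)]
    _ ≤ _ := by
        apply ENNReal.ofReal_le_ofReal
        have h1 : m ^ 2 * ε₁ ≤ ε / 2 := by
          rw [hε₁, ← mul_div_assoc, div_le_div_iff₀ (by positivity) (by positivity)]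
          nlinarith
        have h2 : m * C * η ≤ ε / 2 := by
          rw [hη, ← mul_div_assoc, div_le_div_iff₀ (by positivity) (by positivity)]
          nlinarith
        have hg4 : 0 ≤ g ^ 4 := by positivity
        nlinarith [mul_le_mul_of_nonneg_right (add_le_add h1 h2) hg4]

end LinearBias

end DirLin

namespace DirLin
open scoped ENNReal Real

/-! ### Moments of the contribution of one observation. -/

section ObservationKernel

variable {q : ℕ} {L K : ℝ → ℝ} {h g : ℝ} {f : Sph q × ℝ → ℝ}

/-- The contribution of an observation at `s` to the estimator at `p`. -/
noncomputable def obsKernel (L K : ℝ → ℝ) (h g : ℝ) (p s : Sph q × ℝ) : ℝ :=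
  normConst q L h / g *
    (L ((1 - inner ℝ (p.1 : Amb q) (s.1 : Amb q)) / h ^ 2) * K ((p.2 - s.2) / g))

theorem measurable_obsKernel (hL : Measurable L) (hK : Measurable K) (h g : ℝ) :
    Measurable (Function.uncurry (obsKernel (q := q) L K h g)) := by
  have : Measurable fun a : (Sph q × ℝ) × (Sph q × ℝ) => obsKernel L K h g a.1 a.2 := by
    unfold obsKernel; fun_prop
  exact this

theorem obsKernel_nonneg (hL : IsBorelProfile L) (hK : IsLinKernel K) (hg : 0 < g)
    (p s : Sph q × ℝ) : 0 ≤ obsKernel L K h g p s :=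
  mul_nonneg (div_nonneg (hL.normConst_nonneg q h) hg.le) (mul_nonneg (hL.nonneg _) (hK.nonneg _))

theorem obsKernel_le (hL : IsBorelProfile L) (hK : IsLinKernel K) (hg : 0 < g) {M N : ℝ}
    (hM : ∀ r, L r ≤ M) (hN : ∀ v, K v ≤ N) (p s : Sph q × ℝ) :
    obsKernel L K h g p s ≤ normConst q L h / g * (M * N) :=
  mul_le_mul_of_nonneg_left (mul_le_mul (hM _) (hN _) (hK.nonneg _) ((hL.nonneg 0).trans (hM 0)))
    (div_nonneg (hL.normConst_nonneg q h) hg.le)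

theorem integrable_zonal_profile {Λ : ℝ → ℝ} (hΛ : Measurable Λ) {M : ℝ} (hM : ∀ r, |Λ r| ≤ M) (h : ℝ)
    (x : Sph q) :
    Integrable (fun y : Sph q => Λ ((1 - inner ℝ (x : Amb q) (y : Amb q)) / h ^ 2)) (surf q) :=
  Integrable.of_bound (by fun_prop : Measurable fun y : Sph q =>
    Λ ((1 - inner ℝ (x : Amb q) (y : Amb q)) / h ^ 2)).aestronglyMeasurable M
    (ae_of_all _ fun _ => hM _)

theorem integrable_product_right {Λ κ : ℝ → ℝ} (hΛ : Measurable Λ) {M : ℝ} (hM : ∀ r, |Λ r| ≤ M)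
    (hκ : Integrable κ) (h : ℝ) (hg : 0 < g) (p : Sph q × ℝ) :
    Integrable (fun s : Sph q × ℝ => Λ ((1 - inner ℝ (p.1 : Amb q) (s.1 : Amb q)) / h ^ 2) *
      κ ((p.2 - s.2) / g)) (cyl q) :=
  (integrable_zonal_profile hΛ hM h p.1).mul_prod ((hκ.comp_div hg.ne').comp_sub_left p.2)

theorem integral_product_right (Λ κ : ℝ → ℝ) (h : ℝ) (hg : 0 < g) (p : Sph q × ℝ) :
    ∫ s : Sph q × ℝ, Λ ((1 - inner ℝ (p.1 : Amb q) (s.1 : Amb q)) / h ^ 2) * κ ((p.2 - s.2) / g) ∂(cyl q) =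
      capMoment q Λ h 0 * (g * ∫ v, κ v) := by
  rw [cyl, integral_prod_mul (fun y : Sph q => Λ ((1 - inner ℝ (p.1 : Amb q) (y : Amb q)) / h ^ 2))
    fun z => κ ((p.2 - z) / g), integral_sub_left_eq_self (fun z => κ (z / g)) volume p.2,
    Measure.integral_comp_div, abs_of_pos hg, ← kernelMass_pole, kernelMass_eq q Λ h (pole q) p.1]
  rfl

theorem integrable_product_left {Λ κ : ℝ → ℝ} (hΛ : Measurable Λ) {M : ℝ} (hM : ∀ r, |Λ r| ≤ M)
    (hκ : Integrable κ) (h : ℝ) (hg : 0 < g) (s : Sph q × ℝ) :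
    Integrable (fun p : Sph q × ℝ => Λ ((1 - inner ℝ (p.1 : Amb q) (s.1 : Amb q)) / h ^ 2) *
      κ ((p.2 - s.2) / g)) (cyl q) := by
  simp only [real_inner_comm (s.1 : Amb q)]
  exact (integrable_zonal_profile hΛ hM h s.1).mul_prod ((hκ.comp_div hg.ne').comp_sub_right s.2)

theorem integral_product_left (Λ κ : ℝ → ℝ) (h : ℝ) (hg : 0 < g) (s : Sph q × ℝ) :
    ∫ p : Sph q × ℝ, Λ ((1 - inner ℝ (p.1 : Amb q) (s.1 : Amb q)) / h ^ 2) * κ ((p.2 - s.2) / g) ∂(cyl q) =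
      capMoment q Λ h 0 * (g * ∫ v, κ v) := by
  simp only [real_inner_comm (s.1 : Amb q)]
  rw [cyl, integral_prod_mul (fun y : Sph q => Λ ((1 - inner ℝ (s.1 : Amb q) (y : Amb q)) / h ^ 2))
    fun z => κ ((z - s.2) / g), integral_sub_right_eq_self (fun z => κ (z / g)) s.2,
    Measure.integral_comp_div, abs_of_pos hg, ← kernelMass_pole, kernelMass_eq q Λ h (pole q) s.1]
  rfl

theorem IsBorelProfile.abs_le (hL : IsBorelProfile L) : ∃ M, ∀ r, |L r| ≤ M := by
  obtain ⟨M, hM⟩ := hL.bounded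
  exact ⟨M, fun r => by rw [abs_of_nonneg (hL.nonneg r)]; exact hM r⟩

theorem IsBorelProfile.sq (hL : IsBorelProfile L) : IsBorelProfile fun r => L r ^ 2 := by
  obtain ⟨M, hM⟩ := hL.bounded
  have hLm := hL.measurable
  refine ⟨by fun_prop, fun r => sq_nonneg _, ⟨M ^ 2, fun r => by
    have := hL.nonneg r; have := hM r; gcongr⟩, fun m hm => ?_⟩
  have h1 : IntegrableOn (fun r => L r * (L r * r ^ ((m : ℝ) / 2 - 1))) (Set.Ioi 0) :=
    (hL.moment_integrable m hm).bdd_mul (c := M) hLm.aestronglyMeasurable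
      (ae_of_all _ fun r => by rw [Real.norm_of_nonneg (hL.nonneg r)]; exact hM r)
  refine h1.congr (ae_of_all _ fun r => ?_)
  ring

theorem IsLinKernel.integrable_sq (hK : IsLinKernel K) : Integrable fun v => K v ^ 2 := by
  obtain ⟨N, hN⟩ := hK.bounded
  have : Integrable fun v => K v * K v :=
    hK.integrable.bdd_mul (c := N) hK.measurable.aestronglyMeasurable
      (ae_of_all _ fun v => by rw [Real.norm_of_nonneg (hK.nonneg v)]; exact hN v)
  simpa only [sq] using this

theorem integrable_obsKernel_left (hL : IsBorelProfile L) (hK : IsLinKernel K) (hg : 0 < g)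
    (s : Sph q × ℝ) : Integrable (fun p => obsKernel L K h g p s) (cyl q) := by
  obtain ⟨M, hM⟩ := hL.abs_le
  exact (integrable_product_left hL.measurable hM hK.integrable h hg s).const_mul _

theorem integrable_obsKernel_right (hL : IsBorelProfile L) (hK : IsLinKernel K) (hg : 0 < g)
    (p : Sph q × ℝ) : Integrable (fun s => obsKernel L K h g p s) (cyl q) := by
  obtain ⟨M, hM⟩ := hL.abs_le
  exact (integrable_product_right hL.measurable hM hK.integrable h hg p).const_mul _

theorem integral_obsKernel_left (hK : IsLinKernel K) (hg : 0 < g)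
    (hmass : normMoment q L h 0 = 1) (s : Sph q × ℝ) : ∫ p, obsKernel L K h g p s ∂(cyl q) = 1 := by
  simp only [obsKernel]
  rw [integral_const_mul, integral_product_left L K h hg s, hK.integral_eq_one, mul_one,
    mul_comm (capMoment q L h 0), ← mul_assoc, div_mul_cancel₀ _ hg.ne']
  exact hmass

theorem integral_obsKernel_right (hK : IsLinKernel K) (hg : 0 < g)
    (hmass : normMoment q L h 0 = 1) (p : Sph q × ℝ) : ∫ s, obsKernel L K h g p s ∂(cyl q) = 1 := by
  simp only [obsKernel]
  rw [integral_const_mul, integral_product_right L K h hg p, hK.integral_eq_one, mul_one,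
    mul_comm (capMoment q L h 0), ← mul_assoc, div_mul_cancel₀ _ hg.ne']
  exact hmass

/-- The integrated second moment of the contribution of one observation. -/
noncomputable def obsEnergy (q : ℕ) (L K : ℝ → ℝ) (h g : ℝ) : ℝ :=
  (normConst q L h / g) ^ 2 * (capMoment q (fun r => L r ^ 2) h 0 * (g * roughness K))

theorem integrable_obsKernel_sq_left (hL : IsBorelProfile L) (hK : IsLinKernel K) (hg : 0 < g)
    (s : Sph q × ℝ) : Integrable (fun p => obsKernel L K h g p s ^ 2) (cyl q) := by
  obtain ⟨M, hM⟩ := hL.sq.abs_le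
  simp only [obsKernel, mul_pow]
  exact (integrable_product_left hL.sq.measurable hM hK.integrable_sq h hg s).const_mul _

theorem integral_obsKernel_sq_left (hg : 0 < g) (s : Sph q × ℝ) :
    ∫ p, obsKernel L K h g p s ^ 2 ∂(cyl q) = obsEnergy q L K h g := by
  simp only [obsKernel, mul_pow]
  rw [integral_const_mul, integral_product_left (fun r => L r ^ 2) (fun v => K v ^ 2) h hg s]
  rfl

/-- Integrals of mixtures of functions with constant mass. -/
theorem integral_mixture {X : Type*} [MeasurableSpace X] {μ : Measure X} [SFinite μ] {W : X → X → ℝ}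
    {φ : X → ℝ} {A : ℝ} (hW : Measurable (Function.uncurry W)) (hW0 : ∀ p s, 0 ≤ W p s)
    (hφ : Measurable φ) (hφ0 : ∀ s, 0 ≤ φ s) (hφi : Integrable φ μ) (hφ1 : ∫ s, φ s ∂μ = 1)
    (hWφ : ∀ p, Integrable (fun s => W p s * φ s) μ)
    (hWi : ∀ s, Integrable (fun p => W p s) μ) (hWA : ∀ s, ∫ p, W p s ∂μ = A) (hA : 0 ≤ A) :
    Integrable (fun p => ∫ s, W p s * φ s ∂μ) μ ∧ ∫ p, ∫ s, W p s * φ s ∂μ ∂μ = A := by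
  have hm : Measurable (Function.uncurry fun p s => W p s * φ s) :=
    hW.mul (hφ.comp measurable_snd)
  have h0 : ∀ p, 0 ≤ ∫ s, W p s * φ s ∂μ := fun p =>
    integral_nonneg fun s => mul_nonneg (hW0 p s) (hφ0 s)
  have hlin : ∫⁻ p, ENNReal.ofReal (∫ s, W p s * φ s ∂μ) ∂μ = ENNReal.ofReal A := by
    have e1 : ∀ p, ENNReal.ofReal (∫ s, W p s * φ s ∂μ) = ∫⁻ s, ENNReal.ofReal (W p s * φ s) ∂μ :=
      fun p => ofReal_integral_eq_lintegral_ofReal (hWφ p)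
        (ae_of_all _ fun s => mul_nonneg (hW0 p s) (hφ0 s))
    simp only [e1]
    rw [lintegral_lintegral_swap hm.ennreal_ofReal.aemeasurable]
    have e2 : ∀ s, ∫⁻ p, ENNReal.ofReal (W p s * φ s) ∂μ =
        ENNReal.ofReal A * ENNReal.ofReal (φ s) := fun s => by
      rw [← hWA s, ofReal_integral_eq_lintegral_ofReal (hWi s) (ae_of_all _ fun p => hW0 p s),
        ← lintegral_mul_const' _ _ ENNReal.ofReal_ne_top]
      simp only [ENNReal.ofReal_mul (hW0 _ s)]
    simp only [e2]
    rw [lintegral_const_mul' _ _ ENNReal.ofReal_ne_top,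
      ← ofReal_integral_eq_lintegral_ofReal hφi (ae_of_all _ hφ0), hφ1, ENNReal.ofReal_one, mul_one]
  have hmeas : StronglyMeasurable fun p => ∫ s, W p s * φ s ∂μ :=
    hm.stronglyMeasurable.integral_prod_right
  refine ⟨⟨hmeas.aestronglyMeasurable, ?_⟩, ?_⟩
  · rw [hasFiniteIntegral_iff_ofReal (ae_of_all _ h0), hlin]
    exact ENNReal.ofReal_lt_top
  · rw [integral_eq_lintegral_of_nonneg_ae (ae_of_all _ h0) hmeas.aestronglyMeasurable, hlin,
      ENNReal.toReal_ofReal hA]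

/-- The moments of the contribution of one observation. -/
noncomputable def obsMoment (L K : ℝ → ℝ) (h g : ℝ) (f : Sph q × ℝ → ℝ) (k : ℕ) (p : Sph q × ℝ) : ℝ :=
  ∫ s, obsKernel L K h g p s ^ k * f s ∂(cyl q)

theorem integrable_obsKernel_pow_mul (hL : IsBorelProfile L) (hK : IsLinKernel K) (hg : 0 < g)
    (hf : Integrable f (cyl q)) (k : ℕ) (p : Sph q × ℝ) :
    Integrable (fun s => obsKernel L K h g p s ^ k * f s) (cyl q) := by
  obtain ⟨M, hM⟩ := hL.bounded
  obtain ⟨N, hN⟩ := hK.bounded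
  refine hf.bdd_mul (c := (normConst q L h / g * (M * N)) ^ k) ?_ (ae_of_all _ fun s => ?_)
  · exact ((Measurable.of_uncurry_left (measurable_obsKernel hL.measurable hK.measurable h
      g)).pow_const k).aestronglyMeasurable
  · rw [Real.norm_of_nonneg (pow_nonneg (obsKernel_nonneg hL hK hg p s) k)]
    exact pow_le_pow_left₀ (obsKernel_nonneg hL hK hg p s) (obsKernel_le hL hK hg hM hN p s) k

theorem obsEnergy_nonneg (hL : IsBorelProfile L) (hg : 0 < g) : 0 ≤ obsEnergy q L K h g :=
  mul_nonneg (sq_nonneg _) (mul_nonneg (hL.sq.capMoment_nonneg h 0)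
    (mul_nonneg hg.le (integral_nonneg fun _ => sq_nonneg _)))

theorem integral_obsMoment_one (hL : IsBorelProfile L) (hK : IsLinKernel K) (hg : 0 < g)
    (hmass : normMoment q L h 0 = 1) (hf : IsDensity f) (hfm : Measurable f) :
    Integrable (obsMoment L K h g f 1) (cyl q) ∧ ∫ p, obsMoment L K h g f 1 p ∂(cyl q) = 1 := by
  have := integral_mixture (μ := cyl q) (W := obsKernel L K h g) (φ := f) (A := 1)
    (measurable_obsKernel hL.measurable hK.measurable h g) (obsKernel_nonneg hL hK hg) hfm hf.nonneg
    hf.integrable hf.integral_eq_one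
    (fun p => by simpa using integrable_obsKernel_pow_mul hL hK hg hf.integrable 1 p)
    (integrable_obsKernel_left hL hK hg) (integral_obsKernel_left hK hg hmass) zero_le_one
  unfold obsMoment
  simpa only [pow_one] using this

theorem integral_obsMoment_two (hL : IsBorelProfile L) (hK : IsLinKernel K) (hg : 0 < g)
    (hf : IsDensity f) (hfm : Measurable f) :
    Integrable (obsMoment L K h g f 2) (cyl q) ∧
      ∫ p, obsMoment L K h g f 2 p ∂(cyl q) = obsEnergy q L K h g :=
  integral_mixture (μ := cyl q) (W := fun p s => obsKernel L K h g p s ^ 2) (φ := f)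
    ((measurable_obsKernel hL.measurable hK.measurable h g).pow_const 2) (fun _ _ => sq_nonneg _)
    hfm hf.nonneg hf.integrable hf.integral_eq_one
    (integrable_obsKernel_pow_mul hL hK hg hf.integrable 2)
    (integrable_obsKernel_sq_left hL hK hg) (integral_obsKernel_sq_left hg) (obsEnergy_nonneg hL hg)

theorem obsMoment_one_nonneg (hL : IsBorelProfile L) (hK : IsLinKernel K) (hg : 0 < g)
    (hf : ∀ s, 0 ≤ f s) (p : Sph q × ℝ) : 0 ≤ obsMoment L K h g f 1 p :=
  integral_nonneg fun s => mul_nonneg (pow_nonneg (obsKernel_nonneg hL hK hg p s) 1) (hf s)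

/-- A bound for the mean of the estimator in terms of the truncated density. -/
theorem obsMoment_one_le (hL : IsBorelProfile L) (hK : IsLinKernel K) (hg : 0 < g)
    (hmass : normMoment q L h 0 = 1) {M N : ℝ} (hM : ∀ r, L r ≤ M) (hN : ∀ v, K v ≤ N)
    (hf : Integrable f (cyl q)) {B : ℝ} (hB : 0 ≤ B) (hf0 : ∀ s, 0 ≤ f s) (p : Sph q × ℝ) :
    obsMoment L K h g f 1 p ≤
      B + normConst q L h / g * (M * N) * ∫ s, max (f s - B) 0 ∂(cyl q) := by
  have hmax : Integrable (fun s => max (f s - B) 0) (cyl q) := by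
    refine hf.mono' ((hf.1.aemeasurable.sub_const B).max aemeasurable_const).aestronglyMeasurable
      (ae_of_all _ fun s => ?_)
    rw [Real.norm_of_nonneg (le_max_right _ _)]
    exact max_le (by linarith) (hf0 s)
  have h1 := (integrable_obsKernel_right (h := h) hL hK hg p).const_mul B
  have h2 : Integrable (fun s => normConst q L h / g * (M * N) * max (f s - B) 0) (cyl q) :=
    hmax.const_mul _
  -- The density is bounded by `B + (f - B)⁺`. Against `B` the kernel has mass one, and against the
  -- excess it is replaced by its supremum bound.
  calc obsMoment L K h g f 1 p ≤ ∫ s, (B * obsKernel L K h g p s +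
        normConst q L h / g * (M * N) * max (f s - B) 0) ∂(cyl q) := by
        refine integral_mono (integrable_obsKernel_pow_mul hL hK hg hf 1 p) (h1.add h2) fun s => ?_
        have k0 := obsKernel_nonneg (h := h) hL hK hg p s
        have k1 := obsKernel_le (h := h) hL hK hg hM hN p s
        have m0 : 0 ≤ max (f s - B) 0 := le_max_right _ _
        have m1 : f s ≤ B + max (f s - B) 0 := by linarith [le_max_left (f s - B) 0]
        simp only [pow_one]
        nlinarith [mul_le_mul_of_nonneg_left m1 k0, mul_le_mul_of_nonneg_right k1 m0]
    _ = _ := by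
        rw [integral_add h1 h2, integral_const_mul, integral_const_mul,
          integral_obsKernel_right hK hg hmass p, mul_one]

theorem tendsto_integral_excess (hf : Integrable f (cyl q)) (hf0 : ∀ s, 0 ≤ f s) :
    Tendsto (fun n : ℕ => ∫ s, max (f s - n) 0 ∂(cyl q)) atTop (𝓝 0) := by
  have := tendsto_integral_of_dominated_convergence (μ := cyl q)
    (F := fun (n : ℕ) s => max (f s - n) 0) (f := fun _ => 0) f
    (fun n => ((hf.1.aemeasurable.sub_const (n : ℝ)).max aemeasurable_const).aestronglyMeasurable) hf
    (fun n => ae_of_all _ fun s => by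
      rw [Real.norm_of_nonneg (le_max_right _ _)]
      exact max_le (by linarith [(Nat.cast_nonneg n : (0 : ℝ) ≤ n)]) (hf0 s))
    (ae_of_all _ fun s => by
      refine tendsto_const_nhds.congr' ?_
      filter_upwards [eventually_ge_atTop ⌈f s⌉₊] with n hn
      have : f s ≤ n := Nat.ceil_le.1 hn
      rw [max_eq_right (by linarith)])
  simpa using this

theorem integral_obsKernel_section (hg : 0 < g) (p : Sph q × ℝ) (y : Sph q) :
    ∫ t, obsKernel L K h g p (y, t) ^ 1 * f (y, t) = normConst q L h *
      (L ((1 - inner ℝ (p.1 : Amb q) (y : Amb q)) / h ^ 2) * linAvg K g f (y, p.2)) := by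
  simp only [obsKernel, pow_one]
  set c := L ((1 - inner ℝ (p.1 : Amb q) (y : Amb q)) / h ^ 2)
  -- The substitution `t = z - g v`, as a reflected translation followed by a scaling.
  have e : ∫ v, K v * f (y, p.2 - g * v) = g⁻¹ * ∫ t, K ((p.2 - t) / g) * f (y, t) := by
    have h1 := integral_sub_left_eq_self (fun t => K ((p.2 - t) / g) * f (y, t)) volume p.2
    have h2 := Measure.integral_comp_mul_left
      (fun w => K ((p.2 - (p.2 - w)) / g) * f (y, p.2 - w)) g
    simp only [sub_sub_cancel] at h1 h2
    rw [h1, abs_of_pos (inv_pos.2 hg), smul_eq_mul] at h2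
    rw [← h2]
    refine integral_congr_ae (ae_of_all _ fun v => ?_)
    simp only []
    rw [mul_div_cancel_left₀ _ hg.ne']
  rw [linAvg, e, ← integral_const_mul, ← integral_const_mul, ← integral_const_mul]
  refine integral_congr_ae (ae_of_all _ fun t => ?_)
  simp only []
  ring

theorem integrable_dirAvg_linAvg (hL : IsBorelProfile L) (hK : IsLinKernel K) (hg : 0 < g)
    (hf : Integrable f (cyl q)) (p : Sph q × ℝ) :
    Integrable (fun y : Sph q => normConst q L h *
      (L ((1 - inner ℝ (p.1 : Amb q) (y : Amb q)) / h ^ 2) * linAvg K g f (y, p.2))) (surf q) := by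
  have := (integrable_obsKernel_pow_mul (h := h) hL hK hg hf 1 p).integral_prod_left
  simpa only [integral_obsKernel_section hg] using this

/-- The mean of the estimator is the smoothed density. -/
theorem obsMoment_one_eq (hL : IsBorelProfile L) (hK : IsLinKernel K) (hg : 0 < g)
    (hf : Integrable f (cyl q)) (p : Sph q × ℝ) :
    obsMoment L K h g f 1 p = dirAvg L h (linAvg K g f) p := by
  have h1 := integral_prod _ (integrable_obsKernel_pow_mul (h := h) hL hK hg hf 1 p)
  rw [obsMoment, cyl, h1, dirAvg, ← integral_const_mul]
  exact integral_congr_ae (ae_of_all _ fun y => integral_obsKernel_section hg p y)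

end ObservationKernel

end DirLin

namespace DirLin
open scoped ENNReal Real

/-! ### Bias of the estimator and decomposition of the MISE. -/

section MeanSquare

variable {q : ℕ} {L K : ℝ → ℝ} {h g : ℝ} {f : Sph q × ℝ → ℝ}

theorem integrable_dirAvg_continuous (hL : IsBorelProfile L) (h : ℝ) {u : Sph q × ℝ → ℝ}
    (hu : Continuous u) (p : Sph q × ℝ) :
    Integrable (fun y : Sph q => normConst q L h *
      (L ((1 - inner ℝ (p.1 : Amb q) (y : Amb q)) / h ^ 2) * u (y, p.2))) (surf q) := by
  obtain ⟨M, hM⟩ := hL.abs_le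
  have hLm := hL.measurable
  have hc : Continuous fun y : Sph q => u (y, p.2) := by fun_prop
  refine Integrable.const_mul ?_ _
  refine (hc.integrable_of_hasCompactSupport (HasCompactSupport.of_compactSpace _)).bdd_mul (c := M)
    (by fun_prop : Measurable fun y : Sph q =>
      L ((1 - inner ℝ (p.1 : Amb q) (y : Amb q)) / h ^ 2)).aestronglyMeasurable
    (ae_of_all _ fun y => hM _)

/-- The leading term of the bias. -/
noncomputable def biasMain (L K : ℝ → ℝ) (f : Sph q × ℝ → ℝ) (h g : ℝ) (p : Sph q × ℝ) : ℝ :=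
  h ^ 2 * bConst q L * psiX f p + 1 / 2 * mu2 K * g ^ 2 * hessZ f p

/-- The linear expansion is inserted inside the directional smoothing. Since that smoothing
contracts `L²`, the error of the linear step passes through it, and the main linear term has to be
compared only with its own smoothed version. -/
theorem obsMoment_sub_eq (hf : SmoothDensity f) (hfi : Integrable f (cyl q)) (hL : IsBorelProfile L)
    (hK : IsLinKernel K) (hg : 0 < g) (p : Sph q × ℝ) :
    obsMoment L K h g f 1 p - f p - biasMain L K f h g p =
      dirAvg L h (fun p => linAvg K g f p - f p - 1 / 2 * mu2 K * g ^ 2 * hessZ f p) p +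
        ((dirAvg L h f p - f p - h ^ 2 * bConst q L * psiX f p) +
        1 / 2 * mu2 K * g ^ 2 * (dirAvg L h (hessZ f) p - hessZ f p)) := by
  set c := 1 / 2 * mu2 K * g ^ 2 with hc
  have i1 := integrable_dirAvg_linAvg (h := h) hL hK hg hfi p
  have i2 := integrable_dirAvg_continuous hL h hf.continuous p
  have i3 := (integrable_dirAvg_continuous hL h hf.continuous_hessZ p).const_mul c
  have e : dirAvg L h (fun p => linAvg K g f p - f p - c * hessZ f p) p =
      dirAvg L h (linAvg K g f) p - dirAvg L h f p - c * dirAvg L h (hessZ f) p := by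
    simp only [dirAvg, ← integral_const_mul]
    have i12 : Integrable (fun y : Sph q => normConst q L h *
      (L ((1 - inner ℝ (p.1 : Amb q) (y : Amb q)) / h ^ 2) * linAvg K g f (y, p.2)) - normConst q L h *
      (L ((1 - inner ℝ (p.1 : Amb q) (y : Amb q)) / h ^ 2) * f (y, p.2))) (surf q) := i1.sub i2
    rw [← integral_sub i1 i2, ← integral_sub i12 i3]
    refine integral_congr_ae (ae_of_all _ fun y => ?_)
    simp only []
    ring
  rw [e, obsMoment_one_eq hL hK hg hfi, biasMain]
  ring

theorem measurable_obsMoment (hL : Measurable L) (hK : Measurable K) (hf : Measurable f) (h g : ℝ)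
    (k : ℕ) : Measurable (obsMoment L K h g f k) := by
  have : Measurable (Function.uncurry fun p s => obsKernel L K h g p s ^ k * f s) :=
    ((measurable_obsKernel hL hK h g).pow_const k).mul (hf.comp measurable_snd)
  exact this.stronglyMeasurable.integral_prod_right.measurable

/-- The bias of the estimator, in mean square. -/
theorem sqInt_bias_remainder_le {f : Sph (q + 1) × ℝ → ℝ} (hf : SmoothDensity f)
    (hfi : Integrable f (cyl (q + 1))) (hL : IsBorelProfile L) (hpos : 0 < profMoment q L 0)
    (hK : IsLinKernel K) {h g : ℕ → ℝ} (hh : Tendsto h atTop (𝓝[>] 0)) (hg : Tendsto g atTop (𝓝[>] 0))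
    {ε : ℝ} (hε : 0 < ε) :
    ∀ᶠ n in atTop, sqInt (cyl (q + 1)) (fun p => obsMoment L K (h n) (g n) f 1 p - f p -
      biasMain L K f (h n) (g n) p) ≤ ENNReal.ofReal (ε * (h n ^ 4 + g n ^ 4)) := by
  set c := mu2 K with hc
  -- In the final sum the last term is `c² ε₂ g⁴`, which becomes at most `(ε / 2) g⁴`.
  set ε₂ := ε / (2 * (c ^ 2 + 1)) with hε₂
  have hε₂0 : 0 < ε₂ := by positivity
  have hε4 : 0 < ε / 4 := by positivity
  filter_upwards [hh.eventually (dirAvg_sub_isLittleO hf hL hpos hε4),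
    hg.eventually (linAvg_sub_isLittleO hf hfi hK hε4),
    hh.eventually (dirAvg_sub_tendsto hf.continuous_hessZ hf.memLp_hessZ hL hpos hε₂0),
    hh.eventually (eventually_normMoment_zero hL q hpos), hg.eventually self_mem_nhdsWithin]
    with n h1 h2 h3 hmass hgn
  have hgn : 0 < g n := hgn
  have hfm := hf.continuous.measurable
  have hHm := hf.continuous_hessZ.measurable
  have hψm := hf.continuous_psiX.measurable
  have m1 : Measurable fun p => linAvg K (g n) f p - f p - 1 / 2 * c * g n ^ 2 * hessZ f p := by
    have := measurable_linAvg hK.measurable (g n) hfm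
    fun_prop
  have m2 : Measurable fun p => dirAvg L (h n) f p - f p - h n ^ 2 * bConst (q + 1) L * psiX f p := by
    have := measurable_dirAvg hL (h n) hfm
    fun_prop
  have a1 := (sqInt_dirAvg_le hL hmass m1).trans h2
  simp only [obsMoment_sub_eq hf hfi hL hK hgn]
  have s1 := sqInt_add_le (cyl (q + 1))
    (φ := dirAvg L (h n) (fun p => linAvg K (g n) f p - f p - 1 / 2 * c * g n ^ 2 * hessZ f p))
    (ψ := fun p => (dirAvg L (h n) f p - f p - h n ^ 2 * bConst (q + 1) L * psiX f p) +
        1 / 2 * c * g n ^ 2 * (dirAvg L (h n) (hessZ f) p - hessZ f p))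
    (measurable_dirAvg hL _ m1).aemeasurable
  have s2 := sqInt_add_le (cyl (q + 1))
    (φ := fun p => dirAvg L (h n) f p - f p - h n ^ 2 * bConst (q + 1) L * psiX f p)
    (ψ := fun p => 1 / 2 * c * g n ^ 2 * (dirAvg L (h n) (hessZ f) p - hessZ f p)) m2.aemeasurable
  rw [sqInt_const_mul] at s2
  refine s1.trans ?_
  have hh4 : 0 ≤ h n ^ 4 := by positivity
  have hg4 : 0 ≤ g n ^ 4 := by positivity
  calc _ ≤ 2 * ENNReal.ofReal (ε / 4 * g n ^ 4) + 2 * (2 * ENNReal.ofReal (ε / 4 * h n ^ 4) +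
        2 * (ENNReal.ofReal ((1 / 2 * c * g n ^ 2) ^ 2) * ENNReal.ofReal ε₂)) := by
        refine add_le_add (mul_le_mul_right a1 2) (mul_le_mul_right (s2.trans ?_) 2)
        exact add_le_add (mul_le_mul_right h1 2) (mul_le_mul_right (mul_le_mul_right h3 _) 2)
    _ = ENNReal.ofReal (2 * (ε / 4 * g n ^ 4) + 2 * (2 * (ε / 4 * h n ^ 4) +
        2 * ((1 / 2 * c * g n ^ 2) ^ 2 * ε₂))) := by
        have e2 : (2 : ℝ≥0∞) = ENNReal.ofReal 2 := by simp
        rw [e2, ENNReal.ofReal_add (by positivity) (by positivity),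
          ENNReal.ofReal_mul zero_le_two, ENNReal.ofReal_mul zero_le_two,
          ENNReal.ofReal_add (by positivity) (by positivity), ENNReal.ofReal_mul zero_le_two,
          ENNReal.ofReal_mul zero_le_two, ENNReal.ofReal_mul (sq_nonneg _)]
    _ ≤ _ := by
        apply ENNReal.ofReal_le_ofReal
        have : c ^ 2 * ε₂ ≤ ε / 2 := by
          rw [hε₂, ← mul_div_assoc, div_le_iff₀ (by positivity)]
          nlinarith
        have h5 : 2 * (2 * ((1 / 2 * c * g n ^ 2) ^ 2 * ε₂)) = c ^ 2 * ε₂ * g n ^ 4 := by ring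
        nlinarith [mul_le_mul_of_nonneg_right this hg4]

/-- The cross term is absorbed by `2ab ≤ η a² + η⁻¹ b²`. The parameter `η` can be fixed before the
smallness of `e` is chosen, which lets a remainder that is small in mean square perturb the squared
bias by little. -/
theorem abs_integral_add_sq_sub_le {X : Type*} [MeasurableSpace X] {μ : Measure X} {m e : X → ℝ}
    (hm : MemLp m 2 μ) (he : MemLp e 2 μ) {η : ℝ} (hη : 0 < η) :
    |∫ x, (m x + e x) ^ 2 ∂μ - ∫ x, m x ^ 2 ∂μ| ≤
      η * ∫ x, m x ^ 2 ∂μ + (1 + η⁻¹) * ∫ x, e x ^ 2 ∂μ := by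
  have i1 : Integrable (fun x => (m x + e x) ^ 2) μ := (hm.add he).integrable_sq
  have i2 := hm.integrable_sq
  have i3 := he.integrable_sq
  have i4 : Integrable (fun x => η * m x ^ 2) μ := i2.const_mul _
  have i5 : Integrable (fun x => (1 + η⁻¹) * e x ^ 2) μ := i3.const_mul _
  rw [← integral_sub i1 i2, ← integral_const_mul, ← integral_const_mul, ← integral_add i4 i5,
    ← Real.norm_eq_abs]
  refine norm_integral_le_of_norm_le (i4.add i5) (ae_of_all _ fun x => ?_)
  simp only [Real.norm_eq_abs]
  have hxy : ∀ a b : ℝ, 2 * a * b ≤ η * a ^ 2 + η⁻¹ * b ^ 2 := fun a b => by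
    have : η * a ^ 2 + η⁻¹ * b ^ 2 - 2 * a * b = η⁻¹ * (η * a - b) ^ 2 := by field_simp; ring
    have : 0 ≤ η⁻¹ * (η * a - b) ^ 2 := by positivity
    linarith
  rw [abs_le]
  constructor
  · have := hxy (m x) (-e x)
    nlinarith [sq_nonneg (e x)]
  · have := hxy (m x) (e x)
    nlinarith [sq_nonneg (e x)]

theorem memLp_biasMain (hf : SmoothDensity f) (L K : ℝ → ℝ) (h g : ℝ) :
    MemLp (biasMain L K f h g) 2 (cyl q) :=
  (hf.memLp_psiX.const_mul _).add (hf.memLp_hessZ.const_mul _)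

theorem integral_biasMain_sq (hf : SmoothDensity f) (L K : ℝ → ℝ) (h g : ℝ) :
    ∫ p, biasMain L K f h g p ^ 2 ∂(cyl q) =
      bConst q L ^ 2 * cylInt (fun p => psiX f p ^ 2) * h ^ 4
          + 1 / 4 * mu2 K ^ 2 * cylInt (fun p => hessZ f p ^ 2) * g ^ 4
          + bConst q L * mu2 K * cylInt (fun p => psiX f p * hessZ f p) * (h ^ 2 * g ^ 2) := by
  have i1 := hf.memLp_psiX.integrable_sq.const_mul (bConst q L ^ 2 * h ^ 4)
  have i2 := hf.memLp_hessZ.integrable_sq.const_mul (1 / 4 * mu2 K ^ 2 * g ^ 4)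
  have i3 : Integrable (fun p => bConst q L * mu2 K * (h ^ 2 * g ^ 2) * (psiX f p * hessZ f p)) (cyl q) :=
    (hf.memLp_psiX.integrable_mul hf.memLp_hessZ).const_mul _
  have e : ∀ p, biasMain L K f h g p ^ 2 = bConst q L ^ 2 * h ^ 4 * psiX f p ^ 2 +
      1 / 4 * mu2 K ^ 2 * g ^ 4 * hessZ f p ^ 2 +
      bConst q L * mu2 K * (h ^ 2 * g ^ 2) * (psiX f p * hessZ f p) := fun p => by
    rw [biasMain]; ring
  have i12 : Integrable (fun p => bConst q L ^ 2 * h ^ 4 * psiX f p ^ 2 +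
      1 / 4 * mu2 K ^ 2 * g ^ 4 * hessZ f p ^ 2) (cyl q) := i1.add i2
  simp only [e]
  rw [integral_add i12 i3, integral_add i1 i2, integral_const_mul, integral_const_mul,
    integral_const_mul]
  simp only [cylInt]
  ring

/-- The mean squared error at a point. -/
theorem lintegral_estimator_sub_sq {Ω : Type*} [MeasurableSpace Ω] (P : Measure Ω)
    [IsProbabilityMeasure P] {S : ℕ → Ω → Sph q × ℝ} (hS : ∀ i, Measurable (S i))
    (hind : iIndepFun S P) (hlaw : ∀ i, P.map (S i) = law f) (hL : IsBorelProfile L)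
    (hK : IsLinKernel K) (hg : 0 < g) (hf0 : ∀ p, 0 ≤ f p) (hfm : Measurable f)
    {n : ℕ} (hn : n ≠ 0) (p : Sph q × ℝ) :
    obsMoment L K h g f 1 p ^ 2 ≤ obsMoment L K h g f 2 p ∧
    ∫⁻ ω, ENNReal.ofReal ((estimator L K h g n (fun i => S i ω) p - f p) ^ 2) ∂P =
      ENNReal.ofReal ((obsMoment L K h g f 2 p - obsMoment L K h g f 1 p ^ 2) / n +
        (obsMoment L K h g f 1 p - f p) ^ 2) := by
  obtain ⟨M, hM⟩ := hL.bounded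
  obtain ⟨N, hN⟩ := hK.bounded
  have hWm : Measurable fun s => obsKernel L K h g p s :=
    Measurable.of_uncurry_left (measurable_obsKernel hL.measurable hK.measurable h g)
  set X : ℕ → Ω → ℝ := fun i ω => obsKernel L K h g p (S i ω) with hX
  have hXm : ∀ i, Measurable (X i) := fun i => hWm.comp (hS i)
  have hX2 : ∀ i, MemLp (X i) 2 P := fun i =>
    MemLp.of_bound (hXm i).aestronglyMeasurable (normConst q L h / g * (M * N)) (ae_of_all _ fun ω => by
      rw [Real.norm_of_nonneg (obsKernel_nonneg hL hK hg p _)]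
      exact obsKernel_le hL hK hg hM hN p _)
  have hmom : ∀ i k, ∫ ω, X i ω ^ k ∂P = obsMoment L K h g f k p := fun i k => by
    have h1 := integral_map (hS i).aemeasurable (μ := P) (f := fun s => obsKernel L K h g p s ^ k)
      (hWm.pow_const k).aestronglyMeasurable
    rw [hlaw i, law, integral_withDensity_eq_integral_toReal_smul hfm.ennreal_ofReal
      (ae_of_all _ fun _ => ENNReal.ofReal_lt_top)] at h1
    simp only [hX]
    rw [← h1, obsMoment]
    refine integral_congr_ae (ae_of_all _ fun s => ?_)
    simp only [smul_eq_mul]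
    rw [ENNReal.toReal_ofReal (hf0 s), mul_comm]
  set E1 := obsMoment L K h g f 1 p with hE1
  set E2 := obsMoment L K h g f 2 p with hE2
  have hmean : ∀ i, ∫ ω, X i ω ∂P = E1 := fun i => by simpa using hmom i 1
  have hvar : ∀ i, Var[X i; P] = E2 - E1 ^ 2 := fun i => by
    have h2 : ∫ ω, (X i ^ 2) ω ∂P = E2 := hmom i 2
    rw [variance_eq_sub (hX2 i), hmean i, h2]
  -- The nonnegative variance of one observation gives the comparison of the two moments, needed
  -- later to dominate the square of the mean.
  refine ⟨by have := variance_nonneg (X 0) P; rw [hvar 0] at this; linarith, ?_⟩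
  have hindX : iIndepFun X P := hind.comp (fun _ s => obsKernel L K h g p s) fun _ => hWm
  have hn' : (n : ℝ) ≠ 0 := Nat.cast_ne_zero.2 hn
  set T : Ω → ℝ := ∑ i ∈ Finset.range n, X i with hT
  have hT2 : MemLp T 2 P := memLp_finsetSum' _ fun i _ => hX2 i
  have hTvar : Var[T; P] = n * (E2 - E1 ^ 2) := by
    rw [hT, IndepFun.variance_sum (fun i _ => hX2 i) fun i _ j _ hij => hindX.indepFun hij]
    simp only [hvar, Finset.sum_const, Finset.card_range, nsmul_eq_mul]
  have hTmean : ∫ ω, T ω ∂P = n * E1 := by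
    simp only [hT, Finset.sum_apply]
    rw [integral_finsetSum _ fun i _ => (hX2 i).integrable one_le_two]
    simp [hmean]
  set Y : Ω → ℝ := fun ω => (n : ℝ)⁻¹ * T ω - f p with hY
  have hY2 : MemLp Y 2 P := (hT2.const_mul _).sub (memLp_const _)
  have hYe : ∀ ω, estimator L K h g n (fun i => S i ω) p - f p = Y ω := fun ω => by
    simp only [estimator, hY, hT, hX, Finset.sum_apply, obsKernel, Finset.mul_sum]
    congr 1
    refine Finset.sum_congr rfl fun i _ => ?_
    field_simp
  have hYmean : ∫ ω, Y ω ∂P = E1 - f p := by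
    simp only [hY]
    rw [integral_sub ((hT2.integrable one_le_two).const_mul _) (integrable_const _),
      integral_const_mul, hTmean, inv_mul_cancel_left₀ hn']
    simp
  have hYvar : Var[Y; P] = (E2 - E1 ^ 2) / n := by
    rw [hY, variance_sub_const (hT2.1.const_mul _), variance_const_mul, hTvar]
    field_simp
  have hYsq : ∫ ω, Y ω ^ 2 ∂P = (E2 - E1 ^ 2) / n + (E1 - f p) ^ 2 := by
    have := variance_eq_sub hY2
    rw [hYvar, hYmean] at this
    simp only [Pi.pow_apply] at this
    linarith
  simp only [hYe]
  rw [← hYsq, ofReal_integral_eq_lintegral_ofReal hY2.integrable_sq (ae_of_all _ fun ω => sq_nonneg _)]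

/-- The decomposition of the mean integrated squared error into variance and squared bias. -/
theorem dlMise_eq {Ω : Type*} [MeasurableSpace Ω] (P : Measure Ω)
    [IsProbabilityMeasure P] {S : ℕ → Ω → Sph q × ℝ} (hS : ∀ i, Measurable (S i))
    (hind : iIndepFun S P) (hlaw : ∀ i, P.map (S i) = law f) (hL : IsBorelProfile L)
    (hK : IsLinKernel K) (hg : 0 < g) (hf : IsDensity f) (hfm : Measurable f)
    {n : ℕ} (hn : n ≠ 0) (hbias : MemLp (fun p => obsMoment L K h g f 1 p - f p) 2 (cyl q)) :
    dlMise P S f L K h g n ≠ ⊤ ∧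
    (dlMise P S f L K h g n).toReal = (obsEnergy q L K h g -
      ∫ p, obsMoment L K h g f 1 p ^ 2 ∂(cyl q)) / n +
        ∫ p, (obsMoment L K h g f 1 p - f p) ^ 2 ∂(cyl q) := by
  have hpt := lintegral_estimator_sub_sq (h := h) P hS hind hlaw hL hK hg hf.nonneg hfm hn
  obtain ⟨i2, hi2⟩ := integral_obsMoment_two (h := h) hL hK hg hf hfm
  -- Without square integrability of `f`, the square of the mean is integrable because the second
  -- moment dominates it, and the integral of the latter is finite by Tonelli.
  have i1 : Integrable (fun p => obsMoment L K h g f 1 p ^ 2) (cyl q) :=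
    i2.mono' ((measurable_obsMoment hL.measurable hK.measurable hfm h g
      1).pow_const 2).aestronglyMeasurable (ae_of_all _ fun p => by
        rw [Real.norm_of_nonneg (sq_nonneg _)]; exact (hpt p).1)
  have i3 := hbias.integrable_sq
  have i4 : Integrable (fun p => (obsMoment L K h g f 2 p - obsMoment L K h g f 1 p ^ 2) / n) (cyl q) :=
    (i2.sub i1).div_const _
  have i5 : Integrable (fun p => (obsMoment L K h g f 2 p - obsMoment L K h g f 1 p ^ 2) / n +
      (obsMoment L K h g f 1 p - f p) ^ 2) (cyl q) := i4.add i3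
  have h0 : ∀ p, 0 ≤ (obsMoment L K h g f 2 p - obsMoment L K h g f 1 p ^ 2) / n +
      (obsMoment L K h g f 1 p - f p) ^ 2 := fun p => add_nonneg
    (div_nonneg (sub_nonneg.2 (hpt p).1) (Nat.cast_nonneg n)) (sq_nonneg _)
  have e : dlMise P S f L K h g n = ENNReal.ofReal (∫ p, ((obsMoment L K h g f 2 p -
      obsMoment L K h g f 1 p ^ 2) / n + (obsMoment L K h g f 1 p - f p) ^ 2) ∂(cyl q)) := by
    simp only [dlMise, mise, (hpt _).2]
    rw [← ofReal_integral_eq_lintegral_ofReal i5 (ae_of_all _ h0)]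
  refine ⟨by rw [e]; exact ENNReal.ofReal_ne_top, ?_⟩
  rw [e, ENNReal.toReal_ofReal (integral_nonneg h0), integral_add i4 i3, integral_div,
    integral_sub i2 i1, hi2]

end MeanSquare

end DirLin

namespace DirLin
open scoped ENNReal Real

/-! ### Assembly of the expansion for a Borel profile. -/

section Expansion

variable {q : ℕ} {L K : ℝ → ℝ} {h g : ℕ → ℝ}

theorem dConst_eq (q : ℕ) (L : ℝ → ℝ) :
    dConst (q + 1) L = profMoment q (fun r => L r ^ 2) 0 / profMoment q L 0 := by
  simp [dConst, profMoment]

theorem tendsto_normConst_mul_capMoment_sq (hL : IsBorelProfile L) (hpos : 0 < profMoment q L 0) :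
    Tendsto (fun h : ℝ => normConst (q + 1) L h * capMoment (q + 1) (fun r => L r ^ 2) h 0) (𝓝[>] 0)
      (𝓝 (dConst (q + 1) L)) := by
  have h1 := (tendsto_normConst_mul hL q hpos).mul (tendsto_capMoment_zero hL.sq q)
  have e : (capConst q * profMoment q L 0)⁻¹ * (capConst q * profMoment q (fun r => L r ^ 2) 0) =
      dConst (q + 1) L := by
    have := (capConst_pos q).ne'
    rw [dConst_eq]
    field_simp
  rw [e] at h1
  refine h1.congr' ?_
  filter_upwards [self_mem_nhdsWithin] with h hh
  have hh : h ≠ 0 := (Set.mem_Ioi.1 hh).ne'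
  field_simp

theorem IsBandwidth.h_tendsto_pos {q : ℕ} (hb : IsBandwidth q h g) : Tendsto h atTop (𝓝[>] 0) :=
  tendsto_nhdsWithin_iff.2 ⟨hb.h_tendsto, Eventually.of_forall hb.h_pos⟩

theorem IsBandwidth.g_tendsto_pos {q : ℕ} (hb : IsBandwidth q h g) : Tendsto g atTop (𝓝[>] 0) :=
  tendsto_nhdsWithin_iff.2 ⟨hb.g_tendsto, Eventually.of_forall hb.g_pos⟩

variable {f : Sph (q + 1) × ℝ → ℝ}

/-- The integrated squared bias. -/
theorem integrated_bias_sq (hf : SmoothDensity f) (hfi : Integrable f (cyl (q + 1)))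
    (hL : IsBorelProfile L) (hpos : 0 < profMoment q L 0) (hK : IsLinKernel K)
    (hh : Tendsto h atTop (𝓝[>] 0)) (hg : Tendsto g atTop (𝓝[>] 0)) {c : ℝ} (hc : 0 < c) :
    ∀ᶠ n in atTop, MemLp (fun p => obsMoment L K (h n) (g n) f 1 p - f p) 2 (cyl (q + 1)) ∧
      |∫ p, (obsMoment L K (h n) (g n) f 1 p - f p) ^ 2 ∂(cyl (q + 1)) -
        ∫ p, biasMain L K f (h n) (g n) p ^ 2 ∂(cyl (q + 1))| ≤ c * (h n ^ 4 + g n ^ 4) := by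
  set α := |bConst (q + 1) L ^ 2 * cylInt (fun p => psiX f p ^ 2)| with hα
  set β := |1 / 4 * mu2 K ^ 2 * cylInt (fun p => hessZ f p ^ 2)| with hβ
  set γ := |bConst (q + 1) L * mu2 K * cylInt (fun p => psiX f p * hessZ f p)| with hγ
  have hα0 : 0 ≤ α := abs_nonneg _
  have hβ0 : 0 ≤ β := abs_nonneg _
  have hγ0 : 0 ≤ γ := abs_nonneg _
  -- Half of `c` goes to the main term, through `η (α + β + γ) ≤ c / 2`; the other half fixes `ε` by
  -- `(1 + η⁻¹) ε = c / 2`.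
  set η := c / (2 * (α + β + γ + 1)) with hη
  have hη0 : 0 < η := by positivity
  set ε := c / (2 * (1 + η⁻¹)) with hε
  have hε0 : 0 < ε := by positivity
  filter_upwards [sqInt_bias_remainder_le hf hfi hL hpos hK hh hg hε0,
    hg.eventually self_mem_nhdsWithin] with n hn hgn
  have hgn : 0 < g n := hgn
  set m := biasMain L K f (h n) (g n)
  set e : Sph (q + 1) × ℝ → ℝ := fun p => obsMoment L K (h n) (g n) f 1 p - f p - m p with he
  have hm : MemLp m 2 (cyl (q + 1)) := memLp_biasMain hf L K (h n) (g n)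
  have hmeas : AEStronglyMeasurable e (cyl (q + 1)) :=
    (((measurable_obsMoment hL.measurable hK.measurable hf.continuous.measurable (h n) (g n)
      1).sub hf.continuous.measurable).aestronglyMeasurable).sub hm.1
  have he2 : MemLp e 2 (cyl (q + 1)) :=
    (memLp_two_iff_sqInt hmeas).2 (hn.trans_lt ENNReal.ofReal_lt_top)
  have hG : 0 ≤ h n ^ 4 + g n ^ 4 := by positivity
  have heI : ∫ p, e p ^ 2 ∂(cyl (q + 1)) ≤ ε * (h n ^ 4 + g n ^ 4) := by
    rw [MemLp.sqInt_eq_ofReal he2] at hn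
    exact (ENNReal.ofReal_le_ofReal_iff (by positivity)).1 hn
  have hmI : ∫ p, m p ^ 2 ∂(cyl (q + 1)) ≤ (α + β + γ) * (h n ^ 4 + g n ^ 4) := by
    rw [integral_biasMain_sq hf]
    have h4 : 0 ≤ h n ^ 4 := by positivity
    have g4 : 0 ≤ g n ^ 4 := by positivity
    have hg2 : 0 ≤ h n ^ 2 * g n ^ 2 := by positivity
    have hle : h n ^ 2 * g n ^ 2 ≤ h n ^ 4 + g n ^ 4 := by nlinarith [sq_nonneg (h n ^ 2 - g n ^ 2)]
    have a1 := mul_le_mul_of_nonneg_right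
      (le_abs_self (bConst (q + 1) L ^ 2 * cylInt (fun p => psiX f p ^ 2))) h4
    have a2 := mul_le_mul_of_nonneg_right
      (le_abs_self (1 / 4 * mu2 K ^ 2 * cylInt (fun p => hessZ f p ^ 2))) g4
    have a3 := mul_le_mul_of_nonneg_right
      (le_abs_self (bConst (q + 1) L * mu2 K * cylInt (fun p => psiX f p * hessZ f p))) hg2
    rw [← hα] at a1
    rw [← hβ] at a2
    rw [← hγ] at a3
    have b1 : α * h n ^ 4 ≤ α * (h n ^ 4 + g n ^ 4) := by gcongr; linarith
    have b2 : β * g n ^ 4 ≤ β * (h n ^ 4 + g n ^ 4) := by gcongr; linarith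
    have b3 : γ * (h n ^ 2 * g n ^ 2) ≤ γ * (h n ^ 4 + g n ^ 4) := by gcongr
    linarith
  have hsum : (fun p => obsMoment L K (h n) (g n) f 1 p - f p) = fun p => m p + e p := by
    ext p; simp only [he]; ring
  have hmem : MemLp (fun p => obsMoment L K (h n) (g n) f 1 p - f p) 2 (cyl (q + 1)) := by
    rw [hsum]; exact hm.add he2
  refine ⟨hmem, ?_⟩
  have hsq : ∫ p, (obsMoment L K (h n) (g n) f 1 p - f p) ^ 2 ∂(cyl (q + 1)) =
      ∫ p, (m p + e p) ^ 2 ∂(cyl (q + 1)) := by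
    simp only [congrFun hsum]
  rw [hsq]
  refine (abs_integral_add_sq_sub_le hm he2 hη0).trans ?_
  have c1 : η * (α + β + γ) ≤ c / 2 := by
    rw [hη, div_mul_eq_mul_div, div_le_div_iff₀ (by positivity) (by positivity)]
    nlinarith
  have c2 : (1 + η⁻¹) * ε = c / 2 := by
    rw [hε]
    have : 1 + η⁻¹ ≠ 0 := by positivity
    field_simp
  have hη1 : 0 ≤ 1 + η⁻¹ := by positivity
  calc _ ≤ η * ((α + β + γ) * (h n ^ 4 + g n ^ 4)) + (1 + η⁻¹) * (ε * (h n ^ 4 + g n ^ 4)) := by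
        gcongr
    _ = (η * (α + β + γ) + (1 + η⁻¹) * ε) * (h n ^ 4 + g n ^ 4) := by ring
    _ ≤ _ := by
        apply mul_le_mul_of_nonneg_right _ hG
        linarith

/-- The integrated variance without its centring. -/
theorem integrated_energy (hL : IsBorelProfile L) (hpos : 0 < profMoment q L 0) (K : ℝ → ℝ)
    (hb : IsBandwidth (q + 1) h g) {c : ℝ} (hc : 0 < c) :
    ∀ᶠ n : ℕ in atTop, |obsEnergy (q + 1) L K (h n) (g n) / n -
      normConst (q + 1) L (h n) / (n * g n) * dConst (q + 1) L * roughness K| ≤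
        c * ((n : ℝ) * h n ^ (q + 1) * g n)⁻¹ := by
  have h1 := (tendsto_normConst_mul hL q hpos).comp hb.h_tendsto_pos
  have h2 := (tendsto_normConst_mul_capMoment_sq hL hpos).comp hb.h_tendsto_pos
  -- The error relative to `(n h^(q+1) g)⁻¹` is the convergent factor `c_{h}(L) h^(q+1)` times a
  -- factor tending to zero.
  have h3 := (h1.mul ((h2.sub_const (dConst (q + 1) L)).mul_const (roughness K))).abs
  rw [sub_self, zero_mul, mul_zero, abs_zero] at h3
  filter_upwards [h3.eventually_lt_const hc, eventually_ne_atTop 0] with n hn hn0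
  have hh := hb.h_pos n
  have hg := hb.g_pos n
  have hn1 : (0 : ℝ) < n := Nat.cast_pos.2 (Nat.pos_of_ne_zero hn0)
  have e : obsEnergy (q + 1) L K (h n) (g n) / n -
      normConst (q + 1) L (h n) / (n * g n) * dConst (q + 1) L * roughness K =
      normConst (q + 1) L (h n) * h n ^ (q + 1) * ((normConst (q + 1) L (h n) *
        capMoment (q + 1) (fun r => L r ^ 2) (h n) 0 - dConst (q + 1) L) * roughness K) *
        ((n : ℝ) * h n ^ (q + 1) * g n)⁻¹ := by
    rw [obsEnergy]
    field_simp
  rw [e, abs_mul, abs_of_pos (a := ((n : ℝ) * h n ^ (q + 1) * g n)⁻¹) (by positivity)]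
  exact mul_le_mul_of_nonneg_right hn.le (by positivity)

/-- The square of the mean of the estimator contributes less than its variance. -/
theorem integrated_mean_sq (hf : IsDensity f) (hfm : Measurable f) (hL : IsBorelProfile L)
    (hpos : 0 < profMoment q L 0) (hK : IsLinKernel K)
    (hb : IsBandwidth (q + 1) h g) {c : ℝ} (hc : 0 < c) :
    ∀ᶠ n : ℕ in atTop, |(∫ p, obsMoment L K (h n) (g n) f 1 p ^ 2 ∂(cyl (q + 1))) / n| ≤
        c * ((n : ℝ) * h n ^ (q + 1) * g n)⁻¹ := by
  obtain ⟨M, hM⟩ := hL.bounded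
  obtain ⟨N, hN⟩ := hK.bounded
  have hMN : 0 ≤ M * N := mul_nonneg ((hL.nonneg 0).trans (hM 0)) ((hK.nonneg 0).trans (hN 0))
  set T : ℕ → ℝ := fun B => ∫ s, max (f s - B) 0 ∂(cyl (q + 1)) with hT
  set κ := (capConst q * profMoment q L 0)⁻¹ with hκ
  -- The truncation level `B` is fixed first, so that the limit of the rescaled bound is below `c`;
  -- the term with `B` itself then vanishes because `h^(q+1) g → 0`.
  have t1 : Tendsto (fun B : ℕ => κ * (M * N) * T B) atTop (𝓝 0) := by
    simpa using (tendsto_integral_excess hf.integrable hf.nonneg).const_mul (κ * (M * N))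
  obtain ⟨B, hB⟩ := (t1.eventually_lt_const hc).exists
  have h1 := (tendsto_normConst_mul hL q hpos).comp hb.h_tendsto_pos
  have t2 : Tendsto (fun n => h n ^ (q + 1) * g n * B +
      normConst (q + 1) L (h n) * h n ^ (q + 1) * (M * N) * T B) atTop (𝓝 (κ * (M * N) * T B)) := by
    have := (((hb.h_tendsto.pow (q + 1)).mul hb.g_tendsto).mul_const (B : ℝ)).add
      ((h1.mul_const (M * N)).mul_const (T B))
    simpa only [Function.comp_def, zero_pow (Nat.succ_ne_zero q), zero_mul, zero_add] using this
  filter_upwards [t2.eventually_lt_const hB, eventually_ne_atTop 0,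
    hb.h_tendsto_pos.eventually (eventually_normMoment_zero hL q hpos)] with n hn hn0 hmass
  have hh := hb.h_pos n
  have hg := hb.g_pos n
  have hn1 : (0 : ℝ) < n := Nat.cast_pos.2 (Nat.pos_of_ne_zero hn0)
  obtain ⟨i1, e1⟩ := integral_obsMoment_one (h := h n) hL hK hg hmass hf hfm
  set D := (B : ℝ) + normConst (q + 1) L (h n) / g n * (M * N) * T B with hD
  have hle : ∫ p, obsMoment L K (h n) (g n) f 1 p ^ 2 ∂(cyl (q + 1)) ≤ D := by
    calc _ ≤ ∫ p, D * obsMoment L K (h n) (g n) f 1 p ∂(cyl (q + 1)) := by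
          refine integral_mono_of_nonneg (ae_of_all _ fun p => sq_nonneg _) (i1.const_mul D)
            (ae_of_all _ fun p => ?_)
          simp only [sq]
          exact mul_le_mul_of_nonneg_right (obsMoment_one_le hL hK hg hmass hM hN hf.integrable
            (Nat.cast_nonneg B) hf.nonneg p) (obsMoment_one_nonneg hL hK hg hf.nonneg p)
      _ = D := by rw [integral_const_mul, e1, mul_one]
  rw [abs_of_nonneg (div_nonneg (integral_nonneg fun p => sq_nonneg _) hn1.le)]
  have e : D / n = (h n ^ (q + 1) * g n * B +
      normConst (q + 1) L (h n) * h n ^ (q + 1) * (M * N) * T B) *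
        ((n : ℝ) * h n ^ (q + 1) * g n)⁻¹ := by
    rw [hD]
    field_simp
  calc _ ≤ D / n := by gcongr
    _ ≤ _ := by
        rw [e]
        exact mul_le_mul_of_nonneg_right hn.le (by positivity)

/-- The expansion of the mean integrated squared error for a Borel profile. -/
theorem dlMise_expansion (hf : IsDensity f) (hfs : SmoothDensity f) (hL : IsBorelProfile L)
    (hpos : 0 < profMoment q L 0) (hK : IsLinKernel K) (hb : IsBandwidth (q + 1) h g)
    {Ω : Type*} [MeasurableSpace Ω] (P : Measure Ω) [IsProbabilityMeasure P]
    {S : ℕ → Ω → Sph (q + 1) × ℝ} (hS : ∀ i, Measurable (S i))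
    (hind : iIndepFun S P) (hlaw : ∀ i, P.map (S i) = law f) :
    (∀ᶠ n in atTop, dlMise P S f L K (h n) (g n) n ≠ ⊤) ∧
    (fun n : ℕ => (dlMise P S f L K (h n) (g n) n).toReal -
        (bConst (q + 1) L ^ 2 * cylInt (fun p => psiX f p ^ 2) * h n ^ 4
          + 1 / 4 * mu2 K ^ 2 * cylInt (fun p => hessZ f p ^ 2) * g n ^ 4
          + bConst (q + 1) L * mu2 K * cylInt (fun p => psiX f p * hessZ f p) * (h n ^ 2 * g n ^ 2)
          + normConst (q + 1) L (h n) / (n * g n) * dConst (q + 1) L * roughness K))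
      =o[atTop] (fun n : ℕ => h n ^ 4 + g n ^ 4 + ((n : ℝ) * h n ^ (q + 1) * g n)⁻¹) := by
  have hfm := hfs.continuous.measurable
  have key : ∀ c : ℝ, 0 < c → ∀ᶠ n : ℕ in atTop, dlMise P S f L K (h n) (g n) n ≠ ⊤ ∧
      ‖(dlMise P S f L K (h n) (g n) n).toReal -
        (bConst (q + 1) L ^ 2 * cylInt (fun p => psiX f p ^ 2) * h n ^ 4
          + 1 / 4 * mu2 K ^ 2 * cylInt (fun p => hessZ f p ^ 2) * g n ^ 4
          + bConst (q + 1) L * mu2 K * cylInt (fun p => psiX f p * hessZ f p) * (h n ^ 2 * g n ^ 2)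
          + normConst (q + 1) L (h n) / (n * g n) * dConst (q + 1) L * roughness K)‖ ≤
      c * ‖h n ^ 4 + g n ^ 4 + ((n : ℝ) * h n ^ (q + 1) * g n)⁻¹‖ := by
    intro c hc
    have hc2 : 0 < c / 2 := by positivity
    filter_upwards [integrated_bias_sq hfs hf.integrable hL hpos hK hb.h_tendsto_pos hb.g_tendsto_pos hc,
      integrated_energy hL hpos K hb hc2, integrated_mean_sq hf hfm hL hpos hK hb hc2,
      eventually_ne_atTop 0] with n h1 h2 h3 hn0
    have hh := hb.h_pos n
    have hg := hb.g_pos n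
    have hn1 : (0 : ℝ) < n := Nat.cast_pos.2 (Nat.pos_of_ne_zero hn0)
    obtain ⟨htop, hreal⟩ := dlMise_eq (h := h n) P hS hind hlaw hL hK hg hf hfm hn0 h1.1
    refine ⟨htop, ?_⟩
    have hr : 0 ≤ h n ^ 4 + g n ^ 4 + ((n : ℝ) * h n ^ (q + 1) * g n)⁻¹ := by positivity
    rw [hreal, ← integral_biasMain_sq hfs, Real.norm_of_nonneg hr, Real.norm_eq_abs, sub_div]
    have b1 := abs_le.1 h1.2
    have b2 := abs_le.1 h2
    have b3 := abs_le.1 h3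
    rw [abs_le]
    constructor <;> linarith [b1.1, b1.2, b2.1, b2.2, b3.1, b3.2]
  refine ⟨(key 1 one_pos).mono fun n hn => hn.1, ?_⟩
  rw [isLittleO_iff]
  exact fun c hc => (key c hc).mono fun n hn => hn.2

end Expansion

end DirLin

namespace DirLin
open scoped ENNReal Real

/-! ### Replacing the directional kernel by a Borel version. -/

section BorelVersion

variable {q : ℕ} {L L' K : ℝ → ℝ} {h g : ℝ} {f : Sph q × ℝ → ℝ}

/-- The law of `1 - xᵀy` under the surface measure is absolutely continuous. -/
theorem ae_surf_of_ae_Ioi {p : ℝ → Prop} (hp : ∀ᵐ r ∂(volume.restrict (Set.Ioi (0 : ℝ))), p r)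
    (hh : 0 < h) (x : Sph (q + 1)) :
    ∀ᵐ y : Sph (q + 1) ∂(surf (q + 1)), p ((1 - inner ℝ (x : Amb (q + 1)) (y : Amb (q + 1))) / h ^ 2) := by
  rw [ae_restrict_iff' measurableSet_Ioi] at hp
  -- The exceptional set need not be Borel; its measurable hull is still a null set.
  set N : Set ℝ := toMeasurable volume {r | ¬(r ∈ Set.Ioi (0 : ℝ) → p r)} with hN
  have hN0 : volume N = 0 := by rw [hN, measure_toMeasurable]; exact hp
  have hNm : MeasurableSet N := measurableSet_toMeasurable _ _
  have hNp : ∀ r, 0 < r → r ∉ N → p r := fun r hr hrN => by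
    by_contra hpr
    exact hrN (subset_toMeasurable _ _ (by simpa using ⟨hr, hpr⟩))
  -- Nothing is known about `p` on `(-∞, 0]`, so this half-line is added; it does not matter, since
  -- the law of `1 - y₀` lives on `(0, 2)`.
  set B : Set ℝ := (· * (h ^ 2)⁻¹) ⁻¹' N ∪ Set.Iic 0 with hB
  have hBm : MeasurableSet B := ((measurable_id.mul_const _) hNm).union measurableSet_Iic
  have hB0 : volume ((· * (h ^ 2)⁻¹) ⁻¹' N) = 0 := by
    rw [Real.volume_preimage_mul_right (by positivity), hN0, mul_zero]
  set φ : ℝ → ℝ≥0∞ := B.indicator 1 with hφ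
  have hφm : Measurable φ := measurable_one.indicator hBm
  have hpole : ∫⁻ y : Sph (q + 1), φ (1 - (y : Amb (q + 1)) 0) ∂(surf (q + 1)) = 0 := by
    rw [lintegral_surf_first_coord q hφm]
    have : ∫⁻ t in Set.Ioo (0 : ℝ) 2, φ t * ENNReal.ofReal ((t * (2 - t)) ^ (((q + 1 : ℕ) : ℝ) / 2 - 1)) =
        ∫⁻ _ in Set.Ioo (0 : ℝ) 2, 0 := by
      refine setLIntegral_congr_fun_ae measurableSet_Ioo ?_
      filter_upwards [measure_eq_zero_iff_ae_notMem.1 hB0] with t ht ht2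
      have : t ∉ B := by
        rintro (h1 | h1)
        · exact ht h1
        · exact not_lt.2 h1 ht2.1
      simp [hφ, this]
    rw [this]
    simp
  obtain ⟨R, rfl⟩ := exists_rotAct_eq (pole (q + 1)) x
  have hx : ∫⁻ y : Sph (q + 1), φ (1 - inner ℝ (rotAct R (pole (q + 1)) : Amb (q + 1))
      (y : Amb (q + 1))) ∂(surf (q + 1)) = 0 := by
    rw [← lintegral_surf_rotAct R, ← hpole]
    refine lintegral_congr fun y => ?_
    simp only [coe_rotAct, LinearIsometryEquiv.inner_map_map, inner_pole]
  have hm : Measurable fun y : Sph (q + 1) => φ (1 - inner ℝ (rotAct R (pole (q + 1)) : Amb (q + 1))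
      (y : Amb (q + 1))) := hφm.comp (by fun_prop)
  filter_upwards [(lintegral_eq_zero_iff hm).1 hx] with y hy
  have hyB : 1 - inner ℝ (rotAct R (pole (q + 1)) : Amb (q + 1)) (y : Amb (q + 1)) ∉ B := by
    intro hmem
    simp [hφ, hmem] at hy
  simp only [hB, Set.mem_union, Set.mem_preimage, Set.mem_Iic, not_or, not_le] at hyB
  rw [div_eq_mul_inv]
  exact hNp _ (mul_pos hyB.2 (by positivity)) hyB.1

theorem normConst_congr (hLL : ∀ᵐ r ∂(volume.restrict (Set.Ioi (0 : ℝ))), L r = L' r) (hh : 0 < h) :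
    normConst (q + 1) L h = normConst (q + 1) L' h := by
  rw [normConst, normConst, kernelMass, kernelMass, integral_congr_ae (ae_surf_of_ae_Ioi hLL hh _)]

/-- For a fixed point `p` the arguments of the kernel at the sample have an absolutely continuous
law, so the two estimators at `p` agree almost surely. -/
theorem dlMise_congr {f : Sph (q + 1) × ℝ → ℝ}
    (hLL : ∀ᵐ r ∂(volume.restrict (Set.Ioi (0 : ℝ))), L r = L' r) (hh : 0 < h)
    {Ω : Type*} [MeasurableSpace Ω] (P : Measure Ω)
    {S : ℕ → Ω → Sph (q + 1) × ℝ} (hS : ∀ i, Measurable (S i)) (hlaw : ∀ i, P.map (S i) = law f)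
    (K : ℝ → ℝ) (g : ℝ) (n : ℕ) : dlMise P S f L K h g n = dlMise P S f L' K h g n := by
  unfold dlMise mise
  refine lintegral_congr fun p => lintegral_congr_ae ?_
  have hae : ∀ i, ∀ᵐ ω ∂P, L ((1 - inner ℝ (p.1 : Amb (q + 1)) ((S i ω).1 : Amb (q + 1))) / h ^ 2) =
      L' ((1 - inner ℝ (p.1 : Amb (q + 1)) ((S i ω).1 : Amb (q + 1))) / h ^ 2) := fun i => by
    have h1 : ∀ᵐ s ∂(cyl (q + 1)), L ((1 - inner ℝ (p.1 : Amb (q + 1)) (s.1 : Amb (q + 1))) / h ^ 2) =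
        L' ((1 - inner ℝ (p.1 : Amb (q + 1)) (s.1 : Amb (q + 1))) / h ^ 2) :=
      Measure.quasiMeasurePreserving_fst.ae (ae_surf_of_ae_Ioi hLL hh p.1)
    have h2 := (withDensity_absolutelyContinuous (cyl (q + 1)) fun p => ENNReal.ofReal (f p)).ae_le h1
    change ∀ᵐ s ∂(law f), _ at h2
    rw [← hlaw i] at h2
    exact ae_of_ae_map (hS i).aemeasurable h2
  filter_upwards [ae_all_iff.2 hae] with ω hω
  simp only [estimator, hω, normConst_congr hLL hh]

theorem setIntegral_profile_congr (hLL : ∀ᵐ r ∂(volume.restrict (Set.Ioi (0 : ℝ))), L r = L' r) (k : ℕ)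
    (s : ℝ) : ∫ r in Set.Ioi (0 : ℝ), L r ^ k * r ^ s = ∫ r in Set.Ioi (0 : ℝ), L' r ^ k * r ^ s :=
  integral_congr_ae (hLL.mono fun r hr => by simp only [hr])

theorem bConst_congr (hLL : ∀ᵐ r ∂(volume.restrict (Set.Ioi (0 : ℝ))), L r = L' r) (q : ℕ) :
    bConst q L = bConst q L' := by
  have h := setIntegral_profile_congr hLL 1
  simp only [pow_one] at h
  simp only [bConst, h]

theorem dConst_congr (hLL : ∀ᵐ r ∂(volume.restrict (Set.Ioi (0 : ℝ))), L r = L' r) (q : ℕ) :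
    dConst q L = dConst q L' := by
  have h := setIntegral_profile_congr hLL 1
  simp only [pow_one] at h
  simp only [dConst, h, setIntegral_profile_congr hLL 2]

/-- A directional kernel has a Borel measurable version. -/
theorem IsDirKernel.exists_borelProfile (hL : IsDirKernel L) :
    ∃ L', IsBorelProfile L' ∧ ∀ᵐ r ∂(volume.restrict (Set.Ioi (0 : ℝ))), L r = L' r := by
  obtain ⟨M, hM⟩ := hL.bounded
  have hint := hL.moment_integrable 2 one_le_two 1 (Or.inl rfl)
  have hae : AEMeasurable L (volume.restrict (Set.Ioi (0 : ℝ))) := by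
    -- For `m = 2`, `k = 1` the power of `r` has exponent zero, so this moment condition contains
    -- the measurability of `L` up to a null set.
    refine hint.1.aemeasurable.congr (ae_of_all _ fun r => ?_)
    norm_num
  -- The truncation makes the Borel version nonnegative and bounded everywhere, and changes nothing
  -- at the points of `(0, ∞)` where it agrees with `L`.
  set L' : ℝ → ℝ := fun r => max 0 (min (hae.mk L r) M) with hL'
  have hm := hae.measurable_mk
  have hLL : ∀ᵐ r ∂(volume.restrict (Set.Ioi (0 : ℝ))), L r = L' r := by
    filter_upwards [hae.ae_eq_mk, ae_restrict_mem measurableSet_Ioi] with r hr hr0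
    have hr0 : 0 < r := hr0
    rw [hL']
    simp only [← hr]
    rw [min_eq_left (hM r hr0.le), max_eq_right (hL.nonneg r hr0.le)]
  refine ⟨L', ⟨by fun_prop, fun r => le_max_left _ _, ⟨max 0 M, fun r =>
    max_le_max le_rfl (min_le_right _ _)⟩, fun m hm1 => ?_⟩, hLL⟩
  refine (hL.moment_integrable m hm1 1 (Or.inl rfl)).congr (hLL.mono fun r hr => ?_)
  simp only [hr, pow_one]

end BorelVersion

end DirLin

/-! ### The main theorem. -/

theorem mainTheorem7 (q : ℕ) (hq : 1 ≤ q)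
    (f : Sph q × ℝ → ℝ) (hf : IsDensity f) (hDL1 : SmoothDensity f)
    (L K : ℝ → ℝ) (hL : IsDirKernel L) (hK : IsLinKernel K)
    (h g : ℕ → ℝ) (hDL3 : IsBandwidth q h g)
    {Ω : Type*} [MeasurableSpace Ω] (P : Measure Ω) [IsProbabilityMeasure P]
    (S : ℕ → Ω → Sph q × ℝ) (hS : ∀ i, Measurable (S i))
    (hind : iIndepFun S P) (hlaw : ∀ i, P.map (S i) = law f) :
    (∀ᶠ n in atTop, dlMise P S f L K (h n) (g n) n ≠ ⊤) ∧
    (fun n : ℕ => (dlMise P S f L K (h n) (g n) n).toReal -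
        (bConst q L ^ 2 * cylInt (fun p => psiX f p ^ 2) * h n ^ 4
          + 1 / 4 * mu2 K ^ 2 * cylInt (fun p => hessZ f p ^ 2) * g n ^ 4
          + bConst q L * mu2 K * cylInt (fun p => psiX f p * hessZ f p) * (h n ^ 2 * g n ^ 2)
          + normConst q L (h n) / (n * g n) * dConst q L * roughness K))
      =o[atTop] (fun n : ℕ => h n ^ 4 + g n ^ 4 + ((n : ℝ) * h n ^ q * g n)⁻¹) := by
  -- The analysis is carried out on `Sph (q + 1)`, which encodes that the sphere has positive
  -- dimension.
  obtain ⟨q, rfl⟩ := Nat.exists_eq_add_of_le' hq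
  obtain ⟨L', hL', hLL⟩ := hL.exists_borelProfile
  have hpos : 0 < profMoment q L' 0 := by
    have h1 := hL.moment_pos (q + 1) (Nat.le_add_left 1 q) 1 (Or.inl rfl)
    rw [setIntegral_profile_congr hLL 1] at h1
    simpa [profMoment] using h1
  have key := dlMise_expansion hf hDL1 hL' hpos hK hDL3 P hS hind hlaw
  have e1 : ∀ n, dlMise P S f L K (h n) (g n) n = dlMise P S f L' K (h n) (g n) n := fun n =>
    dlMise_congr hLL (hDL3.h_pos n) P hS hlaw K (g n) n
  have e2 : ∀ n, normConst (q + 1) L (h n) = normConst (q + 1) L' (h n) := fun n =>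
    normConst_congr hLL (hDL3.h_pos n)
  simpa only [e1, e2, bConst_congr hLL, dConst_congr hLL] using key
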